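/- **Tessellations.** An abstract tessellation description $D=(T,n,s,v,c)$ has a finite set $T$ of tile types; a tile of type $t$ is a polygon with $N_t=n_ts_t\ge 3$ edges, numbered clockwise modulo $N_t$; edge types are the pairs $(t,i)$ with $i$ modulo $n_t$; $v(t,i)\ge 1$ is the valence of the $i$-th vertex (between edges $i-1$ and $i$), and $c$ maps edge types to edge types (connection rules). $D$ is consistent if $c\circ c=\mathrm{id}$ and, with $\nu(t,i)=(t',i'+1)$ for $c(t,i)=(t',i')$, we have $v\circ\nu=v$ and $\nu^{v(a)}(a)=a$ for every edge type $a$. A tessellation $C$ described by $D$ is, combinatorially, an infinite connected simply connected surface without boundary glued from such polygons, following $c$, whose vertices have exactly the valences $v$ (so $C$ is a periodic tessellation of the Euclidean or hyperbolic plane). A treewalker is a pair (tile, edge faced); it can rotate and step forward. $\delta_C(g)$ is the length of a shortest path of adjacent tiles from the root tile $g_0$ to $g$. **Tree structures.** A regular tree structure (RTS) is a finite set $Q$ of states with a root state $q_0$, types $t(q)\in T$ and transition rules $e(q,i)\in Q\cup\{L,R,P\}$, $i$ modulo $N_{t(q)}$, such that $P$ occurs at most once in each state and not in $q_0$, and if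 $e(q,i)=q'\in Q$ then $P$ occurs in $q'$, at an edge $p(q')$ with $c(t(q),i)=(t(q'),p(q'))$. It generates tiles and connections from a root tile of state $q_0$: if $e(q,i)=q'\in Q$, a tile of state $q$ has at edge $i$ a new child of state $q'$, attached by the edge $p(q')$; if $e(q,i)=R$, then edge $i$ of a tile $g$ of state $q$ is connected to $(g',i')$, reached from $(g,i+1)$ by stepping forward (over connections generated before) and rotating clockwise $v(t(q),i+1)-1$ times, provided that the rule there is $L$; $L$ is treated symmetrically. The RTS is a *correct geodesic RTS (GRTS) for $C$ with root tile $g_0$* if the generated structure is a copy of $C$ (a bijection of the pairs (tile, edge) that preserves types, numbering and root, such that the generated connections are exactly those of $C$), and the depth of every tile in the tree equals its distance $\delta_C$ from $g_0$. **The algorithm.** (a) *Approximation of $C$ and $\delta$.* The algorithm keeps a finite set $G$ of generated tiles with partially known connections and values $\delta(g)\in\mathbb N\cup\{\infty\}$. Initially $G$ is a single unconnected tile $g_0$, with $\delta(g_0)=0$. The following operations are performed, in any order. When a treewalker steps over an unknown connection, a new tile with $\delta=\infty$ is created and connected according to $c$. If all $v$ tiles around a vertex are known, the first and the last are connected; if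 more are known, the first and the $(v+1)$-st treewalker around the vertex are unified. Unification of treewalkers (union-find with rotations) moves the connections of one tile to the other, recursively unifies the neighbors where both tiles already had one, and takes the minimum of the two values of $\delta$. If adjacent $g_1,g_2$ have $\delta(g_1)+1<\delta(g_2)$, then $\delta(g_2)$ is set to $\delta(g_1)+1$. Tiles can be marked as solid; changing $\delta$ of a solid tile is a distance error, after which the current iteration has to be restarted. Known closed loops of treewalker movements may be recorded as shortcuts for the type of their starting edge; a shortcut may be repeated from a treewalker at an edge of the same type, and its end is then unified with its start. (b) *Parents and sides.* The parent direction of $g$ with $0<\delta(g)<\infty$ is chosen among the edges $i$ leading to a tile with $\delta=\delta(g)-1$: the smallest $i \bmod n_t$, ties being broken by the lexicographically earliest sequence of turns of the path to the root which starts with $i$ and follows the parents. The side of a non-tree edge (an edge that is not a parent edge of either of its tiles) is found by two treewalkers moving from it along the non-tree edges, to the left and to the right, the one with smaller $\delta$ first, until one reaches the other side of the edge. (c) *States.* An edge is classified as parent, child, or non-tree with its side and the difference $\delta(g)-\delta(g')\in\{-1,0,1\}$. The state $E(g)$ consists of the type of $g$, its parent index modulo $n_t$ (or that it is the root), and the answers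 to a sequence of queries given by decision trees, which classify first all edges of $g$, counted from the parent edge, and then possibly edges of descendants of $g$ found by earlier queries. The algorithm maintains a finite set $S\ni g_0$ of tiles and the decision trees, adding or dropping tiles and extending leaves (or resetting both to the initial state) by any strategy. $S$ is closed if every child of a tile of $S$ has the state of some tile of $S$, and consistent if matching children of tiles of $S$ of equal states have equal states. If both hold, the candidate RTS has the states $E(g)$, $g\in S$, the root state $E(g_0)$, and the rules read off from the tiles in $S$. (d) *Validation.* A state is dead if all its children are dead (as a least fixed point) and live otherwise. The root state has to be live. For every state $q$ and all cyclically consecutive live children $i_1,i_2$ of $q$, without a parent edge in between, two treewalkers start in a tile of $S$ of state $q$ and move along the wall of non-tree edges between $i_1$ and $i_2$, one to the left and one to the right; whenever one moves to a child, the state of the child must be the one given by the rules. The right walker pushes edges labelled $R$ on its stack, and at an edge labelled $L$ it pops an edge, which has to be the same edge of the tessellation seen from its other side; the left walker acts symmetrically. With both stacks empty, the left walker at an edge labelled $R$ and the right walker at an edge labelled $L$ must face the two sides of the same edge; then the states and faced edges of both are noted, together with those of their ancestors down to the first live tile if they are in a dead branch, and both advance. The examination of this wall ends successfully if the same note was made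 before (possibly for another wall). The algorithm *terminates successfully* with a candidate RTS $R$ if there is no distance error in the current iteration; all used parent directions, sides and distances (of solid tiles) are valid for the approximation at the end of the iteration, in which all valence checks, unifications and distance updates have been carried out; $S$ is closed and consistent; and $R$ is the candidate and passes the validation. **Theorem.** Let $D$ be a consistent abstract tessellation description, $C$ a tessellation described by $D$, and $g_0$ a tile of $C$ of type $t_0$ (numbered so that its edge $0$ has the type $(t_0,0)$). If some run of the algorithm for $D$, started with a single tile of type $t_0$, terminates successfully and returns $R$, then $R$ is a correct GRTS for $C$ with root tile $g_0$. -/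

import Mathlib

open Classical

noncomputable section

/-! ## Abstract tessellation descriptions and tessellations -/

/-- An abstract tessellation description `(T, n, s, v, c)`.  A tile of type `t` is a polygon with
`n t * s t` edges and `s t`-fold rotational symmetry; an edge type is a pair `⟨t, i⟩` with `i`
modulo `n t`. -/
structure ATD where
  T : Type
  finite_T : Finite T
  n : T → ℕ
  s : T → ℕ
  v : (Σ t : T, ZMod (n t)) → ℕ
  c : (Σ t : T, ZMod (n t)) → (Σ t : T, ZMod (n t))
  polygon : ∀ t, 3 ≤ n t * s t
  valence_pos : ∀ a, 0 < v a

namespace ATD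

/-- The set of edge types. -/
abbrev Edge (D : ATD) : Type := Σ t : D.T, ZMod (D.n t)

/-- The number of edges of a tile of type `t`. -/
def sides (D : ATD) (t : D.T) : ℕ := D.n t * D.s t

/-- The edge type of the `i`-th edge of a tile of type `t`. -/
def edge (D : ATD) (t : D.T) (i : ℤ) : D.Edge := ⟨t, (i : ZMod (D.n t))⟩

/-- Clockwise next edge type of the same tile. -/
def succ (D : ATD) (a : D.Edge) : D.Edge := ⟨a.1, a.2 + 1⟩

/-- The next edge around a vertex. -/
def next (D : ATD) (a : D.Edge) : D.Edge := D.succ (D.c a)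

def Consistent (D : ATD) : Prop :=
  (∀ a, D.c (D.c a) = a) ∧ (∀ a, D.v (D.next a) = D.v a) ∧ (∀ a, (D.next)^[D.v a] a = a)

end ATD

/-- The two elementary moves of a treewalker: rotate clockwise by one edge, and step forward. -/
inductive Move
  | rot
  | step

/-- The position reached from a dart by a sequence of moves, executed from left to right. -/
def moveAlong {X : Type*} (r s : X → X) : X → List Move → X
  | d, [] => d
  | d, Move.rot :: l => moveAlong r s (r d) l
  | d, Move.step :: l => moveAlong r s (s d) l

/-- Homotopy of move sequences from a fixed dart: going once around a tile (`N` rotations),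
crossing an edge and returning, and going once around a vertex (`V` times step forward and rotate)
may be inserted and removed. -/
inductive Homotopic {X : Type*} (r s : X → X) (N V : X → ℕ) (d : X) :
    List Move → List Move → Prop
  | refl (l) : Homotopic r s N V d l l
  | symm {l m} : Homotopic r s N V d l m → Homotopic r s N V d m l
  | trans {l m k} : Homotopic r s N V d l m → Homotopic r s N V d m k → Homotopic r s N V d l k
  | face (l m) : Homotopic r s N V d (l ++ m)
      (l ++ List.replicate (N (moveAlong r s d l)) Move.rot ++ m)
  | edge (l m) : Homotopic r s N V d (l ++ m) (l ++ [Move.step, Move.step] ++ m)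
  | vertex (l m) : Homotopic r s N V d (l ++ m)
      (l ++ (List.replicate (V (moveAlong r s d l)) [Move.step, Move.rot]).flatten ++ m)

/-- A periodic tessellation of the plane (Euclidean or hyperbolic) described by `D`, through its
combinatorial structure.  A dart is a pair (tile, edge of this tile), i.e. a position of a
treewalker; tiles are the orbits of `rot`, vertices are the orbits of `rot ∘ step`.  The surface
glued from the polygons is connected, simply connected and not compact. -/
structure Tessellation (D : ATD) where
  Dart : Type*
  rot : Equiv.Perm Dart
  step : Dart → Dart
  lab : Dart → D.Edge
  step_step : ∀ d, step (step d) = d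
  step_ne : ∀ d, step d ≠ d
  lab_rot : ∀ d, lab (rot d) = D.succ (lab d)
  lab_step : ∀ d, lab (step d) = D.c (lab d)
  face_size : ∀ d, Function.minimalPeriod rot d = D.sides (lab d).1
  vertex_size : ∀ d, Function.minimalPeriod (fun x => rot (step x)) d = D.v (lab d)
  connected : ∀ d d', ∃ l, moveAlong rot step d l = d'
  simply_connected : ∀ d l, moveAlong rot step d l = d →
    Homotopic rot step (fun x => D.sides (lab x).1) (fun x => D.v (lab x)) d l []
  infinite : Infinite Dart

/-- `C.Reach k d d'`: there is a path from the tile of `d` to the tile of `d'` crossing `k` edges. -/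
inductive Tessellation.Reach {D : ATD} (C : Tessellation D) : ℕ → C.Dart → C.Dart → Prop
  | refl (d) : C.Reach 0 d d
  | rot {k d d'} : C.Reach k d d' → C.Reach k d (C.rot d')
  | step {k d d'} : C.Reach k d d' → C.Reach (k + 1) d (C.step d')

/-! ## Regular tree structures -/

/-- The values of a transition rule. -/
inductive TreeEdge (Q : Type*)
  | left
  | right
  | parent
  | child (q : Q)

/-- The data of a regular tree structure over a type `Q` containing its states. -/
structure RTS (D : ATD) (Q : Type*) where
  states : Set Q
  typ : Q → D.T
  e : Q → ℤ → TreeEdge Q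
  root : Q

namespace RTS

variable {D : ATD} {Q : Type*}

/-- The conditions in the definition of a regular tree structure (with a root state). -/
structure WellFormed (R : RTS D Q) : Prop where
  finite : R.states.Finite
  root_mem : R.root ∈ R.states
  child_mem : ∀ q ∈ R.states, ∀ i q', R.e q i = .child q' → q' ∈ R.states
  periodic : ∀ q ∈ R.states, ∀ i, R.e q (i + D.sides (R.typ q)) = R.e q i
  parent_unique : ∀ q ∈ R.states, ∀ i j, R.e q i = .parent → R.e q j = .parent →
    i ≡ j [ZMOD D.sides (R.typ q)]
  root_parent : ∀ i, R.e R.root i ≠ .parent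
  child_connects : ∀ q ∈ R.states, ∀ i q', R.e q i = .child q' →
    ∃ j, R.e q' j = .parent ∧ D.c (D.edge (R.typ q) i) = D.edge (R.typ q') j

/-- The tiles generated by the tree are named by the sequence of edges leading to them from the
root tile (the last edge is the head of the list); `stateAt` is the state of such a tile. -/
def stateAt (R : RTS D Q) : List ℤ → Option Q
  | [] => some R.root
  | i :: p => (R.stateAt p).bind fun q =>
      if 0 ≤ i ∧ i < D.sides (R.typ q) then
        match R.e q i with
        | .child q' => some q'
        | _ => none
      else none

/-- `(p, i)` is a generated tile `p` together with one of its edges. -/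
def IsDart (R : RTS D Q) (w : List ℤ × ℤ) : Prop :=
  ∃ q, R.stateAt w.1 = some q ∧ 0 ≤ w.2 ∧ w.2 < D.sides (R.typ q)

/-- Rotating a treewalker in the generated structure clockwise by `k` edges. -/
def rot (R : RTS D Q) (k : ℤ) (w : List ℤ × ℤ) : List ℤ × ℤ :=
  match R.stateAt w.1 with
  | some q => (w.1, (w.2 + k) % D.sides (R.typ q))
  | none => w

def edgeAt (R : RTS D Q) (w : List ℤ × ℤ) : Option (TreeEdge Q) :=
  (R.stateAt w.1).map fun q => R.e q w.2

def valence (R : RTS D Q) (w : List ℤ × ℤ) : ℕ :=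
  match R.stateAt w.1 with
  | some q => D.v (D.edge (R.typ q) w.2)
  | none => 0

/-- The connections generated from the tree structure.  Tree edges connect a tile with its
children.  A right edge `(g, i)` is connected by going around the `i+1`-st vertex of `g`: starting
from `(g, i+1)`, one steps forward (over connections generated before) and rotates clockwise
`v - 1` times, and arrives at a left edge.  Left edges are treated symmetrically. -/
inductive Conn (R : RTS D Q) : List ℤ × ℤ → List ℤ × ℤ → Prop
  | child {p i j} : R.IsDart (p, i) → R.IsDart (i :: p, j) →
      R.edgeAt (i :: p, j) = some .parent → R.Conn (p, i) (i :: p, j)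
  | symm {a b} : R.Conn a b → R.Conn b a
  | right {a} (f g : ℕ → List ℤ × ℤ) : R.IsDart a → R.edgeAt a = some .right →
      f 0 = R.rot 1 a →
      (∀ k < R.valence (R.rot 1 a) - 1, R.Conn (f k) (g k)) →
      (∀ k < R.valence (R.rot 1 a) - 1, f (k + 1) = R.rot 1 (g k)) →
      R.edgeAt (f (R.valence (R.rot 1 a) - 1)) = some .left →
      R.Conn a (f (R.valence (R.rot 1 a) - 1))
  | left {a} (f g : ℕ → List ℤ × ℤ) : R.IsDart a → R.edgeAt a = some .left →
      f 0 = R.rot (-1) a →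
      (∀ k < R.valence a - 1, R.Conn (f k) (g k)) →
      (∀ k < R.valence a - 1, f (k + 1) = R.rot (-1) (g k)) →
      R.edgeAt (f (R.valence a - 1)) = some .right →
      R.Conn a (f (R.valence a - 1))

/-- The structure generated by `R` is a copy of `C`, with the root tile at the tile of `d₀`:
every tile of `C` appears exactly once in the tree, and the generated connections are exactly
those of `C`. -/
structure IsCopy (R : RTS D Q) (C : Tessellation D) (d₀ : C.Dart)
    (φ : {w // R.IsDart w} ≃ C.Dart) : Prop where
  root : ∀ h, φ ⟨([], 0), h⟩ = d₀
  lab : ∀ w q, R.stateAt w.1.1 = some q → C.lab (φ w) = D.edge (R.typ q) w.1.2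
  rot : ∀ w w', w'.1 = R.rot 1 w.1 → φ w' = C.rot (φ w)
  conn : ∀ w w', R.Conn w.1 w'.1 ↔ C.step (φ w) = φ w'

/-- The depth of every tile in the tree is its distance from the root tile in `C`. -/
def Geodesic (R : RTS D Q) (C : Tessellation D) (d₀ : C.Dart)
    (φ : {w // R.IsDart w} ≃ C.Dart) : Prop :=
  ∀ w, IsLeast {k | C.Reach k d₀ (φ w)} w.1.1.length

/-- `R` is a geodesic regular tree structure generating `C` from the tile of `d₀`. -/
def IsGRTSFor (R : RTS D Q) (C : Tessellation D) (d₀ : C.Dart) : Prop :=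
  R.WellFormed ∧ ∃ φ : {w // R.IsDart w} ≃ C.Dart, R.IsCopy C d₀ φ ∧ R.Geodesic C d₀ φ

/-- Dead branches: a branch is dead if all its children are dead. -/
inductive Dead (R : RTS D Q) : Q → Prop
  | mk {q} : (∀ i q', R.e q i = .child q' → R.Dead q') → R.Dead q

def LiveChild (R : RTS D Q) (q : Q) (i : ℤ) : Prop :=
  ∃ q', R.e q i = .child q' ∧ ¬ R.Dead q'

/-- `i₁`, `i₂` are (cyclically) consecutive live children of `q`: clockwise from `i₁` to `i₂` there
is no other live child nor a parent.  (They coincide modulo the number of edges if `q` has no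
parent and only one live child.) -/
def BranchPair (R : RTS D Q) (q : Q) (i₁ i₂ : ℤ) : Prop :=
  i₁ < i₂ ∧ i₂ ≤ i₁ + D.sides (R.typ q) ∧ R.LiveChild q i₁ ∧ R.LiveChild q i₂ ∧
    ∀ i, i₁ < i → i < i₂ → ¬ R.LiveChild q i ∧ R.e q i ≠ .parent

end RTS

/-! ## Lazily generated approximations of the tessellation -/

/-- A treewalker: (identifier of) a generated tile, and an edge index. -/
abbrev Walker : Type := ℕ × ℤ

/-- The state of the lazily generated approximation.  Tiles `0, …, size - 1` have been generated;
`conn` holds the known connections (`none` is NULL); `u g` is the treewalker with which the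
treewalker `(g, 0)` has been unified (the representative, `(g, 0)` itself if `g` is its own
representative); `pending` are the pairs of treewalkers still to be unified; `dist` is the currently
known value of `δ`; `solid` are the tiles whose `δ` has been used; `distErr` says that a distance
error has occurred; `shortcuts` are the recorded loops, each with the type of its first edge. -/
structure Approx (D : ATD) where
  size : ℕ
  ty : ℕ → D.T
  conn : ℕ → ℤ → Option Walker
  u : ℕ → Walker
  pending : List (Walker × Walker)
  dist : ℕ → ℕ∞
  solid : Set ℕ
  distErr : Prop
  shortcuts : List (D.Edge × List ℤ)

namespace Approx

variable {D : ATD}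

/-- One unconnected tile `g₀ = 0` of type `t₀`. -/
def start (D : ATD) (t₀ : D.T) : Approx D where
  size := 1
  ty := fun _ => t₀
  conn := fun _ _ => none
  u := fun g => (g, 0)
  pending := []
  dist := fun g => if g = 0 then 0 else ⊤
  solid := ∅
  distErr := False
  shortcuts := []

/-- Current tiles: generated tiles that are their own representatives. -/
def IsTile (s : Approx D) (g : ℕ) : Prop := g < s.size ∧ s.u g = (g, 0)

def IsWalker (s : Approx D) (w : Walker) : Prop :=
  s.IsTile w.1 ∧ 0 ≤ w.2 ∧ w.2 < D.sides (s.ty w.1)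

/-- Rotate clockwise by `k` edges. -/
def rot (s : Approx D) (k : ℤ) (w : Walker) : Walker := (w.1, (w.2 + k) % D.sides (s.ty w.1))

/-- Find the representative of a treewalker. -/
def find (s : Approx D) (w : Walker) : Walker := s.rot w.2 (s.u w.1)

/-- Step forward over a known connection. -/
def fwd (s : Approx D) (w : Walker) : Option Walker := (s.conn w.1 w.2).map s.find

def edge (s : Approx D) (w : Walker) : D.Edge := D.edge (s.ty w.1) w.2

/-- The current representative of the root tile, in the orientation of the root. -/
def rootWalker (s : Approx D) : Walker := s.find (0, 0)

/-- `k` times step forward over a known connection and rotate clockwise: going around a vertex. -/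
def around (s : Approx D) : ℕ → Walker → Option Walker
  | 0, w => some w
  | k + 1, w => (s.fwd w).bind fun x => s.around k (s.rot 1 x)

/-- Repeat a sequence of treewalker movements, given by the turns made after each step forward. -/
def follow (s : Approx D) : List ℤ → Walker → Option Walker
  | [], w => some w
  | k :: p, w => (s.fwd w).bind fun x => s.follow p (s.rot k x)

/-- Connect two treewalkers. -/
def connect (s : Approx D) (a b : Walker) : Approx D :=
  { s with conn := fun g i =>
      if (g, i) = a then some b else if (g, i) = b then some a else s.conn g i }

/-- Create a new tile (number `s.size`) and connect `w` to it, following the connection rules. -/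
def generate (s : Approx D) (w : Walker) : Approx D :=
  connect
    { s with
      size := s.size + 1
      ty := fun g => if g = s.size then (D.c (s.edge w)).1 else s.ty g }
    w (s.size, ((D.c (s.edge w)).2.val : ℤ))

/-- Add a pair of treewalkers to be unified. -/
def demand (s : Approx D) (a b : Walker) : Approx D := { s with pending := (a, b) :: s.pending }

/-- Unify the treewalkers `a` and `b` of two different current tiles: `b.1` is attached to `a.1`
with the appropriate rotation, its connections are moved to `a.1`, the neighbors are to be unified
where both tiles already had one, and the minimum of the distances is taken. -/
def merge (s : Approx D) (a b : Walker) (rest : List (Walker × Walker)) : Approx D :=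
  { s with
    u := fun g => if (s.u g).1 = b.1 then s.rot ((s.u g).2 + (a.2 - b.2)) (a.1, 0) else s.u g
    conn := fun g i =>
      if g = a.1 then
        match s.conn a.1 i with
        | some x => some x
        | none => s.conn b.1 (s.rot (i - (a.2 - b.2)) (b.1, 0)).2
      else s.conn g i
    pending := (List.range (D.sides (s.ty a.1))).filterMap (fun j : ℕ =>
        match s.conn a.1 j, s.conn b.1 (s.rot (j - (a.2 - b.2)) (b.1, 0)).2 with
        | some x, some y => some (x, y)
        | _, _ => none) ++ rest
    dist := fun g => if g = a.1 then min (s.dist a.1) (s.dist b.1) else s.dist g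
    solid := {g | g ∈ s.solid ∨ (g = a.1 ∧ b.1 ∈ s.solid)}
    distErr := s.distErr ∨ (a.1 ∈ s.solid ∧ s.dist b.1 < s.dist a.1) ∨
      (b.1 ∈ s.solid ∧ s.dist a.1 < s.dist b.1) }

/-- The elementary operations on the approximation.  They may be performed in any order, so that
every strategy of choosing them is covered. -/
inductive Step : Approx D → Approx D → Prop
  /-- A treewalker steps forward over an unknown connection. -/
  | generate (s : Approx D) (w) : s.IsWalker w → s.fwd w = none → Step s (s.generate w)
  /-- Valence check: if all the tiles around a vertex are known, connect the first and the last. -/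
  | close (s : Approx D) (w w') : s.IsWalker w → s.around (D.v (s.edge w) - 1) w = some w' →
      s.fwd w' = none → s.fwd (s.rot (-1) w) = none → Step s (s.connect w' (s.rot (-1) w))
  /-- Valence check: if too many tiles around a vertex are known, two of them are the same. -/
  | overfull (s : Approx D) (w w') : s.IsWalker w → s.around (D.v (s.edge w)) w = some w' →
      w' ≠ w → Step s (s.demand w w')
  /-- Perform a unification. -/
  | unify (s : Approx D) (a b rest) : s.pending = (a, b) :: rest →
      (s.find a).1 ≠ (s.find b).1 → Step s (s.merge (s.find a) (s.find b) rest)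
  /-- The pair to be unified has already been unified. -/
  | unified (s : Approx D) (a b rest) : s.pending = (a, b) :: rest →
      (s.find a).1 = (s.find b).1 → Step s { s with pending := rest }
  /-- Update a distance; changing it for a solid tile is a distance error. -/
  | relax (s : Approx D) (w w') : s.IsWalker w → s.fwd w = some w' →
      s.dist w.1 + 1 < s.dist w'.1 →
      Step s { s with
        dist := fun g => if g = w'.1 then s.dist w.1 + 1 else s.dist g
        distErr := s.distErr ∨ w'.1 ∈ s.solid }
  /-- Mark a tile as solid. -/
  | solidify (s : Approx D) (g) : s.IsTile g → Step s { s with solid := insert g s.solid }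
  /-- Restart: the results obtained so far are forgotten. -/
  | restart (s : Approx D) : Step s { s with solid := ∅, distErr := False }
  /-- Record a shortcut: a known loop (such as the one composed of two paths from a tile that meet
  again), for the type of the tile and of the edge where it starts. -/
  | record (s : Approx D) (w p) : s.IsWalker w → s.follow p w = some w →
      Step s { s with shortcuts := (s.edge w, p) :: s.shortcuts }
  /-- Repeat a recorded shortcut from another tile of the same type; its ends are the same. -/
  | shortcut (s : Approx D) (w w' p) : s.IsWalker w → (s.edge w, p) ∈ s.shortcuts →
      s.follow p w = some w' → w' ≠ w → Step s (s.demand w w')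

/-- All consequences of what is known have been drawn: no unification is pending, the valence checks
have been made, and the distances have been updated. -/
structure Stable (s : Approx D) : Prop where
  no_pending : s.pending = []
  not_overfull : ∀ w w', s.IsWalker w → s.around (D.v (s.edge w)) w = some w' → w' = w
  closed : ∀ w w', s.IsWalker w → s.around (D.v (s.edge w) - 1) w = some w' → s.fwd w' ≠ none
  relaxed : ∀ w w', s.IsWalker w → s.fwd w = some w' → s.dist w'.1 ≤ s.dist w.1 + 1

/-! ## Parents and sides -/

/-- `i` is a parent candidate for `g`: it leads to a tile closer to the root by one. -/
def Candidate (s : Approx D) (g : ℕ) (i : ℤ) : Prop :=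
  s.IsWalker (g, i) ∧ g ∈ s.solid ∧ ∃ w, s.fwd (g, i) = some w ∧ w.1 ∈ s.solid ∧
    ∃ k : ℕ, s.dist g = (k + 1 : ℕ) ∧ s.dist w.1 = k

/-- The sequence of turns of the path that starts by stepping forward from the given treewalker and
then follows the parents; the tile reached first is at distance `k` from the root. -/
def turns (s : Approx D) (par : ℕ → Option ℤ) : ℕ → Walker → Option (List ℤ)
  | 0, _ => some []
  | k + 1, w => (s.fwd w).bind fun x => (par x.1).bind fun p =>
      (turns s par k (x.1, p)).map fun l => ((p - x.2) % D.sides (s.ty x.1)) :: l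

/-- The rule for choosing the parent direction: the parent candidate with the smallest index modulo
`n`; among several of them, the one generating the lexicographically earliest path. -/
def IsParentDir (s : Approx D) (par : ℕ → Option ℤ) (g : ℕ) (i : ℤ) : Prop :=
  s.Candidate g i ∧ ∀ j, s.Candidate g j → j ≠ i →
    i % D.n (s.ty g) < j % D.n (s.ty g) ∨
    (i % D.n (s.ty g) = j % D.n (s.ty g) ∧
      ∃ k : ℕ, s.dist g = (k + 1 : ℕ) ∧
        ∃ l m, s.turns par k (g, i) = some l ∧ s.turns par k (g, j) = some m ∧ ¬ m < l)

def ParentEdge (par : ℕ → Option ℤ) (w : Walker) : Prop := par w.1 = some w.2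

def ChildEdge (s : Approx D) (par : ℕ → Option ℤ) (w : Walker) : Prop :=
  ∃ w', s.fwd w = some w' ∧ ParentEdge par w'

/-- The parent direction of `g` has been determined, or `g` is the root. -/
def ParentKnown (s : Approx D) (par : ℕ → Option ℤ) (g : ℕ) : Prop :=
  par g ≠ none ∨ g = s.rootWalker.1

def NonTreeEdge (s : Approx D) (par : ℕ → Option ℤ) (w : Walker) : Prop :=
  ∃ w', s.fwd w = some w' ∧ s.ParentKnown par w.1 ∧ s.ParentKnown par w'.1 ∧
    ¬ ParentEdge par w ∧ ¬ ParentEdge par w'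

/-- Moving along a wall (to the right for `ε = 1`, to the left for `ε = -1`): cross tree edges and
rotate until a non-tree edge is faced. -/
inductive Face (s : Approx D) (par : ℕ → Option ℤ) (ε : ℤ) : Walker → Walker → Prop
  | touch {w} : s.NonTreeEdge par w → Face s par ε w w
  | cross {w w' z} : ParentEdge par w ∨ s.ChildEdge par w → s.fwd w = some w' →
      Face s par ε (s.rot ε w') z → Face s par ε w z

end Approx

/-- The side labels of non-tree edges. -/
inductive Side
  | left
  | right

namespace Approx

variable {D : ATD}

/-- `GetSide target a b x`: of the left-moving treewalker `a` and the right-moving treewalker `b`,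
the one closer to the root moves first, until one of them reaches the target; `x` tells which. -/
inductive GetSide (s : Approx D) (par : ℕ → Option ℤ) (target : Walker) :
    Walker → Walker → Side → Prop
  | doneLeft {b} : GetSide s par target target b .left
  | doneRight {a} : GetSide s par target a target .right
  | moveLeft {a b a' x} : a ≠ target → b ≠ target → s.dist a.1 ≤ s.dist b.1 →
      s.Face par (-1) (s.rot (-1) a) a' → GetSide s par target a' b x → GetSide s par target a b x
  | moveRight {a b b' x} : a ≠ target → b ≠ target → s.dist b.1 ≤ s.dist a.1 →
      s.Face par 1 (s.rot 1 b) b' → GetSide s par target a b' x → GetSide s par target a b x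

end Approx

/-! ## States -/

/-- The eight possible relationships of a tile `g` with its neighbor `g'` over an edge: parent,
child, or non-tree with the given side and the given value of `δ(g) - δ(g')`. -/
inductive Cls
  | parent
  | child
  | nontree (side : Side) (diff : SignType)

/-- A state is a leaf of the decision trees: the type of the tile, the index of the parent edge
modulo `n` (`none` for the root), and the sequence of answers to the queries. -/
@[ext]
structure Code (D : ATD) where
  typ : D.T
  par : Option ℤ
  ans : List Cls

/-- Decision trees: the query `(i, j)` asked at a given node, or `none` at a leaf. -/
abbrev Rules (D : ATD) : Type := D.T → Option ℤ → List Cls → Option (ℕ × ℕ)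

/-- Initially only the edges of the tile itself are classified. -/
def Rules.start (D : ATD) : Rules D := fun t _ l =>
  if l.length < D.sides t then some (0, l.length) else none

/-- Extend a leaf of the decision trees by a query. -/
def Rules.extend {D : ATD} (r : Rules D) (q : Code D) (ij : ℕ × ℕ) : Rules D := fun t p l =>
  if t = q.typ ∧ p = q.par ∧ l = q.ans then some ij else r t p l

/-- What the algorithm knows and has cached: the approximation, the parent directions, the sides of
non-tree edges, and the decision trees. -/
structure Info (D : ATD) where
  s : Approx D
  par : ℕ → Option ℤ
  side : Walker → Option Side
  rules : Rules D

namespace Info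

variable {D : ATD}

/-- The cached parent directions and sides are those determined by the rules. -/
structure Valid (I : Info D) : Prop where
  parent : ∀ g i, I.par g = some i → I.s.IsParentDir I.par g i
  side : ∀ w x, I.side w = some x →
    I.s.NonTreeEdge I.par w ∧ ∃ w', I.s.fwd w = some w' ∧ I.s.GetSide I.par w' w w x

/-- Classification of the edge faced by a treewalker. -/
inductive Classify (I : Info D) : Walker → Cls → Prop
  | parent {w} : Approx.ParentEdge I.par w → Classify I w .parent
  | child {w} : I.s.ChildEdge I.par w → Classify I w .child
  | nontree {w w' x} (d : SignType) (a b : ℕ) : I.s.NonTreeEdge I.par w → I.side w = some x →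
      I.s.fwd w = some w' → w.1 ∈ I.s.solid → w'.1 ∈ I.s.solid →
      I.s.dist w.1 = a → I.s.dist w'.1 = b → (a : ℤ) - b = (d : ℤ) →
      Classify I w (.nontree x d)

/-- The treewalker from which the edges of a tile are counted: `(g, p(g))`, and for the root tile
its original edge `0`. -/
def base (I : Info D) (g : ℕ) : Option Walker :=
  if g = I.s.rootWalker.1 then some I.s.rootWalker else (I.par g).map fun p => (g, p)

/-- The part of a state known before the queries: the parent index modulo `n`. -/
def parIndex (I : Info D) (b : Walker) : Option ℤ :=
  if b.1 = I.s.rootWalker.1 then none else some (b.2 % D.n (I.s.ty b.1))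

/-- The queries asked for a tile with the given type and parent index and with base `b`, the list
of treewalkers after stepping over the edges asked about (preceded by `b`), and the list of answers.
The query `(0, j)` is about the base rotated by `j` steps, the query `(i, j)` with `i > 0` is about
the treewalker in the child found by the `i`-th query, rotated by `j` steps from its parent edge. -/
inductive Asked (I : Info D) (t : D.T) (p : Option ℤ) (b : Walker) :
    List Walker → List Cls → Prop
  | start : Asked I t p b [b] []
  | ask {ws l i j w w' c} : Asked I t p b ws l → I.rules t p l = some (i, j) →
      (i = 0 ∨ l[i - 1]? = some Cls.child) → ws[i]? = some w →
      I.Classify (I.s.rot j w) c → I.s.fwd (I.s.rot j w) = some w' →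
      Asked I t p b (ws ++ [w']) (l ++ [c])

/-- `E(g) = q`. -/
def HasState (I : Info D) (g : ℕ) (q : Code D) : Prop :=
  I.s.IsTile g ∧ q.typ = I.s.ty g ∧ ∃ b, I.base g = some b ∧ q.par = I.parIndex b ∧
    (∃ ws, I.Asked q.typ q.par b ws q.ans) ∧ I.rules q.typ q.par q.ans = none

/-- `w` is at a tile of state `q`, facing the edge with index `i` in the numbering of the state
(where the parent edge has the index `q.par`). -/
def At (I : Info D) (w : Walker) (q : Code D) (i : ℤ) : Prop :=
  I.s.IsWalker w ∧ I.HasState w.1 q ∧ ∃ b, I.base w.1 = some b ∧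
    i = (w.2 - b.2 + q.par.getD 0) % D.sides q.typ

/-! ## Closed and consistent sets, the candidate tree structure -/

/-- The current tiles represented by the elements of `S`. -/
def current (I : Info D) (S : Finset ℕ) : Set ℕ := {g | ∃ h ∈ S, (I.s.u h).1 = g}

/-- Every child of a tile in `S` has the state of some tile in `S`. -/
def Closed (I : Info D) (S : Finset ℕ) : Prop :=
  ∀ w w', w.1 ∈ I.current S → I.s.IsWalker w → I.s.ChildEdge I.par w → I.s.fwd w = some w' →
    ∃ g ∈ I.current S, ∃ q, I.HasState w'.1 q ∧ I.HasState g q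

/-- Matching children of two tiles of `S` of the same state have the same state. -/
def Consistent (I : Info D) (S : Finset ℕ) : Prop :=
  ∀ w₁ w₂ q i w₁' w₂', w₁.1 ∈ I.current S → w₂.1 ∈ I.current S → I.At w₁ q i → I.At w₂ q i →
    I.s.ChildEdge I.par w₁ → I.s.ChildEdge I.par w₂ → I.s.fwd w₁ = some w₁' →
    I.s.fwd w₂ = some w₂' → ∃ q', I.HasState w₁'.1 q' ∧ I.HasState w₂'.1 q'

/-- The transition rule value read off from a classification. -/
inductive Reads (I : Info D) (w : Walker) : Cls → TreeEdge (Code D) → Prop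
  | parent : Reads I w .parent .parent
  | child {w' q} : I.s.fwd w = some w' → I.HasState w'.1 q → Reads I w .child (.child q)
  | left (d) : Reads I w (.nontree .left d) .left
  | right (d) : Reads I w (.nontree .right d) .right

/-- `R` is the tree structure built from `S`. -/
structure IsCandidate (I : Info D) (S : Finset ℕ) (R : RTS D (Code D)) : Prop where
  states : R.states = {q | ∃ g ∈ I.current S, I.HasState g q}
  root : I.HasState I.s.rootWalker.1 R.root
  typ : ∀ q, R.typ q = q.typ
  rule : ∀ w q i, w.1 ∈ I.current S → I.At w q (i % D.sides q.typ) →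
    ∃ c, I.Classify w c ∧ I.Reads w c (R.e q i)

/-! ## Validation of the candidate -/

/-- Moving along a wall as `Approx.Face`, by the transition rules of `R`; whenever a treewalker moves
to a child, the state of the child is checked to be the one given by the rules. -/
inductive Look (I : Info D) (R : RTS D (Code D)) (ε : ℤ) : Walker → Walker → Prop
  | touch {w q i} : I.At w q i → R.e q i = .left ∨ R.e q i = .right → Look I R ε w w
  | up {w w' q i z} : I.At w q i → R.e q i = .parent → I.s.fwd w = some w' →
      Look I R ε (I.s.rot ε w') z → Look I R ε w z
  | down {w w' q q' i z} : I.At w q i → R.e q i = .child q' → I.s.fwd w = some w' →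
      I.HasState w'.1 q' → Look I R ε (I.s.rot ε w') z → Look I R ε w z

/-- The treewalker faces an edge with the given transition rule. -/
def Faces (I : Info D) (R : RTS D (Code D)) (w : Walker) (x : TreeEdge (Code D)) : Prop :=
  ∃ q i, I.At w q i ∧ R.e q i = x

def SameEdge (I : Info D) (a b : Walker) : Prop := I.s.fwd a = some b ∧ I.s.fwd b = some a

/-- What is noted about a treewalker: its state and the edge faced; in a dead branch, the same for
its ancestors, down to the live tile from which the dead branch grows. -/
inductive Note (I : Info D) (R : RTS D (Code D)) : Walker → List (Code D × ℤ) → Prop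
  | live {w q i} : I.At w q i → ¬ R.Dead q → Note I R w [(q, i)]
  | dead {w q i p w' l} : I.At w q i → R.Dead q → I.par w.1 = some p →
      I.s.fwd (w.1, p) = some w' → Note I R w' l → Note I R w ((q, i) :: l)

/-- The notes about a pair of treewalkers. -/
abbrev Seen (D : ATD) : Type := List (Code D × ℤ) × List (Code D × ℤ)

/-- `Examine I R V a b sl sr V'`: the examination of a wall with the left-moving treewalker facing
the non-tree edge `a`, the right-moving one facing `b`, and stacks `sl`, `sr`, succeeds; `V` and `V'`
are the sets of the pairs of notes seen before and after. -/
inductive Examine (I : Info D) (R : RTS D (Code D)) : Set (Seen D) → Walker → Walker →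
    List Walker → List Walker → Set (Seen D) → Prop
  | pushRight {V a b b' sl sr V'} : I.Faces R b .right → I.Look R 1 (I.s.rot 1 b) b' →
      Examine I R V a b' sl (b :: sr) V' → Examine I R V a b sl sr V'
  | popRight {V a b b' x sl sr V'} : I.Faces R b .left → I.SameEdge x b →
      I.Look R 1 (I.s.rot 1 b) b' →
      Examine I R V a b' sl sr V' → Examine I R V a b sl (x :: sr) V'
  | pushLeft {V a a' b sl sr V'} : I.Faces R a .left → I.Look R (-1) (I.s.rot (-1) a) a' →
      Examine I R V a' b (a :: sl) sr V' → Examine I R V a b sl sr V'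
  | popLeft {V a a' b x sl sr V'} : I.Faces R a .right → I.SameEdge x a →
      I.Look R (-1) (I.s.rot (-1) a) a' →
      Examine I R V a' b sl sr V' → Examine I R V a b (x :: sl) sr V'
  | advance {V a a' b b' la lb V'} : I.Faces R a .right → I.Faces R b .left → I.SameEdge a b →
      I.Note R a la → I.Note R b lb → (la, lb) ∉ V →
      I.Look R (-1) (I.s.rot (-1) a) a' → I.Look R 1 (I.s.rot 1 b) b' →
      Examine I R (insert (la, lb) V) a' b' [] [] V' → Examine I R V a b [] [] V'
  | seen {V a b la lb} : I.Faces R a .right → I.Faces R b .left → I.SameEdge a b →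
      I.Note R a la → I.Note R b lb → (la, lb) ∈ V → Examine I R V a b [] [] V

/-- Examine, one after another, the walls to the right of the given treewalkers. -/
inductive ExamineAll (I : Info D) (R : RTS D (Code D)) : Set (Seen D) → List Walker → Prop
  | nil {V} : ExamineAll I R V []
  | cons {V V' w a b ws} : I.Look R (-1) w a → I.Look R 1 (I.s.rot 1 w) b →
      I.Examine R V a b [] [] V' → ExamineAll I R V' ws → ExamineAll I R V (w :: ws)

/-- The validation succeeds: the tree generated from the root is infinite, and for all states and
all pairs of consecutive live children, the wall between them has been examined successfully. -/
def Validates (I : Info D) (S : Finset ℕ) (R : RTS D (Code D)) : Prop :=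
  ¬ R.Dead R.root ∧ ∃ ws : List Walker, I.ExamineAll R ∅ ws ∧
    (∀ w ∈ ws, w.1 ∈ I.current S ∧
      ∃ q ∈ R.states, ∃ i₁ i₂, R.BranchPair q i₁ i₂ ∧ I.At w q (i₁ % D.sides q.typ)) ∧
    ∀ q ∈ R.states, ∀ i₁ i₂, R.BranchPair q i₁ i₂ →
      ∃ w ∈ ws, w.1 ∈ I.current S ∧ I.At w q (i₁ % D.sides q.typ)

end Info

/-! ## The algorithm -/

/-- The state of the algorithm: the approximation, the tiles `S`, and the decision trees. -/
structure Config (D : ATD) where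
  s : Approx D
  S : Finset ℕ
  rules : Rules D

def Config.start (D : ATD) (t₀ : D.T) : Config D := ⟨Approx.start D t₀, {0}, Rules.start D⟩

/-- The steps of the algorithm.  Tiles are added to `S` when `S` is not closed or when the
examination of a candidate finds a wrong transition, leaves of the decision trees are extended to
remove inconsistencies, and both may be taken back.  The choices made on these occasions are left
free here, so that every strategy for them is covered. -/
inductive Config.Step {D : ATD} : Config D → Config D → Prop
  | approx (A : Config D) (s') : Approx.Step A.s s' → Step A { A with s := s' }
  | addTile (A : Config D) (g) : g < A.s.size → Step A { A with S := insert g A.S }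
  | reduce (A : Config D) (S') : S' ⊆ A.S → 0 ∈ S' → Step A { A with S := S' }
  | extend (A : Config D) (q i j) : A.rules q.typ q.par q.ans = none → i ≤ q.ans.length →
      (i = 0 ∨ q.ans[i - 1]? = some Cls.child) →
      Step A { A with rules := A.rules.extend q (i, j) }
  | refresh (A : Config D) : Step A { A with S := {0}, rules := Rules.start D }

/-- The iteration ending in the configuration `A` finishes successfully and returns `R`: there is no
distance error, all the information used (parent directions, sides, distances) is up to date,
`S` is closed and consistent, and `R` is the tree structure built from it, and is validated. -/
def Config.Succeeds {D : ATD} (A : Config D) (R : RTS D (Code D)) : Prop :=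
  A.s.Stable ∧ ¬ A.s.distErr ∧
    ∃ I : Info D, I.s = A.s ∧ I.rules = A.rules ∧ I.Valid ∧
      (∀ g ∈ I.current A.S, ∃ q, I.HasState g q) ∧
      I.Closed A.S ∧ I.Consistent A.S ∧ I.IsCandidate A.S R ∧ I.Validates A.S R

/-- Some run of the algorithm, started with a single tile of type `t₀`, terminates successfully and
returns `R`. -/
def AlgorithmReturns (D : ATD) (t₀ : D.T) (R : RTS D (Code D)) : Prop :=
  ∃ A, Relation.ReflTransGen Config.Step (Config.start D t₀) A ∧ A.Succeeds R

end

/-!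
The generated structure is compared with `C` in two directions.

Since the connections prescribed by the transition rules respect the edge types, and an edge marked
as left or right is connected over the remaining edges of a vertex, every connection of the generated
structure holds in `C`, at the place obtained by following the tree from `d₀`
(`RTS.WellFormed.place_conn`).  Conversely, suppose that every dart of the generated structure has a
partner to which it is connected, and that the vertices close up.  Then `C`, being simply connected,
is universal among structures with these local properties, so that paths from `d₀` can be lifted
(`Tessellation.exists_lift`); the two maps are inverse to each other.  If in addition the depth
changes by at most one over each connection, the depth is the distance from the root
(`RTS.WellFormed.isGRTSFor_of_partner`).

To find the partners, consider the contour of the tree: the permutation of the darts that crosses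
tree edges and then rotates by one edge.  It runs along the walls of non-tree edges, and a right edge
and a left edge are connected if the piece of the contour between them is a correctly parenthesized
word in right and left edges which is long enough to complete the vertex (`Balanced`, `Matched`).
A tree structure is thus correct as soon as every wall is exhausted by growing balanced pieces
(`RTS.WellFormed.isGRTSFor_of_walls`); as the root is live, walls between consecutive live children
reach all darts, since dead branches are traversed completely (`forall_of_contour`).

The validation supplies these pieces.  Every approximation reachable in the algorithm is true of `C`
(`Config.invariant`): unified tiles have the same place in `C`, and known connections are connections
of `C`.  The two treewalkers of an examination move in the approximation, but they are followed step
by step in the generated structure, because the states of all tiles they enter are checked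
(`Info.Successful.look`); the pushed and popped edges become matching edges
(`Info.Successful.examine`).  That a vertex is completed exactly once between two such edges is read
off from the approximation: the number of its edges is a multiple of the valence by comparison with
`C`, and not a larger one, since the last edge is a left edge and would otherwise have been passed
before (`Info.Successful.matched_of_joint`).  The difference of the distances on both sides of an
edge is part of the state, which bounds the change of the depth.  Finally, the notes about a pair of
treewalkers determine how they can be followed (`track_of_note`), so that a wall whose examination
ended at known notes continues in the way already examined (`synced_next`).
-/

/-! ### Path lifting -/

theorem moveAlong_append {X : Type*} (r s : X → X) (x : X) (l m : List Move) :
    moveAlong r s x (l ++ m) = moveAlong r s (moveAlong r s x l) m := by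
  induction l generalizing x with
  | nil => rfl
  | cons a l ih => cases a <;> simp [moveAlong, ih]

theorem moveAlong_injective {X : Type*} {r s : X → X} (hr : r.Injective) (hs : s.Injective)
    (l : List Move) : Function.Injective fun x => moveAlong r s x l := by
  induction l with
  | nil => exact fun _ _ h => h
  | cons a l ih =>
    cases a
    · exact ih.comp hr
    · exact ih.comp hs

theorem moveAlong_replicate_rot {X : Type*} (r s : X → X) (x : X) (n : ℕ) :
    moveAlong r s x (List.replicate n Move.rot) = r^[n] x := by
  induction n generalizing x with
  | zero => rfl
  | succ n ih => simp [List.replicate_succ, moveAlong, ih]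

theorem moveAlong_replicate_vertex {X : Type*} (r s : X → X) (x : X) (n : ℕ) :
    moveAlong r s x (List.replicate n [Move.step, Move.rot]).flatten =
      (fun y => r (s y))^[n] x := by
  induction n generalizing x with
  | zero => rfl
  | succ n ih => simp [List.replicate_succ, moveAlong, ih]

namespace Tessellation

variable {D : ATD} (C : Tessellation D)

/-- A simply connected tessellation is universal among the structures with a rotation and a step
that carry edge labels and in which going around a tile or a vertex is trivial: any dart can be
sent to any element with the same label, compatibly with all the moves. -/
theorem exists_lift {X : Type*} {r s : X → X} {lab : X → D.Edge} (hr : r.Injective)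
    (hss : ∀ x, s (s x) = x) (hlr : ∀ x, lab (r x) = D.succ (lab x))
    (hls : ∀ x, lab (s x) = D.c (lab x)) (hface : ∀ x, r^[D.sides (lab x).1] x = x)
    (hvert : ∀ x, (fun y => r (s y))^[D.v (lab x)] x = x) {d : C.Dart} {x : X}
    (hx : lab x = C.lab d) :
    ∃ F : C.Dart → X, F d = x ∧ (∀ e, F (C.rot e) = r (F e)) ∧ ∀ e, F (C.step e) = s (F e) := by
  have hs : s.Injective := fun a b h => by rw [← hss a, h, hss]
  have hlab : ∀ l, lab (moveAlong r s x l) = C.lab (moveAlong C.rot C.step d l) := by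
    have key : ∀ (l : List Move) (d : C.Dart) (x : X), lab x = C.lab d →
        lab (moveAlong r s x l) = C.lab (moveAlong C.rot C.step d l) := by
      intro l
      induction l with
      | nil => exact fun _ _ h => h
      | cons a l ih =>
        intro d x h
        cases a
        · exact ih _ _ (by rw [hlr, C.lab_rot, h])
        · exact ih _ _ (by rw [hls, C.lab_step, h])
    exact fun l => key l d x hx
  have hhom : ∀ l m, Homotopic C.rot C.step (fun x => D.sides (C.lab x).1)
      (fun x => D.v (C.lab x)) d l m → moveAlong r s x l = moveAlong r s x m := by
    intro l m h
    induction h with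
    | refl => rfl
    | symm _ ih => exact ih.symm
    | trans _ _ ih₁ ih₂ => exact ih₁.trans ih₂
    | face l m =>
      simp only [moveAlong_append, moveAlong_replicate_rot, ← hlab l, hface]
    | edge l m => simp [moveAlong_append, moveAlong, hss]
    | vertex l m =>
      simp only [moveAlong_append, moveAlong_replicate_vertex, ← hlab l, hvert]
  have hwd : ∀ l m, moveAlong C.rot C.step d l = moveAlong C.rot C.step d m →
      moveAlong r s x l = moveAlong r s x m := by
    intro l m h
    -- both paths are closed to loops by the same path back to `d`
    obtain ⟨k, hk⟩ := C.connected (moveAlong C.rot C.step d l) d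
    apply moveAlong_injective hr hs k
    simp only [← moveAlong_append]
    rw [hhom _ _ (C.simply_connected d (l ++ k) (by rw [moveAlong_append, hk])),
      hhom _ _ (C.simply_connected d (m ++ k) (by rw [moveAlong_append, ← h, hk]))]
  choose P hP using C.connected d
  refine ⟨fun e => moveAlong r s x (P e), hwd (P d) [] (hP d), fun e => ?_, fun e => ?_⟩
  · have := hwd (P (C.rot e)) (P e ++ [Move.rot]) (by rw [moveAlong_append, hP, hP]; rfl)
    simpa [moveAlong_append, moveAlong] using this
  · have := hwd (P (C.step e)) (P e ++ [Move.step]) (by rw [moveAlong_append, hP, hP]; rfl)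
    simpa [moveAlong_append, moveAlong] using this

theorem rot_iterate_sides (d : C.Dart) : C.rot^[D.sides (C.lab d).1] d = d := by
  rw [← C.face_size]; exact Function.iterate_minimalPeriod

theorem vertex_iterate (d : C.Dart) : (fun x => C.rot (C.step x))^[D.v (C.lab d)] d = d := by
  rw [← C.vertex_size]; exact Function.iterate_minimalPeriod

/-- Darts with the same label are equivalent under a symmetry of the tessellation. -/
theorem exists_symmetry {d d' : C.Dart} (h : C.lab d' = C.lab d) :
    ∃ F : C.Dart → C.Dart, F d = d' ∧ (∀ e, F (C.rot e) = C.rot (F e)) ∧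
      ∀ e, F (C.step e) = C.step (F e) :=
  C.exists_lift C.rot.injective C.step_step C.lab_rot C.lab_step C.rot_iterate_sides
    C.vertex_iterate h

theorem lab_zpow (d : C.Dart) (k : ℤ) :
    C.lab ((C.rot ^ k) d) = ⟨(C.lab d).1, (C.lab d).2 + (k : ZMod _)⟩ := by
  have hinv : ∀ e, C.lab (C.rot⁻¹ e) = ⟨(C.lab e).1, (C.lab e).2 - 1⟩ := by
    intro e
    have h := C.lab_rot (C.rot⁻¹ e)
    rw [show C.rot (C.rot⁻¹ e) = e from Equiv.apply_symm_apply C.rot e] at h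
    rw [h]
    exact Sigma.ext rfl (heq_of_eq (add_sub_cancel_right _ _).symm)
  induction k with
  | zero => simp
  | succ n ih =>
    rw [add_comm, zpow_add, Equiv.Perm.mul_apply, zpow_one, C.lab_rot, ih]
    simp only [ATD.succ, Int.cast_add, Int.cast_one]
    congr 1; ring
  | pred n ih =>
    rw [sub_eq_add_neg, add_comm, zpow_add, Equiv.Perm.mul_apply, zpow_neg_one, hinv, ih]
    simp only [Int.cast_add, Int.cast_neg, Int.cast_one]
    congr 1; ring

theorem lab_zpow_edge {d : C.Dart} {t : D.T} {i : ℤ} (h : C.lab d = D.edge t i) (k : ℤ) :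
    C.lab ((C.rot ^ k) d) = D.edge t (i + k) := by
  rw [lab_zpow, h]
  simp only [ATD.edge, Int.cast_add]
  rfl

theorem zpow_sides_mul {d : C.Dart} {t : D.T} (h : (C.lab d).1 = t) (k : ℤ) :
    (C.rot ^ ((D.sides t : ℤ) * k)) d = d := by
  have h1 : (C.rot ^ (D.sides t : ℤ)) d = d := by
    rw [zpow_natCast, ← Equiv.Perm.iterate_eq_pow, ← h]; exact C.rot_iterate_sides d
  rw [zpow_mul]
  exact Function.IsFixedPt.perm_zpow (e := C.rot ^ (D.sides t : ℤ)) h1 k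

theorem zpow_emod {d : C.Dart} {t : D.T} (h : (C.lab d).1 = t) (k : ℤ) :
    (C.rot ^ (k % (D.sides t : ℤ))) d = (C.rot ^ k) d := by
  conv_rhs => rw [← Int.emod_add_mul_ediv k (D.sides t)]
  rw [zpow_add, Equiv.Perm.mul_apply, C.zpow_sides_mul h]

theorem zpow_eq_zpow_iff {d : C.Dart} {t : D.T} (h : (C.lab d).1 = t) {i j : ℤ} :
    (C.rot ^ i) d = (C.rot ^ j) d ↔ i ≡ j [ZMOD D.sides t] := by
  constructor
  · intro hij
    have h1 : (C.rot ^ (j - i)) d = d := by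
      rw [sub_eq_neg_add, zpow_add, Equiv.Perm.mul_apply, ← hij, ← Equiv.Perm.mul_apply,
        ← zpow_add]; simp
    rw [← C.zpow_emod h] at h1
    have hN : (D.sides t : ℤ) ≠ 0 := by
      have := D.polygon t; unfold ATD.sides; omega
    obtain ⟨n, hn⟩ := Int.eq_ofNat_of_zero_le (Int.emod_nonneg (j - i) hN)
    rw [hn, zpow_natCast, ← Equiv.Perm.iterate_eq_pow] at h1
    have h2 := (Function.isPeriodicPt_iff_minimalPeriod_dvd (f := C.rot) (n := n)).1 h1
    rw [C.face_size, h] at h2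
    rw [Int.modEq_iff_dvd]
    apply Int.dvd_of_emod_eq_zero
    have hlt : (j - i) % (D.sides t : ℤ) < D.sides t :=
      Int.emod_lt_of_pos _ (by omega)
    have := Nat.eq_zero_of_dvd_of_lt h2 (by omega)
    omega
  · intro hij
    rw [← C.zpow_emod h, hij, C.zpow_emod h]

end Tessellation

/-! ### Darts of the generated structure -/

namespace RTS

variable {D : ATD} {Q : Type*} (R : RTS D Q)

theorem sides_pos (D : ATD) (t : D.T) : (0 : ℤ) < D.sides t := by
  have := D.polygon t
  unfold ATD.sides; omega

/-- The index, between `0` and the number of edges, of the parent edge of a tile of state `q`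
(`0` if there is none). -/
noncomputable def parentIndex (q : Q) : ℤ :=
  if h : ∃ j : ℤ, 0 ≤ j ∧ j < D.sides (R.typ q) ∧ R.e q j = .parent then h.choose else 0

variable {R}

theorem parentIndex_spec {q : Q} (h : ∃ j : ℤ, 0 ≤ j ∧ j < D.sides (R.typ q) ∧ R.e q j = .parent) :
    0 ≤ R.parentIndex q ∧ R.parentIndex q < D.sides (R.typ q) ∧
      R.e q (R.parentIndex q) = .parent := by
  unfold parentIndex; rw [dif_pos h]; exact h.choose_spec

namespace WellFormed

variable (hW : R.WellFormed)
include hW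

theorem e_emod {q : Q} (hq : q ∈ R.states) (i : ℤ) :
    R.e q (i % D.sides (R.typ q)) = R.e q i := by
  have key : ∀ (k : ℕ) (i : ℤ), R.e q (i + D.sides (R.typ q) * k) = R.e q i := by
    intro k
    induction k with
    | zero => simp
    | succ k ih =>
      intro i
      rw [← ih i, ← hW.periodic q hq (i + D.sides (R.typ q) * (k : ℤ))]
      congr 1; push_cast; ring
  have h := Int.emod_add_mul_ediv i (D.sides (R.typ q))
  rcases Int.le_total 0 (i / D.sides (R.typ q)) with h0 | h0
  · obtain ⟨k, hk⟩ := Int.eq_ofNat_of_zero_le h0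
    rw [hk] at h
    conv_rhs => rw [← h]
    exact (key k _).symm
  · obtain ⟨k, hk⟩ := Int.eq_ofNat_of_zero_le (Int.neg_nonneg_of_nonpos h0)
    rw [← key k i]
    congr 1
    rw [← hk]; linarith

theorem e_congr {q : Q} (hq : q ∈ R.states) {i j : ℤ} (h : i ≡ j [ZMOD D.sides (R.typ q)]) :
    R.e q i = R.e q j := by
  rw [← hW.e_emod hq i, ← hW.e_emod hq j, h]

theorem parentIndex_of_parent {q : Q} (hq : q ∈ R.states) {i : ℤ} (h : R.e q i = .parent) :
    0 ≤ R.parentIndex q ∧ R.parentIndex q < D.sides (R.typ q) ∧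
      R.e q (R.parentIndex q) = .parent ∧ i ≡ R.parentIndex q [ZMOD D.sides (R.typ q)] := by
  have hp := sides_pos D (R.typ q)
  obtain ⟨h1, h2, h3⟩ := parentIndex_spec (R := R) (q := q)
    ⟨i % D.sides (R.typ q), Int.emod_nonneg _ hp.ne', Int.emod_lt_of_pos _ hp,
      by rw [hW.e_emod hq, h]⟩
  exact ⟨h1, h2, h3, hW.parent_unique q hq _ _ h h3⟩

theorem parentIndex_eq {q : Q} (hq : q ∈ R.states) {i : ℤ} (h : R.e q i = .parent)
    (h0 : 0 ≤ i) (h1 : i < D.sides (R.typ q)) : i = R.parentIndex q := by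
  obtain ⟨h2, h3, -, h4⟩ := hW.parentIndex_of_parent hq h
  unfold Int.ModEq at h4
  rwa [Int.emod_eq_of_lt h0 h1, Int.emod_eq_of_lt h2 h3] at h4

theorem child_parentIndex {q q' : Q} (hq : q ∈ R.states) {i : ℤ} (h : R.e q i = .child q') :
    0 ≤ R.parentIndex q' ∧ R.parentIndex q' < D.sides (R.typ q') ∧
      R.e q' (R.parentIndex q') = .parent ∧
      D.c (D.edge (R.typ q) i) = D.edge (R.typ q') (R.parentIndex q') := by
  obtain ⟨j, hj, hc⟩ := hW.child_connects q hq i q' h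
  obtain ⟨h1, h2, h3, h4⟩ := hW.parentIndex_of_parent (hW.child_mem q hq i q' h) hj
  refine ⟨h1, h2, h3, hc.trans ?_⟩
  have : (D.n (R.typ q') : ℤ) ∣ R.parentIndex q' - j := by
    refine dvd_trans ?_ (Int.modEq_iff_dvd.1 h4)
    unfold ATD.sides; push_cast; exact dvd_mul_right _ _
  unfold ATD.edge
  rw [(ZMod.intCast_eq_intCast_iff_dvd_sub _ _ _).2 this]

end WellFormed

theorem stateAt_cons {i : ℤ} {p : List ℤ} {q' : Q} : R.stateAt (i :: p) = some q' ↔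
    ∃ q, R.stateAt p = some q ∧ 0 ≤ i ∧ i < D.sides (R.typ q) ∧ R.e q i = .child q' := by
  simp only [stateAt, Option.bind_eq_some_iff]
  refine exists_congr fun q => and_congr_right fun _ => ?_
  split_ifs with h
  · cases he : R.e q i <;> simp [h]
  · simp only [false_iff]
    exact fun h' => h ⟨h'.1, h'.2.1⟩

theorem WellFormed.stateAt_mem (hW : R.WellFormed) {p : List ℤ} {q : Q}
    (h : R.stateAt p = some q) : q ∈ R.states := by
  induction p generalizing q with
  | nil => cases h; exact hW.root_mem
  | cons i p ih =>
    obtain ⟨q₀, h0, -, -, h1⟩ := stateAt_cons.1 h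
    exact hW.child_mem _ (ih h0) _ _ h1

variable (R) in
/-- Positions of a treewalker in the generated structure. -/
abbrev Dart := {w : List ℤ × ℤ // R.IsDart w}

namespace Dart

/-- The state of the tile of a dart. -/
noncomputable def state (x : R.Dart) : Q := x.2.choose

theorem stateAt (x : R.Dart) : R.stateAt x.1.1 = some x.state := x.2.choose_spec.1

theorem nonneg (x : R.Dart) : 0 ≤ x.1.2 := x.2.choose_spec.2.1

theorem lt (x : R.Dart) : x.1.2 < D.sides (R.typ x.state) := x.2.choose_spec.2.2

theorem state_eq {x : R.Dart} {q : Q} (h : R.stateAt x.1.1 = some q) : x.state = q :=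
  Option.some_injective _ (x.stateAt.symm.trans h)

theorem state_mem (hW : R.WellFormed) (x : R.Dart) : x.state ∈ R.states :=
  hW.stateAt_mem x.stateAt

/-- The transition rule at the edge faced. -/
noncomputable def edge (x : R.Dart) : TreeEdge Q := R.e x.state x.1.2

theorem edgeAt (x : R.Dart) : R.edgeAt x.1 = some x.edge := by
  simp [RTS.edgeAt, x.stateAt, edge]

theorem rot_val (x : R.Dart) (k : ℤ) :
    R.rot k x.1 = (x.1.1, (x.1.2 + k) % D.sides (R.typ x.state)) := by
  simp [RTS.rot, x.stateAt]

/-- The `i`-th dart of a tile of the generated structure, with `i` taken modulo the number of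
edges. -/
noncomputable def mk {p : List ℤ} {q : Q} (h : R.stateAt p = some q) (i : ℤ) : R.Dart :=
  ⟨(p, i % D.sides (R.typ q)), q, h, Int.emod_nonneg _ (sides_pos D _).ne',
    Int.emod_lt_of_pos _ (sides_pos D _)⟩

theorem mk_state {p : List ℤ} {q : Q} (h : R.stateAt p = some q) (i : ℤ) : (mk h i).state = q :=
  state_eq h

theorem mk_edge (hW : R.WellFormed) {p : List ℤ} {q : Q} (h : R.stateAt p = some q) (i : ℤ) :
    (mk h i).edge = R.e q i := by
  rw [edge, mk_state]; exact hW.e_emod (hW.stateAt_mem h) i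

theorem mk_congr {p : List ℤ} {q : Q} (h : R.stateAt p = some q) {i j : ℤ}
    (hij : i ≡ j [ZMOD D.sides (R.typ q)]) : mk h i = mk h j := by
  apply Subtype.ext; simp only [mk]; rw [hij]

theorem eq_mk (x : R.Dart) : x = mk x.stateAt x.1.2 := by
  apply Subtype.ext; simp only [mk]; rw [Int.emod_eq_of_lt x.nonneg x.lt]

/-- Rotation by `k` edges. -/
noncomputable def rotBy (k : ℤ) (x : R.Dart) : R.Dart := mk x.stateAt (x.1.2 + k)

theorem rotBy_val (k : ℤ) (x : R.Dart) : (rotBy k x).1 = R.rot k x.1 := (rot_val x k).symm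

theorem rotBy_mk {p : List ℤ} {q : Q} (h : R.stateAt p = some q) (i k : ℤ) :
    rotBy k (mk h i) = mk h (i + k) := by
  apply Subtype.ext
  rw [rotBy_val, rot_val, mk_state]
  simp only [mk, Int.emod_add_emod]

theorem rotBy_rotBy (k l : ℤ) (x : R.Dart) : rotBy l (rotBy k x) = rotBy (k + l) x := by
  rw [eq_mk x, rotBy_mk, rotBy_mk, rotBy_mk, add_assoc]

theorem rotBy_zero (x : R.Dart) : rotBy 0 x = x := by
  conv_lhs => rw [eq_mk x, rotBy_mk, add_zero]
  exact (eq_mk x).symm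

variable (R) in
/-- Clockwise rotation by one edge. -/
noncomputable def rot : Equiv.Perm R.Dart where
  toFun := rotBy 1
  invFun := rotBy (-1)
  left_inv x := by rw [rotBy_rotBy]; exact rotBy_zero x
  right_inv x := by rw [rotBy_rotBy]; exact rotBy_zero x

theorem rot_apply (x : R.Dart) : rot R x = rotBy 1 x := rfl

theorem rot_mk {p : List ℤ} {q : Q} (h : R.stateAt p = some q) (i : ℤ) :
    rot R (mk h i) = mk h (i + 1) := rotBy_mk h i 1

theorem rot_iterate (k : ℕ) (x : R.Dart) : (rot R)^[k] x = rotBy k x := by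
  induction k generalizing x with
  | zero => exact (rotBy_zero x).symm
  | succ k ih => rw [Function.iterate_succ_apply, ih, rot_apply, rotBy_rotBy]; push_cast; ring_nf

/-- The edge type of the edge faced. -/
noncomputable def lab (x : R.Dart) : D.Edge := D.edge (R.typ x.state) x.1.2

theorem edge_emod (t : D.T) (i : ℤ) : D.edge t (i % D.sides t) = D.edge t i := by
  unfold ATD.edge
  congr 1
  rw [ZMod.intCast_eq_intCast_iff_dvd_sub]
  refine dvd_trans (b := (D.sides t : ℤ)) ?_ ?_
  · unfold ATD.sides; push_cast; exact dvd_mul_right _ _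
  · exact Int.dvd_self_sub_of_emod_eq rfl

theorem lab_mk {p : List ℤ} {q : Q} (h : R.stateAt p = some q) (i : ℤ) :
    lab (mk h i) = D.edge (R.typ q) i := by
  rw [lab, mk_state]; exact edge_emod _ _

theorem lab_rot (x : R.Dart) : lab (rot R x) = D.succ (lab x) := by
  conv_lhs => rw [eq_mk x, rot_mk, lab_mk]
  simp only [lab, ATD.edge, ATD.succ, Int.cast_add, Int.cast_one]
  rfl

/-- The depth in the tree of the tile of the dart. -/
def depth (x : R.Dart) : ℕ := x.1.1.length

/-- Facing an edge of the tree. -/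
def IsTree (x : R.Dart) : Prop := x.edge = .parent ∨ ∃ q', x.edge = .child q'

theorem tree_or (x : R.Dart) : x.IsTree ∨ x.edge = .left ∨ x.edge = .right := by
  unfold IsTree; cases x.edge <;> simp

theorem IsTree.not_left {x : R.Dart} (h : x.IsTree) : x.edge ≠ .left := by
  rintro h'; simp [IsTree, h'] at h

theorem IsTree.not_right {x : R.Dart} (h : x.IsTree) : x.edge ≠ .right := by
  rintro h'; simp [IsTree, h'] at h

end Dart

variable (R) in
/-- Crossing a tree edge, on the level of addresses of tiles and indices of edges; everything else
stays in place. -/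
noncomputable def crossRaw (w : List ℤ × ℤ) : List ℤ × ℤ :=
  match R.edgeAt w with
  | some (.child q') => (w.2 :: w.1, R.parentIndex q')
  | some .parent => match w.1 with
    | [] => w
    | i :: p => (p, i)
  | _ => w

theorem stateAt_child {p : List ℤ} {q q' : Q} {i : ℤ} (h : R.stateAt p = some q)
    (h0 : 0 ≤ i) (h1 : i < D.sides (R.typ q)) (he : R.e q i = .child q') :
    R.stateAt (i :: p) = some q' := stateAt_cons.2 ⟨q, h, h0, h1, he⟩

namespace WellFormed

variable (hW : R.WellFormed)

theorem crossRaw_of_child {x : R.Dart} {q' : Q} (h : x.edge = .child q') :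
    R.crossRaw x.1 = (x.1.2 :: x.1.1, R.parentIndex q') := by
  simp [crossRaw, x.edgeAt, h]

include hW in
/-- A parent edge leads back to the edge over which the tile was attached as a child. -/
theorem exists_of_parent {x : R.Dart} (h : x.edge = .parent) :
    ∃ i p, x.1 = (i :: p, R.parentIndex x.state) ∧
      ∃ y : R.Dart, y.1 = (p, i) ∧ y.edge = .child x.state ∧ R.crossRaw x.1 = y.1 := by
  obtain ⟨⟨p, j⟩, hx⟩ := x
  cases p with
  | nil =>
    exfalso
    have : Dart.state ⟨([], j), hx⟩ = R.root := Dart.state_eq rfl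
    rw [Dart.edge, this] at h
    exact hW.root_parent _ h
  | cons i p =>
    set x : R.Dart := ⟨(i :: p, j), hx⟩ with hxd
    obtain ⟨q, hq, h0, h1, he⟩ := stateAt_cons.1 x.stateAt
    have hj : j = R.parentIndex x.state :=
      hW.parentIndex_eq (x.state_mem hW) h x.nonneg x.lt
    refine ⟨i, p, ?_, ⟨(p, i), q, hq, h0, h1⟩, rfl, ?_, ?_⟩
    · rw [hxd]; simp only [Prod.mk.injEq, true_and]; exact hj
    · rw [Dart.edge, Dart.state_eq hq]; exact he
    · have := x.edgeAt
      rw [h, hxd] at this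
      simp [crossRaw, hxd, this]

include hW in
theorem isDart_crossRaw (x : R.Dart) : R.IsDart (R.crossRaw x.1) := by
  cases h : x.edge with
  | left => simpa [crossRaw, x.edgeAt, h] using x.2
  | right => simpa [crossRaw, x.edgeAt, h] using x.2
  | parent =>
    obtain ⟨i, p, -, y, -, -, hy⟩ := hW.exists_of_parent h
    rw [hy]; exact y.2
  | child q' =>
    rw [crossRaw_of_child h]
    obtain ⟨h1, h2, -⟩ := hW.child_parentIndex (x.state_mem hW) h
    exact ⟨q', stateAt_child x.stateAt x.nonneg x.lt h, h1, h2⟩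

/-- Crossing a tree edge; darts that do not face a tree edge stay in place. -/
noncomputable def cross (x : R.Dart) : R.Dart := ⟨R.crossRaw x.1, hW.isDart_crossRaw x⟩

theorem cross_of_child {x : R.Dart} {q' : Q} (h : x.edge = .child q') :
    (hW.cross x).1 = (x.1.2 :: x.1.1, R.parentIndex q') ∧ (hW.cross x).state = q' ∧
      (hW.cross x).edge = .parent := by
  have h1 : (hW.cross x).1 = (x.1.2 :: x.1.1, R.parentIndex q') := crossRaw_of_child h
  have h2 : (hW.cross x).state = q' := by
    apply Dart.state_eq; rw [h1]; exact stateAt_child x.stateAt x.nonneg x.lt h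
  refine ⟨h1, h2, ?_⟩
  rw [Dart.edge, h2, h1]
  exact (hW.child_parentIndex (x.state_mem hW) h).2.2.1

theorem cross_of_parent {x : R.Dart} (h : x.edge = .parent) :
    (hW.cross x).edge = .child x.state ∧
      x.1 = ((hW.cross x).1.2 :: (hW.cross x).1.1, R.parentIndex x.state) := by
  obtain ⟨i, p, h1, y, h2, h3, h4⟩ := hW.exists_of_parent h
  have : hW.cross x = y := Subtype.ext h4
  rw [this, h2]; exact ⟨h3, h1⟩

theorem cross_of_left {x : R.Dart} (h : x.edge = .left) : hW.cross x = x := by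
  apply Subtype.ext; simp [cross, crossRaw, x.edgeAt, h]

theorem cross_of_right {x : R.Dart} (h : x.edge = .right) : hW.cross x = x := by
  apply Subtype.ext; simp [cross, crossRaw, x.edgeAt, h]

theorem cross_of_not_tree {x : R.Dart} (h : ¬ x.IsTree) : hW.cross x = x := by
  rcases x.tree_or with h' | h' | h'
  · exact absurd h' h
  · exact hW.cross_of_left h'
  · exact hW.cross_of_right h'

theorem cross_tree {x : R.Dart} (h : x.IsTree) : (hW.cross x).IsTree := by
  rcases h with h | ⟨q', h⟩
  · exact .inr ⟨_, (hW.cross_of_parent h).1⟩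
  · exact .inl (hW.cross_of_child h).2.2

theorem cross_cross (x : R.Dart) : hW.cross (hW.cross x) = x := by
  by_cases hx : x.IsTree
  · rcases hx with h | ⟨q', h⟩
    · obtain ⟨h1, h2⟩ := hW.cross_of_parent h
      apply Subtype.ext
      rw [(hW.cross_of_child h1).1, ← h2]
    · obtain ⟨h1, h2, h3⟩ := hW.cross_of_child h
      have h4 := (hW.cross_of_parent h3).2
      rw [h1] at h4
      simp only [Prod.mk.injEq, List.cons.injEq] at h4
      exact Subtype.ext (Prod.ext h4.1.2.symm h4.1.1.symm)
  · rw [hW.cross_of_not_tree hx, hW.cross_of_not_tree hx]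

theorem conn_cross {x : R.Dart} (h : x.IsTree) : R.Conn x.1 (hW.cross x).1 := by
  have key : ∀ (x : R.Dart) q', x.edge = .child q' → R.Conn x.1 (hW.cross x).1 := by
    intro x q' h
    have h3 := (hW.cross x).edgeAt
    have h2 := (hW.cross x).2
    obtain ⟨h1, -, h4⟩ := hW.cross_of_child h
    rw [h4] at h3
    rw [h1] at h2 h3 ⊢
    exact .child x.2 h2 h3
  rcases h with h | ⟨q', h⟩
  · have := key _ _ (hW.cross_of_parent h).1
    rw [cross_cross] at this
    exact this.symm
  · exact key x q' h

/-- The next position on the contour of the tree, in clockwise direction: the contour crosses the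
edges of the tree and goes along all other edges. -/
noncomputable def contour : Equiv.Perm R.Dart where
  toFun x := Dart.rot R (hW.cross x)
  invFun x := hW.cross ((Dart.rot R).symm x)
  left_inv x := by simp [cross_cross]
  right_inv x := by simp [cross_cross]

theorem contour_apply (x : R.Dart) : hW.contour x = Dart.rot R (hW.cross x) := rfl

theorem contour_of_not_tree {x : R.Dart} (h : ¬ x.IsTree) : hW.contour x = Dart.rot R x := by
  rw [contour_apply, hW.cross_of_not_tree h]

end WellFormed

end RTS

/-! ### The generated structure and the tessellation -/

namespace RTS

variable {D : ATD} {Q : Type*} (R : RTS D Q) (C : Tessellation D) (d₀ : C.Dart)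

/-- The dart of `C` that corresponds to the edge `0` of a generated tile, found by following the
path of the tile in the tree. -/
noncomputable def develop : List ℤ → C.Dart
  | [] => d₀
  | i :: p => (C.rot ^ (-((R.stateAt (i :: p)).elim 0 R.parentIndex)))
      (C.step ((C.rot ^ i) (develop p)))

/-- The dart of `C` that corresponds to a generated tile and one of its edges. -/
noncomputable def place (w : List ℤ × ℤ) : C.Dart := (C.rot ^ w.2) (R.develop C d₀ w.1)

namespace WellFormed

variable {R C d₀} (hW : R.WellFormed) (h₀ : C.lab d₀ = D.edge (R.typ R.root) 0)
include hW h₀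

theorem lab_develop {p : List ℤ} {q : Q} (h : R.stateAt p = some q) :
    C.lab (R.develop C d₀ p) = D.edge (R.typ q) 0 := by
  induction p generalizing q with
  | nil => cases h; exact h₀
  | cons i p ih =>
    obtain ⟨q₀, hq₀, -, -, he⟩ := stateAt_cons.1 h
    obtain ⟨-, -, -, hc⟩ := hW.child_parentIndex (hW.stateAt_mem hq₀) he
    have h1 := C.lab_zpow_edge (ih hq₀) i
    have h2 : C.lab (C.step ((C.rot ^ i) (R.develop C d₀ p))) =
        D.edge (R.typ q) (R.parentIndex q) := by
      rw [C.lab_step, h1, zero_add, hc]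
    simp only [develop, h, Option.elim]
    rw [C.lab_zpow_edge h2]
    simp

theorem lab_place (x : R.Dart) : C.lab (R.place C d₀ x.1) = x.lab := by
  rw [place, C.lab_zpow_edge (hW.lab_develop h₀ x.stateAt), zero_add]; rfl

theorem place_mk {p : List ℤ} {q : Q} (h : R.stateAt p = some q) (i : ℤ) :
    R.place C d₀ (Dart.mk h i).1 = (C.rot ^ i) (R.develop C d₀ p) := by
  have h1 : (C.lab (R.develop C d₀ p)).1 = R.typ q := by rw [hW.lab_develop h₀ h]; rfl
  exact C.zpow_emod h1 i

theorem place_rotBy (k : ℤ) (x : R.Dart) :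
    R.place C d₀ (x.rotBy k).1 = (C.rot ^ k) (R.place C d₀ x.1) := by
  rw [Dart.rotBy, hW.place_mk h₀, place, add_comm, zpow_add, Equiv.Perm.mul_apply]

theorem place_rot (x : R.Dart) : R.place C d₀ (Dart.rot R x).1 = C.rot (R.place C d₀ x.1) := by
  rw [Dart.rot_apply, hW.place_rotBy h₀, zpow_one]

omit hW h₀ in
theorem place_child {i : ℤ} {p : List ℤ} {q : Q} (h : R.stateAt (i :: p) = some q) :
    R.place C d₀ (i :: p, R.parentIndex q) = C.step (R.place C d₀ (p, i)) := by
  simp only [place, develop, h, Option.elim]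
  rw [← Equiv.Perm.mul_apply, ← zpow_add]
  simp

omit h₀ hW in
theorem isDart_rot {k : ℤ} {w : List ℤ × ℤ} (h : R.IsDart w) : R.IsDart (R.rot k w) := by
  have := (Dart.rotBy k ⟨w, h⟩).2
  rwa [Dart.rotBy_val] at this

omit h₀ hW in
theorem valence_eq (x : R.Dart) : R.valence x.1 = D.v x.lab := by
  simp [valence, x.stateAt, Dart.lab]

theorem place_rotBy' (k : ℤ) {w : List ℤ × ℤ} (h : R.IsDart w) :
    R.place C d₀ (R.rot k w) = (C.rot ^ k) (R.place C d₀ w) := by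
  rw [← hW.place_rotBy h₀ k ⟨w, h⟩, Dart.rotBy_val]

/-- The generated connections are connections of `C`: a right or left edge is connected by going
around a vertex, and all but one of the edges at the vertex being known, so is the last one. -/
theorem place_conn {a b : List ℤ × ℤ} (h : R.Conn a b) :
    R.IsDart a ∧ R.IsDart b ∧ C.step (R.place C d₀ a) = R.place C d₀ b := by
  induction h with
  | child ha hb he =>
    refine ⟨ha, hb, ?_⟩
    rename_i p i j
    have hj : j = R.parentIndex (Dart.state ⟨_, hb⟩) := by
      have hd := Dart.edgeAt ⟨_, hb⟩
      rw [he] at hd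
      exact hW.parentIndex_eq (Dart.state_mem hW ⟨_, hb⟩) (Option.some_injective _ hd).symm
        (Dart.nonneg ⟨_, hb⟩) (Dart.lt ⟨_, hb⟩)
    rw [hj, place_child (Dart.stateAt ⟨_, hb⟩)]
  | symm _ ih => exact ⟨ih.2.1, ih.1, by rw [← ih.2.2, C.step_step]⟩
  | @right a f g ha _ h0 _ hfg _ ih =>
    have hv : R.valence (R.rot 1 a) = D.v (C.lab (R.place C d₀ (R.rot 1 a))) := by
      rw [hW.lab_place h₀ ⟨_, isDart_rot ha⟩]; exact valence_eq ⟨_, isDart_rot ha⟩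
    set v := R.valence (R.rot 1 a) with hvd
    have key : ∀ k ≤ v - 1, R.IsDart (f k) ∧ R.place C d₀ (f k) =
        (fun x => C.rot (C.step x))^[k] (C.rot (R.place C d₀ a)) := by
      intro k
      induction k with
      | zero => intro _; rw [h0, hW.place_rotBy' h₀ 1 ha]; exact ⟨isDart_rot ha, by simp⟩
      | succ k ihk =>
        intro hk
        obtain ⟨h1, h2, h3⟩ := ih k (by omega)
        rw [hfg k (by omega), Function.iterate_succ_apply', ← (ihk (by omega)).2, h3,
          hW.place_rotBy' h₀ 1 h2]
        exact ⟨isDart_rot h2, by simp⟩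
    obtain ⟨h1, h2⟩ := key (v - 1) le_rfl
    refine ⟨ha, h1, ?_⟩
    have hva := C.vertex_iterate (C.rot (R.place C d₀ a))
    rw [hW.place_rotBy' h₀ 1 ha, zpow_one] at hv
    have hpos : 0 < v := hv ▸ D.valence_pos _
    rw [← hv, show v = (v - 1) + 1 by omega, Function.iterate_succ_apply', ← h2] at hva
    rw [← C.rot.injective hva, C.step_step]
  | @left a f g ha _ h0 _ hfg _ ih =>
    have hv : R.valence a = D.v (C.lab (R.place C d₀ a)) := by
      rw [hW.lab_place h₀ ⟨_, ha⟩]; exact valence_eq ⟨_, ha⟩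
    set v := R.valence a with hvd
    have key : ∀ k ≤ v - 1, R.IsDart (f k) ∧
        (fun x => C.rot (C.step x))^[k + 1] (C.step (R.place C d₀ (f k))) =
          R.place C d₀ a := by
      intro k
      induction k with
      | zero =>
        intro _
        rw [h0, hW.place_rotBy' h₀ (-1) ha]
        exact ⟨isDart_rot ha, by simp [C.step_step]⟩
      | succ k ihk =>
        intro hk
        obtain ⟨h1, h2, h3⟩ := ih k (by omega)
        refine ⟨by rw [hfg k (by omega)]; exact isDart_rot h2, ?_⟩
        rw [← (ihk (by omega)).2, Function.iterate_succ_apply, hfg k (by omega),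
          hW.place_rotBy' h₀ (-1) h2, h3]
        simp [C.step_step]
    obtain ⟨h1, h2⟩ := key (v - 1) le_rfl
    refine ⟨ha, h1, ?_⟩
    have hpos : 0 < v := hv ▸ D.valence_pos _
    have hinj : Function.Injective (fun x => C.rot (C.step x)) := fun x y hxy => by
      have := C.rot.injective hxy
      rw [← C.step_step x, this, C.step_step]
    have hva := C.vertex_iterate (R.place C d₀ a)
    rw [← hv] at hva
    rw [show v - 1 + 1 = v by omega] at h2
    rw [← (hinj.iterate v) (h2.trans hva.symm), C.step_step]

/-- A tree structure whose connections form a surface is a copy of `C`: let `P` be an involution of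
the generated darts given by generated connections and closing up around every vertex.  Then `C`
maps to the generated structure by path lifting, and this map is inverse to the placement of the
generated darts in `C`.  If, moreover, `P` changes the depth by at most one, no path can reach a
tile faster than the tree. -/
theorem isGRTSFor_of_partner (P : R.Dart → R.Dart) (hPP : ∀ x, P (P x) = x)
    (hP : ∀ x, R.Conn x.1 (P x).1) (hPt : ∀ x : R.Dart, x.IsTree → P x = hW.cross x)
    (hdepth : ∀ x, (P x).depth ≤ x.depth + 1)
    (hvert : ∀ x : R.Dart, (fun y => Dart.rot R (P y))^[D.v x.lab] x = x) :
    R.IsGRTSFor C d₀ := by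
  have hroot : R.stateAt [] = some R.root := rfl
  have hstep : ∀ x, R.place C d₀ (P x).1 = C.step (R.place C d₀ x.1) :=
    fun x => (hW.place_conn h₀ (hP x)).2.2.symm
  have hlabP : ∀ x, (P x).lab = D.c x.lab := fun x => by
    rw [← hW.lab_place h₀, hstep, C.lab_step, hW.lab_place h₀]
  have hface : ∀ x : R.Dart, (Dart.rot R)^[D.sides x.lab.1] x = x := by
    intro x
    rw [Dart.rot_iterate]
    change Dart.mk x.stateAt (x.1.2 + (D.sides (R.typ x.state) : ℤ)) = x
    conv_rhs => rw [x.eq_mk]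
    exact Dart.mk_congr _ Int.add_modEq_right
  have hmk0 : (Dart.mk hroot 0).1 = ([], 0) := by simp [Dart.mk]
  obtain ⟨F, hF0, hFr, hFs⟩ := C.exists_lift (r := Dart.rot R) (s := P) (lab := Dart.lab)
    (d := d₀) (x := Dart.mk hroot 0) (Dart.rot R).injective hPP Dart.lab_rot hlabP hface hvert
    (by rw [Dart.lab_mk, h₀])
  have hFr' : ∀ (k : ℤ) e, F ((C.rot ^ k) e) = Dart.rotBy k (F e) := by
    intro k
    induction k with
    | zero => intro e; simp [Dart.rotBy_zero]
    | succ n ih =>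
      intro e
      rw [add_comm, zpow_add, Equiv.Perm.mul_apply, zpow_one, hFr, ih, Dart.rot_apply,
        Dart.rotBy_rotBy, add_comm]
    | pred n ih =>
      intro e
      apply (Dart.rot R).injective
      rw [← hFr, ← Equiv.Perm.mul_apply, ← zpow_one_add, Dart.rot_apply, Dart.rotBy_rotBy,
        show (1 : ℤ) + (-n - 1) = -n by ring, show (-n - 1 + 1 : ℤ) = -n by ring, ih]
  -- the generated structure is connected by its tree
  have hFdev : ∀ p q (h : R.stateAt p = some q), F (R.develop C d₀ p) = Dart.mk h 0 := by
    intro p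
    induction p with
    | nil => intro q h; cases h; exact hF0
    | cons i p ih =>
      intro q h
      obtain ⟨q₀, hq₀, hi0, hi1, he⟩ := stateAt_cons.1 h
      simp only [develop, h, Option.elim]
      rw [hFr', hFs, hFr', ih _ hq₀, Dart.rotBy_mk, zero_add]
      have hed : (Dart.mk hq₀ i).edge = .child q := by rw [Dart.mk_edge hW, he]
      rw [hPt _ (.inr ⟨q, hed⟩)]
      obtain ⟨h1, -, -⟩ := hW.cross_of_child hed
      have h2 : hW.cross (Dart.mk hq₀ i) = Dart.mk h (R.parentIndex q) := by
        apply Subtype.ext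
        obtain ⟨h3, h4, -⟩ := hW.child_parentIndex (hW.stateAt_mem hq₀) he
        rw [h1]
        simp only [Dart.mk]
        rw [Int.emod_eq_of_lt hi0 hi1, Int.emod_eq_of_lt h3 h4]
      rw [h2, Dart.rotBy_mk]; simp
  have hFplace : ∀ x : R.Dart, F (R.place C d₀ x.1) = x := by
    intro x
    rw [place, hFr', hFdev _ _ x.stateAt, Dart.rotBy_mk, zero_add, ← x.eq_mk]
  have hplaceF : ∀ d, R.place C d₀ (F d).1 = d := by
    have key : ∀ l d, R.place C d₀ (F d).1 = d →
        R.place C d₀ (F (moveAlong C.rot C.step d l)).1 = moveAlong C.rot C.step d l := by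
      intro l
      induction l with
      | nil => exact fun d h => h
      | cons a l ih =>
        intro d h
        cases a
        · exact ih _ (by rw [hFr, hW.place_rot h₀, h])
        · exact ih _ (by rw [hFs, hstep, h])
    intro d
    obtain ⟨l, rfl⟩ := C.connected d₀ d
    exact key l d₀ (by rw [hF0, hmk0]; simp [place, develop])
  let φ : R.Dart ≃ C.Dart := ⟨fun x => R.place C d₀ x.1, F, hFplace, hplaceF⟩
  have hφ : ∀ x : R.Dart, φ x = R.place C d₀ x.1 := fun _ => rfl
  refine ⟨hW, φ, ⟨fun h => by simp [hφ, place, develop], fun w q hq => ?_, fun w w' hw => ?_,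
    fun w w' => ⟨fun h => (hW.place_conn h₀ h).2.2, fun h => ?_⟩⟩, fun w => ⟨?_, ?_⟩⟩
  · rw [hφ, hW.lab_place h₀, Dart.lab, Dart.state_eq hq]
  · rw [hφ, hφ, hw, hW.place_rotBy' h₀ 1 w.2, zpow_one]
  · rw [hφ, ← hstep, ← hφ] at h
    rw [← φ.injective h]; exact hP w
  · have hrot : ∀ (k : ℕ) n d, C.Reach n d₀ d → C.Reach n d₀ ((C.rot ^ k) d) := by
      intro k n d h
      induction k with
      | zero => exact h
      | succ k ih => rw [pow_succ', Equiv.Perm.mul_apply]; exact ih.rot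
    have hrotz : ∀ (k : ℤ) n d, C.Reach n d₀ d → C.Reach n d₀ ((C.rot ^ k) d) := by
      intro k n d h
      rw [← C.zpow_emod rfl]
      obtain ⟨m, hm⟩ := Int.eq_ofNat_of_zero_le
        (Int.emod_nonneg k (sides_pos D (C.lab d).1).ne')
      rw [hm, zpow_natCast]; exact hrot m n d h
    have key : ∀ p, C.Reach p.length d₀ (R.develop C d₀ p) := by
      intro p
      induction p with
      | nil => exact .refl _
      | cons i p ih => exact hrotz _ _ _ (hrotz _ _ _ ih).step
    exact hrotz _ _ _ (key _)
  · intro k hk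
    have key : ∀ n d d', C.Reach n d d' → (F d').depth ≤ n + (F d).depth := by
      intro n d d' h
      induction h with
      | refl => simp
      | rot _ ih => rw [hFr]; exact ih
      | step _ ih =>
        rw [hFs]
        exact (hdepth _).trans (by omega)
    have := key _ _ _ hk
    rw [hφ, hFplace, hF0] at this
    simpa [Dart.depth, hmk0] using this

end WellFormed

end RTS

/-! ### Balanced pieces of the contour -/

namespace RTS.WellFormed

variable {D : ATD} {Q : Type*} {R : RTS D Q} (hW : R.WellFormed)

/-- The depths of the tiles differ by at most one. -/
def Close (x z : R.Dart) : Prop := x.depth ≤ z.depth + 1 ∧ z.depth ≤ x.depth + 1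

/-- `Balanced c m x y`: the piece of the contour of length `m` from `x` (included) to `y`
(excluded) is a correctly parenthesized word, if right edges are opening parentheses, left edges
are closing parentheses and tree edges are ignored.  A treewalker that goes from `x` around a
vertex, crossing the tree edges and jumping over the matching pairs, arrives at `y` after crossing
`c` edges; every matching pair inside is connected by going once around a vertex, and the depths of
the two tiles differ by at most one. -/
inductive Balanced : ℕ → ℕ → R.Dart → R.Dart → Prop
  | nil (x) : Balanced 0 0 x x
  | tree {c m x y} : x.IsTree → Balanced c m (hW.contour x) y → Balanced (c + 1) (m + 1) x y
  | pair {c m c' m' x z y} : x.edge = .right → Balanced c m (hW.contour x) z → z.edge = .left →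
      c + 1 = D.v (hW.contour x).lab → Close x z → Balanced c' m' (hW.contour z) y →
      Balanced (c' + 1) (m + m' + 2) x y

/-- The right edge `x` and the left edge `z` match as parentheses on the contour, and the vertex
between them closes up: with the edge itself, the treewalker that goes around it from `x` to `z`
crosses as many edges as the valence says. -/
def Matched (x z : R.Dart) : Prop :=
  x.edge = .right ∧ z.edge = .left ∧ Close x z ∧
    ∃ c m, hW.Balanced c m (hW.contour x) z ∧ c + 1 = D.v (hW.contour x).lab

variable {hW}

theorem Balanced.trans {c m c' m' : ℕ} {x y z : R.Dart} (h : hW.Balanced c m x y)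
    (h' : hW.Balanced c' m' y z) : hW.Balanced (c + c') (m + m') x z := by
  induction h with
  | nil => simpa using h'
  | tree ht _ ih =>
    have := (ih h').tree ht
    convert this using 1 <;> omega
  | pair hx h1 hz hc hcl _ _ ih =>
    have := Balanced.pair hx h1 hz hc hcl (ih h')
    convert this using 1 <;> omega

theorem Balanced.iterate {c m : ℕ} {x y : R.Dart} (h : hW.Balanced c m x y) :
    hW.contour^[m] x = y := by
  induction h with
  | nil => rfl
  | tree _ _ ih => exact ih
  | @pair c m c' m' x z y _ _ _ _ _ _ ih₁ ih₂ =>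
    rw [show m + m' + 2 = (m' + 1) + (m + 1) by omega, Function.iterate_add_apply,
      Function.iterate_succ_apply _ m, ih₁, Function.iterate_succ_apply, ih₂]

/-- As in a parenthesized word, the next unmatched left edge is determined by where the piece of the
contour starts. -/
theorem Balanced.right_unique {c m c' m' : ℕ} {x y y' : R.Dart} (h : hW.Balanced c m x y)
    (hy : y.edge = .left) (h' : hW.Balanced c' m' x y') (hy' : y'.edge = .left) :
    y = y' ∧ c = c' ∧ m = m' := by
  induction h generalizing c' m' y' with
  | nil =>
    cases h' with
    | nil => exact ⟨rfl, rfl, rfl⟩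
    | tree ht => exact absurd hy ht.not_left
    | pair hx => rw [hx] at hy; cases hy
  | tree ht _ ih =>
    cases h' with
    | nil => exact absurd hy' ht.not_left
    | tree _ h' => obtain ⟨h1, h2, h3⟩ := ih hy h' hy'; exact ⟨h1, by rw [h2], by rw [h3]⟩
    | pair hx => exact absurd hx ht.not_right
  | pair hx h1 hz _ _ h2 ih₁ ih₂ =>
    cases h' with
    | nil => rw [hx] at hy'; cases hy'
    | tree ht => exact absurd hx ht.not_right
    | pair _ h1' hz' _ _ h2' =>
      obtain ⟨rfl, rfl, rfl⟩ := ih₁ hz h1' hz'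
      obtain ⟨h4, h5, h6⟩ := ih₂ hy h2' hy'
      exact ⟨h4, by rw [h5], by rw [h6]⟩

theorem Matched.right_unique {x z z' : R.Dart} (h : hW.Matched x z) (h' : hW.Matched x z') :
    z = z' := by
  obtain ⟨-, hz, -, c, m, h, -⟩ := h
  obtain ⟨-, hz', -, c', m', h', -⟩ := h'
  exact (h.right_unique hz h' hz').1

variable (hW) in
/-- Balanced pieces of the contour, built up from left to right, so that they can be read backwards;
the counts are dropped. -/
inductive BalancedLeft : R.Dart → R.Dart → Prop
  | nil (x) : BalancedLeft x x
  | tree {x y} : BalancedLeft x y → y.IsTree → BalancedLeft x (hW.contour y)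
  | pair {x y z} : BalancedLeft x y → y.edge = .right → BalancedLeft (hW.contour y) z →
      z.edge = .left → BalancedLeft x (hW.contour z)

theorem BalancedLeft.trans {x y z : R.Dart} (h : hW.BalancedLeft x y)
    (h' : hW.BalancedLeft y z) : hW.BalancedLeft x z := by
  induction h' with
  | nil => exact h
  | tree _ ht ih => exact (ih h).tree ht
  | pair _ hy h2 hz ih _ => exact (ih h).pair hy h2 hz

theorem Balanced.balancedLeft {c m : ℕ} {x y : R.Dart} (h : hW.Balanced c m x y) :
    hW.BalancedLeft x y := by
  induction h with
  | nil => exact .nil _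
  | tree ht _ ih => exact ((BalancedLeft.nil _).tree ht).trans ih
  | pair hx _ hz _ _ _ ih₁ ih₂ => exact ((BalancedLeft.nil _).pair hx ih₁ hz).trans ih₂

theorem BalancedLeft.inv {u w : R.Dart} (h : hW.BalancedLeft u w) :
    u = w ∨ (∃ y, w = hW.contour y ∧ y.IsTree ∧ hW.BalancedLeft u y) ∨
      ∃ y z, w = hW.contour z ∧ z.edge = .left ∧ y.edge = .right ∧
        hW.BalancedLeft (hW.contour y) z ∧ hW.BalancedLeft u y := by
  cases h with
  | nil => exact .inl rfl
  | tree h ht => exact .inr (.inl ⟨_, rfl, ht, h⟩)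
  | pair h hy h' hz => exact .inr (.inr ⟨_, _, rfl, hz, hy, h', h⟩)

theorem BalancedLeft.left_unique {u w x : R.Dart} (h : hW.BalancedLeft u w)
    (hu : u = hW.contour x) (hx : x.edge = .right) {x' : R.Dart}
    (h' : hW.BalancedLeft (hW.contour x') w) (hx' : x'.edge = .right) : x = x' := by
  induction h generalizing x x' with
  | nil =>
    subst hu
    rcases h'.inv with h | ⟨y, hy, ht, -⟩ | ⟨y, z, hz, hl, -⟩
    · exact (hW.contour.injective h).symm
    · rw [hW.contour.injective hy] at hx; exact absurd hx ht.not_right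
    · rw [hW.contour.injective hz, hl] at hx; cases hx
  | tree h1 ht ih =>
    rcases h'.inv with h | ⟨y, hy, ht', h2⟩ | ⟨y, z, hz, hl, -⟩
    · rw [hW.contour.injective h] at hx'; exact absurd hx' ht.not_right
    · rw [← hW.contour.injective hy] at h2
      exact ih hu hx h2 hx'
    · rw [← hW.contour.injective hz] at hl; exact absurd hl ht.not_left
  | pair h1 hy1 h2 hz1 ih₁ ih₂ =>
    rcases h'.inv with h | ⟨y, hy, ht', -⟩ | ⟨y, z, hz, hl, hy, h3, h4⟩
    · rw [hW.contour.injective h, hz1] at hx'; cases hx'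
    · rw [hW.contour.injective hy] at hz1; exact absurd hz1 ht'.not_left
    · rw [← hW.contour.injective hz] at h3
      rw [← ih₂ rfl hy1 h3 hy] at h4
      exact ih₁ hu hx h4 hx'

theorem Matched.left_unique {x x' z : R.Dart} (h : hW.Matched x z) (h' : hW.Matched x' z) :
    x = x' := by
  obtain ⟨hx, -, -, c, m, h, -⟩ := h
  obtain ⟨hx', -, -, c', m', h', -⟩ := h'
  exact h.balancedLeft.left_unique rfl hx h'.balancedLeft hx'

/-- The sequence of positions of a treewalker going around a vertex from `x` to `y`, crossing `c`
edges. -/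
def VertexPath (c : ℕ) (x y : R.Dart) : Prop :=
  ∃ f g : ℕ → List ℤ × ℤ, f 0 = x.1 ∧ f c = y.1 ∧
    ∀ k < c, R.Conn (f k) (g k) ∧ f (k + 1) = R.rot 1 (g k)

theorem VertexPath.cons {c : ℕ} {x x' y : R.Dart} (hx : R.Conn x.1 x'.1)
    (h : VertexPath c (Dart.rot R x') y) : VertexPath (c + 1) x y := by
  obtain ⟨f, g, h0, hc, h⟩ := h
  refine ⟨fun k => k.casesOn x.1 f, fun k => k.casesOn x'.1 g, rfl, hc, fun k hk => ?_⟩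
  cases k with
  | zero => exact ⟨hx, h0.trans (Dart.rotBy_val 1 x')⟩
  | succ k => exact h k (by omega)

/-- With the sequence of positions around the vertex, a right edge is connected by the defining rule
of the generated connections. -/
theorem VertexPath.conn {c : ℕ} {x z : R.Dart} (h : VertexPath c (hW.contour x) z)
    (hx : x.edge = .right) (hz : z.edge = .left) (hc : c + 1 = D.v (hW.contour x).lab) :
    R.Conn x.1 z.1 := by
  have hκ : (hW.contour x).1 = R.rot 1 x.1 := by
    rw [hW.contour_of_not_tree fun h => h.not_right hx]; exact Dart.rotBy_val 1 x
  obtain ⟨f, g, h0, hc', h⟩ := h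
  have hv : R.valence (R.rot 1 x.1) - 1 = c := by
    rw [← hκ, valence_eq, ← hc]; omega
  rw [← hc', ← hv]
  refine Conn.right f g x.2 (x.edgeAt.trans (by rw [hx])) (h0.trans hκ) ?_ ?_ ?_
  · rw [hv]; exact fun k hk => (h k hk).1
  · rw [hv]; exact fun k hk => (h k hk).2
  · rw [hv, hc', z.edgeAt, hz]

theorem Balanced.vertexPath {c m : ℕ} {x y : R.Dart} (h : hW.Balanced c m x y) :
    VertexPath c x y := by
  induction h with
  | nil x => exact ⟨fun _ => x.1, fun _ => x.1, rfl, rfl, fun k hk => absurd hk (by omega)⟩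
  | tree ht _ ih => exact ih.cons (hW.conn_cross ht)
  | pair hx _ hz hc _ _ ih₁ ih₂ =>
    rw [hW.contour_of_not_tree fun h => h.not_left hz] at ih₂
    exact ih₂.cons (ih₁.conn hx hz hc)

theorem Matched.conn {x z : R.Dart} (h : hW.Matched x z) : R.Conn x.1 z.1 := by
  obtain ⟨hx, hz, -, c, m, h, hc⟩ := h
  exact h.vertexPath.conn hx hz hc

/-! ### The partner of a dart -/

variable (hW) in
/-- The dart faces an edge of the tree or an edge that has a match. -/
def Good (x : R.Dart) : Prop := x.IsTree ∨ ∃ z, hW.Matched x z ∨ hW.Matched z x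

theorem Balanced.good {c m : ℕ} {x y : R.Dart} (h : hW.Balanced c m x y) :
    ∀ j < m, hW.Good (hW.contour^[j] x) := by
  induction h with
  | nil => exact fun j hj => absurd hj (by omega)
  | tree ht _ ih =>
    rintro (_ | j) hj
    · exact .inl ht
    · exact ih j (by omega)
  | @pair c m c' m' x z y hx h1 hz hc hcl h2 ih₁ ih₂ =>
    have hM : hW.Matched x z := ⟨hx, hz, hcl, c, m, h1, hc⟩
    rintro (_ | j) hj
    · exact .inr ⟨z, .inl hM⟩
    · rw [Function.iterate_succ_apply]
      rcases lt_trichotomy j m with h | h | h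
      · exact ih₁ j h
      · rw [h, h1.iterate]; exact .inr ⟨x, .inr hM⟩
      · obtain ⟨k, rfl⟩ : ∃ k, j = k + 1 + m := ⟨j - m - 1, by omega⟩
        rw [Function.iterate_add_apply, h1.iterate]
        exact ih₂ k (by omega)

variable (hW) in
/-- The dart on the other side of the edge faced, if this is a tree edge or has a match (otherwise
the dart itself). -/
noncomputable def partner (x : R.Dart) : R.Dart :=
  if x.IsTree then hW.cross x
  else if h : ∃ z, hW.Matched x z ∨ hW.Matched z x then h.choose else x

theorem partner_of_tree {x : R.Dart} (h : x.IsTree) : hW.partner x = hW.cross x := if_pos h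

theorem partner_of_matched {x z : R.Dart} (h : hW.Matched x z) : hW.partner x = z := by
  have hx : ¬ x.IsTree := fun ht => ht.not_right h.1
  have hex : ∃ z, hW.Matched x z ∨ hW.Matched z x := ⟨z, .inl h⟩
  rw [partner, if_neg hx, dif_pos hex]
  rcases hex.choose_spec with h' | h'
  · exact h'.right_unique h
  · have := h'.2.1; rw [h.1] at this; cases this

theorem partner_of_matched' {x z : R.Dart} (h : hW.Matched z x) : hW.partner x = z := by
  have hx : ¬ x.IsTree := fun ht => ht.not_left h.2.1
  have hex : ∃ z, hW.Matched x z ∨ hW.Matched z x := ⟨z, .inr h⟩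
  rw [partner, if_neg hx, dif_pos hex]
  rcases hex.choose_spec with h' | h'
  · have := h.2.1; rw [h'.1] at this; cases this
  · exact h'.left_unique h

theorem Balanced.partner_iterate {c m : ℕ} {x y : R.Dart} (h : hW.Balanced c m x y) :
    (fun z => Dart.rot R (hW.partner z))^[c] x = y := by
  induction h with
  | nil => rfl
  | tree ht _ ih => rw [Function.iterate_succ_apply, partner_of_tree ht]; exact ih
  | @pair c m c' m' x z y hx h1 hz hc hcl _ _ ih =>
    rw [hW.contour_of_not_tree fun h => h.not_left hz] at ih
    rw [Function.iterate_succ_apply, partner_of_matched ⟨hx, hz, hcl, c, m, h1, hc⟩]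
    exact ih

/-- On a balanced piece of the contour before a left edge, every treewalker going around a vertex
meets a left edge. -/
theorem Balanced.exists_left {c m : ℕ} {x y : R.Dart} (h : hW.Balanced c m x y)
    (hy : y.edge = .left) : ∀ j ≤ m, ∃ k,
      ((fun z => Dart.rot R (hW.partner z))^[k] (hW.contour^[j] x)).edge = .left := by
  induction h with
  | nil => intro j hj; exact ⟨0, by rw [Nat.le_zero.1 hj]; exact hy⟩
  | tree ht _ ih =>
    rintro (_ | j) hj
    · obtain ⟨k, hk⟩ := ih hy 0 (Nat.zero_le _)
      refine ⟨k + 1, ?_⟩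
      rw [Function.iterate_succ_apply, Function.iterate_zero_apply, partner_of_tree ht]
      exact hk
    · exact ih hy j (by omega)
  | @pair c m c' m' x z y hx h1 hz hc hcl h2 ih₁ ih₂ =>
    rintro (_ | j) hj
    · obtain ⟨k, hk⟩ := ih₂ hy 0 (Nat.zero_le _)
      rw [hW.contour_of_not_tree fun h => h.not_left hz] at hk
      refine ⟨k + 1, ?_⟩
      rw [Function.iterate_succ_apply, Function.iterate_zero_apply,
        partner_of_matched ⟨hx, hz, hcl, c, m, h1, hc⟩]
      exact hk
    · rw [Function.iterate_succ_apply]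
      by_cases h : j ≤ m
      · exact ih₁ hz j h
      · obtain ⟨k, rfl⟩ : ∃ k, j = k + 1 + m := ⟨j - m - 1, by omega⟩
        rw [Function.iterate_add_apply, h1.iterate]
        exact ih₂ hy k (by omega)

/-! ### Every dart lies on a wall -/

variable (hW) in
/-- A set of darts closed under moving along the contour that contains the beginning of the wall
between any two consecutive live children contains all darts: dead branches are traversed
completely, and the edges next to the parent edge are reached from the parent. -/
theorem forall_of_contour {M : R.Dart → Prop} (hM : ∀ x, M x ↔ M (hW.contour x))
    (hlive : ¬ R.Dead R.root)
    (hstart : ∀ p q (h : R.stateAt p = some q) i₁ i₂, R.BranchPair q i₁ i₂ →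
      M (Dart.mk h (i₁ + 1))) (x : R.Dart) : M x := by
  have hstep : ∀ q ∈ R.states, ∀ p (h : R.stateAt p = some q) i,
      (R.e q i = .left ∨ R.e q i = .right) → (M (Dart.mk h i) ↔ M (Dart.mk h (i + 1))) := by
    intro q _ p h i hi
    have hne : ¬ (Dart.mk h i).IsTree := by
      intro ht
      rcases hi with hi | hi
      · exact ht.not_left (by rw [Dart.mk_edge hW, hi])
      · exact ht.not_right (by rw [Dart.mk_edge hW, hi])
    rw [hM, hW.contour_of_not_tree hne, Dart.rot_mk]
  -- entering and leaving the branch over the edge `i`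
  have hchild : ∀ p q (h : R.stateAt p = some q) i q', R.e q i = .child q' →
      ∃ p', ∃ h' : R.stateAt p' = some q', p' = (i % D.sides (R.typ q)) :: p ∧
        (M (Dart.mk h i) ↔ M (Dart.mk h' (R.parentIndex q' + 1))) ∧
        (M (Dart.mk h' (R.parentIndex q')) ↔ M (Dart.mk h (i + 1))) := by
    intro p q h i q' he
    have hed : (Dart.mk h i).edge = .child q' := by rw [Dart.mk_edge hW, he]
    obtain ⟨h1, -, h3⟩ := hW.cross_of_child hed
    have h' : R.stateAt ((i % D.sides (R.typ q)) :: p) = some q' :=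
      stateAt_child h (Dart.mk h i).nonneg (Int.emod_lt_of_pos _ (sides_pos D _))
        (by rw [hW.e_emod (hW.stateAt_mem h), he])
    have hx : hW.cross (Dart.mk h i) = Dart.mk h' (R.parentIndex q') := by
      obtain ⟨h4, h5, -⟩ := hW.child_parentIndex (hW.stateAt_mem h) he
      apply Subtype.ext
      rw [h1]
      simp only [Dart.mk]
      rw [Int.emod_eq_of_lt h4 h5]
    refine ⟨_, h', rfl, ?_, ?_⟩
    · rw [hM, contour_apply, hx, Dart.rot_mk]
    · rw [hM (Dart.mk h' _), contour_apply, ← hx, cross_cross, Dart.rot_mk]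
  -- a run of edges that do not lead to the parent or to a live child
  have hrun : ∀ p q (h : R.stateAt p = some q),
      (∀ i q', R.e q i = .child q' → R.Dead q' → (M (Dart.mk h i) ↔ M (Dart.mk h (i + 1)))) →
      ∀ i (n : ℕ), (∀ k < n, R.e q (i + k) ≠ .parent ∧ ¬ R.LiveChild q (i + k)) →
        (M (Dart.mk h i) ↔ M (Dart.mk h (i + n))) := by
    intro p q h hd i n
    induction n with
    | zero => intro _; simp
    | succ n ih =>
      intro hn
      rw [ih fun k hk => hn k (by omega), Nat.cast_succ, ← add_assoc]
      obtain ⟨h1, h2⟩ := hn n (by omega)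
      cases he : R.e q (i + n) with
      | left => exact hstep q (hW.stateAt_mem h) p h _ (.inl he)
      | right => exact hstep q (hW.stateAt_mem h) p h _ (.inr he)
      | parent => exact absurd he h1
      | child q' => exact hd _ _ he (by by_contra hl; exact h2 ⟨q', he, hl⟩)
  have hdead : ∀ q, R.Dead q → ∀ p (h : R.stateAt p = some q), (∃ j, R.e q j = .parent) →
      (M (Dart.mk h (R.parentIndex q + 1)) ↔ M (Dart.mk h (R.parentIndex q))) := by
    intro q hq
    induction hq with
    | @mk q hq ih =>
      rintro p h ⟨j, hj⟩
      have hmem := hW.stateAt_mem h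
      have hN := sides_pos D (R.typ q)
      obtain ⟨-, -, hp, -⟩ := hW.parentIndex_of_parent hmem hj
      rw [hrun p q h ?_ _ (D.sides (R.typ q) - 1) ?_]
      · rw [Nat.cast_sub (by omega), Nat.cast_one,
          show R.parentIndex q + 1 + ((D.sides (R.typ q) : ℤ) - 1) =
            R.parentIndex q + D.sides (R.typ q) by ring,
          Dart.mk_congr h Int.add_modEq_right]
      · intro i q' he _
        obtain ⟨p', h', -, h1, h2⟩ := hchild p q h i q' he
        rw [h1, ih i q' he p' h' ⟨_, (hW.child_parentIndex hmem he).2.2.1⟩, h2]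
      · intro k hk
        refine ⟨fun hpar => ?_, ?_⟩
        · have h1 := Int.modEq_iff_dvd.1 (hW.parent_unique q hmem _ _ hp hpar)
          have h2 := Int.le_of_dvd (by omega) h1
          omega
        · rintro ⟨q', he, hl⟩; exact hl (hq _ _ he)
  have hdead' : ∀ p q (h : R.stateAt p = some q) i q', R.e q i = .child q' → R.Dead q' →
      (M (Dart.mk h i) ↔ M (Dart.mk h (i + 1))) := by
    intro p q h i q' he hd
    obtain ⟨p', h', -, h1, h2⟩ := hchild p q h i q' he
    rw [h1, hdead q' hd p' h' ⟨_, (hW.child_parentIndex (hW.stateAt_mem h) he).2.2.1⟩, h2]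
  -- a tile whose darts next to the parent edge are known
  have htile : ∀ p q (h : R.stateAt p = some q),
      (∃ i, R.e q i = .parent ∨ R.LiveChild q i) →
      (∀ i, R.e q i = .parent → M (Dart.mk h i) ∧ M (Dart.mk h (i + 1))) →
      ∀ i, M (Dart.mk h i) := by
    intro p q h ⟨i₀, hi₀⟩ hpar i
    have hmem := hW.stateAt_mem h
    have hN := sides_pos D (R.typ q)
    have hper : ∀ {i j : ℤ}, i ≡ j [ZMOD D.sides (R.typ q)] →
        (R.e q i = .parent ∨ R.LiveChild q i) → R.e q j = .parent ∨ R.LiveChild q j := by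
      intro i j hij
      simp only [LiveChild, hW.e_congr hmem hij, imp_self]
    -- the next parent or live child at or after `i`, and the last one before `i`
    have hex₂ : ∃ n : ℕ, R.e q (i + n) = .parent ∨ R.LiveChild q (i + n) := by
      obtain ⟨n, hn⟩ := Int.eq_ofNat_of_zero_le (Int.emod_nonneg (i₀ - i) hN.ne')
      refine ⟨n, hper ?_ hi₀⟩
      rw [← hn]
      calc i₀ = i + (i₀ - i) := by ring
        _ ≡ i + (i₀ - i) % _ [ZMOD D.sides (R.typ q)] :=
          (Int.ModEq.refl i).add (Int.mod_modEq _ _).symm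
    have hex₁ : ∃ n : ℕ, R.e q (i - 1 - n) = .parent ∨ R.LiveChild q (i - 1 - n) := by
      obtain ⟨n, hn⟩ := Int.eq_ofNat_of_zero_le (Int.emod_nonneg (i - 1 - i₀) hN.ne')
      refine ⟨n, hper ?_ hi₀⟩
      rw [← hn]
      calc i₀ = i - 1 - (i - 1 - i₀) := by ring
        _ ≡ i - 1 - (i - 1 - i₀) % _ [ZMOD D.sides (R.typ q)] :=
          (Int.ModEq.refl _).sub (Int.mod_modEq _ _).symm
    set n₂ := Nat.find hex₂ with hn₂
    set n₁ := Nat.find hex₁ with hn₁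
    have h2 := Nat.find_spec hex₂
    have h1 := Nat.find_spec hex₁
    rw [← hn₂] at h2
    rw [← hn₁] at h1
    have hbetween : ∀ j, i - 1 - n₁ < j → j < i + n₂ →
        R.e q j ≠ .parent ∧ ¬ R.LiveChild q j := by
      intro j hj1 hj2
      rw [← not_or]
      by_cases hji : j < i
      · obtain ⟨k, hk⟩ := Int.eq_ofNat_of_zero_le (show 0 ≤ i - 1 - j by omega)
        have := Nat.find_min hex₁ (m := k) (by omega)
        rwa [show i - 1 - (k : ℤ) = j by omega] at this
      · obtain ⟨k, hk⟩ := Int.eq_ofNat_of_zero_le (show 0 ≤ j - i by omega)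
        have := Nat.find_min hex₂ (m := k) (by omega)
        rwa [show i + (k : ℤ) = j by omega] at this
    have hleft : M (Dart.mk h (i - 1 - n₁ + 1)) ↔ M (Dart.mk h i) := by
      rw [hrun p q h (hdead' p q h) (i - 1 - n₁ + 1) n₁ fun k hk =>
        hbetween _ (by omega) (by omega)]
      ring_nf
    have hright : M (Dart.mk h i) ↔ M (Dart.mk h (i + n₂)) :=
      hrun p q h (hdead' p q h) i n₂ fun k hk => hbetween _ (by omega) (by omega)
    rcases h1 with h1 | h1
    · exact hleft.1 (hpar _ h1).2
    · rcases h2 with h2 | h2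
      · exact hright.2 (hpar _ h2).1
      · refine hleft.1 (hstart p q h _ (i + n₂) ⟨by omega, ?_, h1, h2, fun j hj1 hj2 =>
          (hbetween j hj1 hj2).symm⟩)
        by_contra hlt
        refine (hbetween (i - 1 - n₁ + D.sides (R.typ q)) (by omega) (by omega)).2 ?_
        rcases hper (i := i - 1 - n₁) (j := i - 1 - n₁ + D.sides (R.typ q))
          Int.add_modEq_right.symm (.inr h1) with h | h
        · rw [hW.periodic q hmem] at h
          obtain ⟨q', hq', -⟩ := h1
          rw [h] at hq'; cases hq'
        · exact h
  have hall : ∀ p q (h : R.stateAt p = some q) i, M (Dart.mk h i) := by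
    intro p
    induction p with
    | nil =>
      intro q h
      cases h
      refine htile [] R.root rfl ?_ fun i hi => absurd hi (hW.root_parent i)
      by_contra hno
      refine hlive (.mk fun i q' he => ?_)
      by_contra hl
      exact hno ⟨i, .inr ⟨q', he, hl⟩⟩
    | cons i₀ p ih =>
      intro q h
      obtain ⟨q₀, hq₀, h0, h1, he⟩ := stateAt_cons.1 h
      have hmem := hW.stateAt_mem hq₀
      obtain ⟨p', h', hp', h2, h3⟩ := hchild p q₀ hq₀ i₀ q he
      rw [Int.emod_eq_of_lt h0 h1] at hp'
      subst hp'
      obtain ⟨-, -, hpi, -⟩ := hW.child_parentIndex hmem he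
      refine htile _ q h ⟨_, .inl hpi⟩ fun i hi => ?_
      have hmod := (hW.parentIndex_of_parent (hW.stateAt_mem h) hi).2.2.2
      rw [Dart.mk_congr h hmod, Dart.mk_congr h (hmod.add_right 1)]
      exact ⟨h3.2 (ih q₀ hq₀ _), h2.1 (ih q₀ hq₀ _)⟩
  rw [x.eq_mk]
  exact hall _ _ _ _

/-- A tree structure is correct if every wall is exhausted by larger and larger pieces between two
matching edges: `S` is a set of matching pairs, each of which is surrounded by a next one on the
same wall, and each wall between consecutive live children has a first one. -/
theorem isGRTSFor_of_walls (hD : D.Consistent) {C : Tessellation D} {d₀ : C.Dart}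
    (h₀ : C.lab d₀ = D.edge (R.typ R.root) 0) (hlive : ¬ R.Dead R.root)
    (S : R.Dart → R.Dart → Prop) (hS : ∀ a b, S a b → hW.Matched a b)
    (hnext : ∀ a b, S a b → ∃ a' b' c m c' m', S a' b' ∧ hW.Balanced c m (hW.contour a') a ∧
      hW.Balanced c' m' (hW.contour b) b')
    (hstart : ∀ p q (h : R.stateAt p = some q) i₁ i₂, R.BranchPair q i₁ i₂ →
      ∃ a b c m c' m', S a b ∧ hW.Balanced c m (hW.contour a) (Dart.mk h (i₁ + 1)) ∧
        hW.Balanced c' m' (Dart.mk h (i₁ + 1)) b) :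
    R.IsGRTSFor C d₀ := by
  let M : R.Dart → Prop := fun x => ∃ a b c m j, S a b ∧ hW.Balanced c m (hW.contour a) b ∧
    j ≤ m ∧ hW.contour^[j] (hW.contour a) = x
  have hgrow : ∀ a b c m, S a b → hW.Balanced c m (hW.contour a) b →
      ∃ a' b' c' m' k, S a' b' ∧ hW.Balanced c' m' (hW.contour a') b' ∧
        hW.contour^[k] (hW.contour a') = a ∧ k + m + 2 ≤ m' := by
    intro a b c m hab h
    obtain ⟨a', b', c₁, m₁, c₂, m₂, hab', h1, h2⟩ := hnext a b hab
    obtain ⟨hx, hz, hcl, c', m', h', hc'⟩ := hS a b hab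
    obtain ⟨-, rfl, -⟩ := h.right_unique hz h' hz
    exact ⟨a', b', _, _, m₁, hab', h1.trans (.pair hx h hz hc' hcl h2), h1.iterate, by omega⟩
  have hM : ∀ x, M x ↔ M (hW.contour x) := by
    intro x
    constructor
    · rintro ⟨a, b, c, m, j, hab, h, hj, rfl⟩
      obtain ⟨a', b', c', m', k, hab', h', hk, hm⟩ := hgrow a b c m hab h
      refine ⟨a', b', c', m', j + 2 + k, hab', h', by omega, ?_⟩
      rw [Function.iterate_add_apply, hk, Function.iterate_succ_apply,
        Function.iterate_succ_apply']
    · rintro ⟨a, b, c, m, j, hab, h, hj, hx⟩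
      cases j with
      | zero =>
        obtain ⟨a', b', c', m', k, hab', h', hk, hm⟩ := hgrow a b c m hab h
        exact ⟨a', b', c', m', k, hab', h', by omega, by rw [hk]; exact hW.contour.injective hx⟩
      | succ j =>
        rw [Function.iterate_succ_apply'] at hx
        exact ⟨a, b, c, m, j, hab, h, by omega, hW.contour.injective hx⟩
  have hMall : ∀ x, M x := by
    refine hW.forall_of_contour hM hlive fun p q h i₁ i₂ hp => ?_
    obtain ⟨a, b, c, m, c', m', hab, h1, h2⟩ := hstart p q h i₁ i₂ hp
    exact ⟨a, b, _, _, m, hab, h1.trans h2, by omega, h1.iterate⟩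
  have hgood : ∀ x, hW.Good x := by
    intro x
    obtain ⟨a, b, c, m, j, hab, h, hj, rfl⟩ := hMall x
    obtain ⟨a', b', c', m', k, hab', h', hk, hm⟩ := hgrow a b c m hab h
    have := h'.good (j + 1 + k) (by omega)
    rwa [Function.iterate_add_apply, hk, Function.iterate_succ_apply] at this
  have hP : ∀ x : R.Dart, (x.IsTree ∧ hW.partner x = hW.cross x) ∨
      hW.Matched x (hW.partner x) ∨ hW.Matched (hW.partner x) x := by
    intro x
    rcases hgood x with h | ⟨z, h | h⟩
    · exact .inl ⟨h, partner_of_tree h⟩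
    · exact .inr (.inl (by rwa [partner_of_matched h]))
    · exact .inr (.inr (by rwa [partner_of_matched' h]))
  have hconn : ∀ x, R.Conn x.1 (hW.partner x).1 := by
    intro x
    rcases hP x with ⟨h, h'⟩ | h | h
    · rw [h']; exact hW.conn_cross h
    · exact h.conn
    · exact h.conn.symm
  have hlab : ∀ x : R.Dart, D.v (Dart.rot R (hW.partner x)).lab = D.v x.lab := by
    intro x
    rw [Dart.lab_rot, ← hW.lab_place h₀, ← (hW.place_conn h₀ (hconn x)).2.2, C.lab_step,
      hW.lab_place h₀]
    exact hD.2.1 x.lab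
  have hlab' : ∀ (k : ℕ) (x : R.Dart),
      D.v ((fun y => Dart.rot R (hW.partner y))^[k] x).lab = D.v x.lab := by
    intro k x
    induction k with
    | zero => rfl
    | succ k ih => rw [Function.iterate_succ_apply', hlab, ih]
  have hPP : ∀ x, hW.partner (hW.partner x) = x := by
    intro x
    rcases hP x with ⟨h, h'⟩ | h | h
    · rw [h', partner_of_tree (hW.cross_tree h), hW.cross_cross]
    · exact partner_of_matched' h
    · exact partner_of_matched h
  have hinj : Function.Injective fun y => Dart.rot R (hW.partner y) := fun x y hxy => by
    rw [← hPP x, (Dart.rot R).injective hxy, hPP]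
  refine hW.isGRTSFor_of_partner h₀ hW.partner hPP hconn (fun x => partner_of_tree) ?_ ?_
  · intro x
    rcases hP x with ⟨h | ⟨q, h⟩, h'⟩ | h | h
    · have h1 := (hW.cross_of_parent h).2
      rw [h', Dart.depth, Dart.depth, h1]
      simp only [List.length_cons]; omega
    · rw [h', Dart.depth, Dart.depth, (hW.cross_of_child h).1]
      simp
    · exact h.2.2.1.2
    · exact h.2.2.1.1
  · intro x
    have hleft : ∃ k, ((fun y => Dart.rot R (hW.partner y))^[k] x).edge = .left := by
      obtain ⟨a, b, c, m, j, hab, h, hj, rfl⟩ := hMall x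
      exact h.exists_left (hS a b hab).2.1 j hj
    obtain ⟨k, hk⟩ := hleft
    -- the vertex closes up at a left edge, hence also `k` steps before
    apply hinj.iterate k
    rw [← Function.iterate_add_apply, add_comm, Function.iterate_add_apply, ← hlab' k x]
    set y := (fun y => Dart.rot R (hW.partner y))^[k] x
    rcases hP y with ⟨h, -⟩ | h | h
    · exact absurd hk h.not_left
    · rw [h.1] at hk; cases hk
    · obtain ⟨hz, -, -, c, m, h1, hc⟩ := h
      have h2 := h1.partner_iterate
      rw [hW.contour_of_not_tree fun h => h.not_right hz] at h2 hc
      rw [← hlab y, ← hc, Function.iterate_succ_apply, h2]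

end RTS.WellFormed

/-! ### Soundness of the approximation -/

namespace Tessellation

variable {D : ATD} (C : Tessellation D)

/-- The end of a sequence of movements in `C`, given by the turns made after each step forward. -/
def follow : List ℤ → C.Dart → C.Dart
  | [], d => d
  | k :: p, d => follow p ((C.rot ^ k) (C.step d))

/-- A loop is a loop at every edge of the same type. -/
theorem follow_eq_self {d d' : C.Dart} (h : C.lab d' = C.lab d) {p : List ℤ}
    (hp : C.follow p d = d) : C.follow p d' = d' := by
  obtain ⟨F, rfl, hr, hs⟩ := C.exists_symmetry h
  have hz : ∀ (k : ℤ) e, F ((C.rot ^ k) e) = (C.rot ^ k) (F e) := by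
    intro k e
    obtain ⟨n, hn⟩ := Int.eq_ofNat_of_zero_le
      (Int.emod_nonneg k (RTS.sides_pos D (C.lab e).1).ne')
    have hit : ∀ (n : ℕ) e, F ((C.rot ^ n) e) = (C.rot ^ n) (F e) := by
      intro n
      induction n with
      | zero => intro e; rfl
      | succ n ih =>
        intro e
        rw [pow_succ', Equiv.Perm.mul_apply, Equiv.Perm.mul_apply, hr, ih]
    have hfix : C.rot^[D.sides (C.lab e).1] (F e) = F e := by
      have h1 := congrArg F (C.rot_iterate_sides e)
      rwa [Equiv.Perm.iterate_eq_pow, hit] at h1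
    have hfix' : (C.rot ^ (D.sides (C.lab e).1 : ℤ)) (F e) = F e := by
      rwa [Equiv.Perm.iterate_eq_pow] at hfix
    have hmul : (C.rot ^ ((D.sides (C.lab e).1 : ℤ) * (k / D.sides (C.lab e).1))) (F e) = F e := by
      rw [zpow_mul]
      exact Function.IsFixedPt.perm_zpow (e := C.rot ^ (D.sides (C.lab e).1 : ℤ)) hfix' _
    rw [← C.zpow_emod rfl, hn, zpow_natCast, hit]
    conv_rhs => rw [← Int.emod_add_mul_ediv k (D.sides (C.lab e).1), zpow_add,
      Equiv.Perm.mul_apply, hmul, hn, zpow_natCast]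
  have key : ∀ p e, F (C.follow p e) = C.follow p (F e) := by
    intro p
    induction p with
    | nil => exact fun _ => rfl
    | cons k p ih => intro e; rw [follow, follow, ih, hz, hs]
  rw [← key, hp]

end Tessellation

namespace Approx

variable {D : ATD} {C : Tessellation D} {d₀ : C.Dart}

/-- The dart of `C` at which a treewalker stands, if `ψ` gives the place of the edge `0` of every
generated tile. -/
def pos (ψ : ℕ → C.Dart) (w : Walker) : C.Dart := (C.rot ^ w.2) (ψ w.1)

/-- The two treewalkers have been unified, or are going to be. -/
def Rel (s : Approx D) (a b : Walker) : Prop :=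
  a.1 < s.size ∧ b.1 < s.size ∧ (s.find a = s.find b ∨ (a, b) ∈ s.pending)

/-- The equivalence of treewalkers that results from all pending unifications. -/
def Eqv (s : Approx D) : Walker → Walker → Prop := Relation.EqvGen s.Rel

theorem Eqv.mono {s s' : Approx D} (h : ∀ a b, s.Rel a b → s'.Eqv a b) {a b : Walker}
    (hab : s.Eqv a b) : s'.Eqv a b := by
  induction hab with
  | rel _ _ hr => exact h _ _ hr
  | refl => exact .refl _
  | symm _ _ _ ih => exact .symm _ _ ih
  | trans _ _ _ _ _ ih₁ ih₂ => exact .trans _ _ _ ih₁ ih₂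

/-- The approximation is true of `C`: the generated tiles have places `ψ` in `C` such that unified
tiles have the same place and all known connections are connections of `C`.  Moreover, the known
connections are symmetric up to pending unifications, and the root tile has distance `0`. -/
structure Sound (s : Approx D) (C : Tessellation D) (d₀ : C.Dart) (ψ : ℕ → C.Dart) : Prop where
  size_pos : 0 < s.size
  root : ψ 0 = d₀
  lab : ∀ g < s.size, C.lab (ψ g) = D.edge (s.ty g) 0
  u_tile : ∀ g < s.size, s.IsTile (s.u g).1
  u_range : ∀ g < s.size, 0 ≤ (s.u g).2 ∧ (s.u g).2 < D.sides (s.ty (s.u g).1)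
  u_pos : ∀ g < s.size, pos ψ (s.u g) = ψ g
  u_ge : ∀ g, s.size ≤ g → s.u g = (g, 0)
  conn_lt : ∀ g i x, s.conn g i = some x → g < s.size ∧ x.1 < s.size
  conn_pos : ∀ g i x, s.conn g i = some x → C.step (pos ψ (g, i)) = pos ψ x
  conn_symm : ∀ w x, s.IsWalker w → s.conn w.1 w.2 = some x →
    ∃ w' y, s.IsWalker w' ∧ s.Eqv w' x ∧ s.conn w'.1 w'.2 = some y ∧ s.Eqv y w
  pending : ∀ a b, (a, b) ∈ s.pending → a.1 < s.size ∧ b.1 < s.size ∧ pos ψ a = pos ψ b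
  shortcuts : ∀ e p, (e, p) ∈ s.shortcuts → ∀ d, C.lab d = e → C.follow p d = d
  root_dist : s.dist (s.u 0).1 = 0

theorem rot_rot (s : Approx D) (k l : ℤ) (w : Walker) : s.rot l (s.rot k w) = s.rot (k + l) w := by
  simp only [rot, Int.emod_add_emod, add_assoc]

namespace Sound

variable {s : Approx D} {ψ : ℕ → C.Dart} (h : s.Sound C d₀ ψ)
include h

theorem lab_pos {w : Walker} (hw : w.1 < s.size) : C.lab (pos ψ w) = s.edge w := by
  rw [pos, C.lab_zpow_edge (h.lab _ hw), zero_add]; rfl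

theorem pos_rot {w : Walker} (hw : w.1 < s.size) (k : ℤ) :
    pos ψ (s.rot k w) = (C.rot ^ k) (pos ψ w) := by
  have : (C.lab (ψ w.1)).1 = s.ty w.1 := by rw [h.lab _ hw]; rfl
  simp only [pos, rot]
  rw [C.zpow_emod this, add_comm, zpow_add, Equiv.Perm.mul_apply]

omit h in
theorem isWalker_rot {w : Walker} (hw : s.IsTile w.1) (k : ℤ) : s.IsWalker (s.rot k w) :=
  ⟨hw, Int.emod_nonneg _ (RTS.sides_pos D _).ne', Int.emod_lt_of_pos _ (RTS.sides_pos D _)⟩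

theorem isWalker_find {w : Walker} (hw : w.1 < s.size) : s.IsWalker (s.find w) :=
  isWalker_rot (h.u_tile _ hw) _

theorem pos_find {w : Walker} (hw : w.1 < s.size) : pos ψ (s.find w) = pos ψ w := by
  rw [find, h.pos_rot (h.u_tile _ hw).1, h.u_pos _ hw]; rfl

omit h in
theorem find_of_isWalker {w : Walker} (hw : s.IsWalker w) : s.find w = w := by
  obtain ⟨⟨-, h1⟩, h2, h3⟩ := hw
  rw [find, h1]
  simp only [rot, zero_add]
  rw [Int.emod_eq_of_lt h2 h3]

theorem fwd {w w' : Walker} (hf : s.fwd w = some w') :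
    s.IsWalker w' ∧ C.step (pos ψ w) = pos ψ w' := by
  rw [Approx.fwd, Option.map_eq_some_iff] at hf
  obtain ⟨x, hx, rfl⟩ := hf
  have hlt := (h.conn_lt _ _ _ hx).2
  exact ⟨h.isWalker_find hlt, by rw [h.pos_find hlt]; exact h.conn_pos _ _ _ hx⟩

theorem around {k : ℕ} {w w' : Walker} (hw : s.IsWalker w) (hf : s.around k w = some w') :
    s.IsWalker w' ∧ pos ψ w' = (fun x => C.rot (C.step x))^[k] (pos ψ w) := by
  induction k generalizing w with
  | zero => cases hf; exact ⟨hw, rfl⟩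
  | succ k ih =>
    rw [Approx.around, Option.bind_eq_some_iff] at hf
    obtain ⟨x, hx, hf⟩ := hf
    obtain ⟨h1, h2⟩ := h.fwd hx
    obtain ⟨h3, h4⟩ := ih (isWalker_rot h1.1 1) hf
    refine ⟨h3, ?_⟩
    rw [h4, h.pos_rot h1.1.1, Function.iterate_succ_apply, h2, zpow_one]

theorem follow {p : List ℤ} {w w' : Walker} (hw : s.IsWalker w) (hf : s.follow p w = some w') :
    s.IsWalker w' ∧ pos ψ w' = C.follow p (pos ψ w) := by
  induction p generalizing w with
  | nil => cases hf; exact ⟨hw, rfl⟩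
  | cons k p ih =>
    rw [Approx.follow, Option.bind_eq_some_iff] at hf
    obtain ⟨x, hx, hf⟩ := hf
    obtain ⟨h1, h2⟩ := h.fwd hx
    obtain ⟨h3, h4⟩ := ih (isWalker_rot h1.1 k) hf
    refine ⟨h3, ?_⟩
    rw [h4, h.pos_rot h1.1.1, Tessellation.follow, h2]

/-- Known connections are unaffected by operations that only add pending unifications and shortcuts
and change distances. -/
theorem congr {s' : Approx D} (h1 : s'.size = s.size) (h2 : s'.ty = s.ty)
    (h3 : s'.conn = s.conn) (h4 : s'.u = s.u)
    (h5 : ∀ a b, (a, b) ∈ s'.pending → a.1 < s.size ∧ b.1 < s.size ∧ pos ψ a = pos ψ b)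
    (h6 : ∀ a b, s.Rel a b → s.find a = s.find b ∨ (a, b) ∈ s'.pending)
    (h7 : ∀ e p, (e, p) ∈ s'.shortcuts → ∀ d, C.lab d = e → C.follow p d = d)
    (h8 : s'.dist (s.u 0).1 = 0) : s'.Sound C d₀ ψ := by
  have hfind : ∀ a, s'.find a = s.find a := fun a => by simp only [find, rot, h2, h4]
  have hm : ∀ a b, s.Eqv a b → s'.Eqv a b := fun a b => Eqv.mono fun a b hab =>
    Relation.EqvGen.rel _ _ ⟨h1 ▸ hab.1, h1 ▸ hab.2.1, by rw [hfind, hfind]; exact h6 a b hab⟩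
  obtain ⟨size, ty, conn, u, pending, dist, solid, distErr, shortcuts⟩ := s
  obtain ⟨size', ty', conn', u', pending', dist', solid', distErr', shortcuts'⟩ := s'
  simp only at h1 h2 h3 h4
  subst h1 h2 h3 h4
  refine ⟨h.size_pos, h.root, h.lab, h.u_tile, h.u_range, h.u_pos, h.u_ge, h.conn_lt, h.conn_pos,
    fun w x hw hx => ?_, h5, h7, h8⟩
  obtain ⟨w', y, h9, h10, h11, h12⟩ := h.conn_symm w x hw hx
  exact ⟨w', y, h9, hm _ _ h10, h11, hm _ _ h12⟩

theorem connect {a b : Walker} (ha : s.IsWalker a) (hb : s.IsWalker b)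
    (hca : s.conn a.1 a.2 = none) (hcb : s.conn b.1 b.2 = none)
    (hab : C.step (pos ψ a) = pos ψ b) : (s.connect a b).Sound C d₀ ψ := by
  have hconn : ∀ g i x, (s.connect a b).conn g i = some x →
      ((g, i) = a ∧ x = b) ∨ ((g, i) = b ∧ x = a) ∨ s.conn g i = some x := by
    intro g i x hx
    simp only [Approx.connect] at hx
    split_ifs at hx with h1 h2
    · exact .inl ⟨h1, (Option.some_injective _ hx).symm⟩
    · exact .inr (.inl ⟨h2, (Option.some_injective _ hx).symm⟩)
    · exact .inr (.inr hx)
  have hba : ∃ y, (s.connect a b).conn b.1 b.2 = some y ∧ s.Eqv y a := by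
    by_cases h1 : b = a
    · exact ⟨b, by simp [Approx.connect, h1], by rw [h1]; exact .refl _⟩
    · exact ⟨a, by simp [Approx.connect, h1], .refl _⟩
  have hab' : (s.connect a b).conn a.1 a.2 = some b := by simp [Approx.connect]
  refine ⟨h.size_pos, h.root, h.lab, h.u_tile, h.u_range, h.u_pos, h.u_ge, ?_, ?_, ?_, h.pending,
    h.shortcuts, h.root_dist⟩
  · intro g i x hx
    rcases hconn g i x hx with ⟨rfl, rfl⟩ | ⟨rfl, rfl⟩ | h1
    · exact ⟨ha.1.1, hb.1.1⟩
    · exact ⟨hb.1.1, ha.1.1⟩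
    · exact h.conn_lt _ _ _ h1
  · intro g i x hx
    rcases hconn g i x hx with ⟨h1, rfl⟩ | ⟨h1, rfl⟩ | h1
    · rw [h1, hab]
    · rw [h1, ← hab, C.step_step]
    · exact h.conn_pos _ _ _ h1
  · intro w x hw hx
    rcases hconn w.1 w.2 x hx with ⟨h1, rfl⟩ | ⟨h1, rfl⟩ | h1
    · obtain ⟨y, h2, h3⟩ := hba
      rw [show w = a from h1]
      exact ⟨x, y, hb, .refl _, h2, h3⟩
    · rw [show w = b from h1]
      exact ⟨x, b, ha, .refl _, hab', .refl _⟩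
    · obtain ⟨w', y, h2, h3, h4, h5⟩ := h.conn_symm w x hw h1
      refine ⟨w', y, h2, h3, ?_, h5⟩
      have hne₁ : w' ≠ a := fun h => by rw [h, hca] at h4; cases h4
      have hne₂ : w' ≠ b := fun h => by rw [h, hcb] at h4; cases h4
      simp [Approx.connect, hne₁, hne₂, h4]

/-- A new tile is placed in `C` on the other side of the edge over which it has been created. -/
theorem generate {w : Walker} (hw : s.IsWalker w) (hf : s.fwd w = none) :
    ∃ ψ', (s.generate w).Sound C d₀ ψ' := by
  set e := D.c (s.edge w) with he
  let s₁ : Approx D :=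
    { s with size := s.size + 1, ty := fun g => if g = s.size then e.1 else s.ty g }
  let ψ' : ℕ → C.Dart := fun g =>
    if g = s.size then (C.rot ^ (-(e.2.val : ℤ))) (C.step (pos ψ w)) else ψ g
  have hψ : ∀ g < s.size, ψ' g = ψ g := fun g hg => if_neg hg.ne
  have hpos : ∀ w : Walker, w.1 < s.size → pos ψ' w = pos ψ w := fun w hw => by
    rw [pos, hψ _ hw]; rfl
  have hty : ∀ g < s.size, s₁.ty g = s.ty g := fun g hg => if_neg hg.ne
  have htile : ∀ g < s.size, s.IsTile g → s₁.IsTile g := fun g hg h =>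
    ⟨Nat.lt_succ_of_lt h.1, h.2⟩
  have hwalk : ∀ w, s.IsWalker w → s₁.IsWalker w := fun w hw =>
    ⟨htile _ hw.1.1 hw.1, hw.2.1, by rw [hty _ hw.1.1]; exact hw.2.2⟩
  have hlab : C.lab (C.step (pos ψ w)) = D.edge e.1 (e.2.val : ℤ) := by
    have : NeZero (D.n e.1) := ⟨fun h0 => by
      have := D.polygon e.1; rw [h0, Nat.zero_mul] at this; omega⟩
    rw [C.lab_step, h.lab_pos hw.1.1, ← he, ATD.edge]
    simp
  have hu : s.u s.size = (s.size, 0) := h.u_ge _ le_rfl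
  have h₁ : s₁.Sound C d₀ ψ' := by
    refine ⟨Nat.succ_pos _, ?_, ?_, ?_, ?_, ?_, ?_, ?_, ?_, ?_, ?_, h.shortcuts, h.root_dist⟩
    · rw [hψ _ h.size_pos, h.root]
    · intro g hg
      rcases Nat.lt_succ_iff_lt_or_eq.1 hg with hg | rfl
      · rw [hψ g hg, hty g hg]; exact h.lab g hg
      · simp only [ψ', s₁, if_true]
        rw [C.lab_zpow_edge hlab]; simp
    · intro g hg
      rcases Nat.lt_succ_iff_lt_or_eq.1 hg with hg | rfl
      · exact htile _ (h.u_tile g hg).1 (h.u_tile g hg)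
      · change s₁.IsTile (s.u s.size).1
        rw [hu]; exact ⟨Nat.lt_succ_self _, hu⟩
    · intro g hg
      rcases Nat.lt_succ_iff_lt_or_eq.1 hg with hg | rfl
      · change _ ∧ _ < (D.sides (s₁.ty (s.u g).1) : ℤ)
        rw [hty _ (h.u_tile g hg).1]; exact h.u_range g hg
      · change 0 ≤ (s.u s.size).2 ∧ (s.u s.size).2 < (D.sides (s₁.ty _) : ℤ)
        rw [hu]; exact ⟨le_rfl, RTS.sides_pos D _⟩
    · intro g hg
      change pos ψ' (s.u g) = ψ' g
      rcases Nat.lt_succ_iff_lt_or_eq.1 hg with hg | rfl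
      · rw [hpos _ (h.u_tile g hg).1, hψ g hg, h.u_pos g hg]
      · rw [hu, pos]; simp
    · exact fun g hg => h.u_ge g (Nat.le_of_succ_le hg)
    · exact fun g i x hx => ⟨Nat.lt_succ_of_lt (h.conn_lt g i x hx).1,
        Nat.lt_succ_of_lt (h.conn_lt g i x hx).2⟩
    · intro g i x hx
      rw [hpos _ (h.conn_lt g i x hx).2, hpos (g, i) (h.conn_lt g i x hx).1]
      exact h.conn_pos g i x hx
    · intro w x hw hx
      have hlt := (h.conn_lt _ _ _ hx).1
      have hw' : s.IsWalker w := ⟨⟨hlt, hw.1.2⟩, hw.2.1, by rw [← hty _ hlt]; exact hw.2.2⟩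
      obtain ⟨w', y, h1, h2, h3, h4⟩ := h.conn_symm w x hw' hx
      have hm : ∀ a b, s.Eqv a b → s₁.Eqv a b := fun a b => Eqv.mono fun a b hab => by
        have hfind : ∀ a : Walker, a.1 < s.size → s₁.find a = s.find a := by
          intro a ha
          simp only [find, rot]
          rw [hty _ (h.u_tile _ ha).1]
        refine Relation.EqvGen.rel _ _ ⟨Nat.lt_succ_of_lt hab.1, Nat.lt_succ_of_lt hab.2.1, ?_⟩
        rw [hfind a hab.1, hfind b hab.2.1]; exact hab.2.2
      exact ⟨w', y, hwalk _ h1, hm _ _ h2, h3, hm _ _ h4⟩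
    · intro a b hab
      obtain ⟨h1, h2, h3⟩ := h.pending a b hab
      exact ⟨Nat.lt_succ_of_lt h1, Nat.lt_succ_of_lt h2, by rw [hpos _ h1, hpos _ h2, h3]⟩
  refine ⟨ψ', h₁.connect (hwalk _ hw) ?_ ?_ ?_ ?_⟩
  · refine ⟨⟨Nat.lt_succ_self _, hu⟩, Int.natCast_nonneg _, ?_⟩
    change _ < (D.sides (if s.size = s.size then e.1 else s.ty s.size) : ℤ)
    rw [if_pos rfl, Nat.cast_lt]
    have h3 := D.polygon e.1
    have hn : 0 < D.n e.1 := Nat.pos_of_ne_zero fun h0 => by rw [h0, Nat.zero_mul] at h3; omega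
    have hs : 0 < D.s e.1 := Nat.pos_of_ne_zero fun h0 => by rw [h0, Nat.mul_zero] at h3; omega
    have : NeZero (D.n e.1) := ⟨hn.ne'⟩
    exact (ZMod.val_lt _).trans_le (Nat.le_mul_of_pos_right _ hs)
  · simpa [Approx.fwd] using hf
  · change s.conn s.size _ = none
    by_contra hne
    obtain ⟨x, hx⟩ := Option.ne_none_iff_exists'.1 hne
    exact absurd (h.conn_lt _ _ _ hx).1 (lt_irrefl _)
  · have hnew : ψ' s.size = (C.rot ^ (-(e.2.val : ℤ))) (C.step (pos ψ w)) := if_pos rfl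
    change C.step (pos ψ' w) = (C.rot ^ (e.2.val : ℤ)) (ψ' s.size)
    rw [hpos _ hw.1.1, hnew, ← Equiv.Perm.mul_apply, ← zpow_add]; simp

end Sound

end Approx

/-! ### Unification and the steps of the algorithm -/

namespace Approx

variable {D : ATD} {C : Tessellation D} {d₀ : C.Dart}

namespace Sound

variable {s : Approx D} {ψ : ℕ → C.Dart} (h : s.Sound C d₀ ψ)
include h

/-- Unifying two treewalkers at the same place of `C` preserves soundness.  A connection of the
tile that is given up is either moved to the other tile, or its end is going to be unified with the
end of the connection already present there, so that connections remain symmetric. -/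
theorem merge {a b : Walker} {rest : List (Walker × Walker)} (ha : s.IsWalker a)
    (hb : s.IsWalker b) (hab : a.1 ≠ b.1) (hpos : pos ψ a = pos ψ b)
    (hrest : ∀ x ∈ rest, x ∈ s.pending)
    (hpend : ∀ x y, (x, y) ∈ s.pending → (x, y) ∈ rest ∨ (s.find x = a ∧ s.find y = b)) :
    (s.merge a b rest).Sound C d₀ ψ := by
  set δ := a.2 - b.2 with hδ
  set s' := s.merge a b rest with hs'
  have hty : s.ty b.1 = s.ty a.1 := by
    have h1 := h.lab_pos ha.1.1
    rw [hpos, h.lab_pos hb.1.1] at h1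
    exact congrArg Sigma.fst h1
  set N := (D.sides (s.ty a.1) : ℤ) with hN
  have hN0 : 0 < N := RTS.sides_pos D _
  have hlaba : (C.lab (ψ a.1)).1 = s.ty a.1 := by rw [h.lab _ ha.1.1]; rfl
  have hlabb : (C.lab (ψ b.1)).1 = s.ty a.1 := by rw [h.lab _ hb.1.1, hty]; rfl
  have hψ : (C.rot ^ δ) (ψ a.1) = ψ b.1 := by
    have h1 : (C.rot ^ (-b.2)) (pos ψ a) = (C.rot ^ (-b.2)) (pos ψ b) := by rw [hpos]
    simp only [pos, ← Equiv.Perm.mul_apply, ← zpow_add] at h1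
    rw [hδ, sub_eq_neg_add, h1]; simp
  -- `F` sends the treewalkers of the tile that is given up to those of the other tile
  let F : Walker → Walker := fun w => if w.1 = b.1 then (a.1, (w.2 + δ) % N) else w
  have hFb : ∀ i, F (b.1, i) = (a.1, (i + δ) % N) := fun i => if_pos rfl
  have hF : ∀ w : Walker, w.1 ≠ b.1 → F w = w := fun w hw => if_neg hw
  have hu : ∀ g, s'.u g = if (s.u g).1 = b.1 then (a.1, (0 + ((s.u g).2 + δ)) % N) else s.u g :=
    fun g => rfl
  have hfind : ∀ w, s'.find w = F (s.find w) := by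
    intro w
    change s.rot w.2 (s'.u w.1) = F (s.rot w.2 (s.u w.1))
    rw [hu]
    by_cases h1 : (s.u w.1).1 = b.1
    · rw [if_pos h1]
      have h2 : s.rot w.2 (s.u w.1) = (b.1, ((s.u w.1).2 + w.2) % N) := by
        simp only [rot, h1, hty]; rfl
      rw [h2, hFb]
      simp only [rot, ← hN, Int.emod_add_emod]
      congr 2; ring
    · rw [if_neg h1]; exact (hF (s.rot w.2 (s.u w.1)) h1).symm
  have htile : ∀ g, s'.IsTile g ↔ s.IsTile g ∧ g ≠ b.1 := by
    intro g
    constructor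
    · rintro ⟨h1, h2⟩
      rw [hu] at h2
      split_ifs at h2 with h3
      · exfalso
        have h4 : a.1 = g := congrArg Prod.fst h2
        rw [← h4, ha.1.2] at h3
        exact hab h3
      · exact ⟨⟨h1, h2⟩, fun h4 => h3 (by rw [h2, h4])⟩
    · rintro ⟨⟨h1, h2⟩, h3⟩
      refine ⟨h1, ?_⟩
      rw [hu, if_neg (by rw [h2]; exact h3), h2]
  have hwalk : ∀ w, s'.IsWalker w ↔ s.IsWalker w ∧ w.1 ≠ b.1 := by
    intro w
    constructor
    · rintro ⟨h1, h2⟩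
      rw [htile] at h1
      exact ⟨⟨h1.1, h2⟩, h1.2⟩
    · rintro ⟨⟨h1, h2⟩, h3⟩
      exact ⟨(htile _).2 ⟨h1, h3⟩, h2⟩
  have hta : s'.IsTile a.1 := (htile _).2 ⟨ha.1, hab⟩
  have hconn : ∀ g i, s'.conn g i = if g = a.1 then
      (match s.conn a.1 i with
        | some x => some x
        | none => s.conn b.1 ((0 + (i - δ)) % N)) else s.conn g i := by
    intro g i
    rw [hN, ← hty]; rfl
  have hmem : ∀ x, x ∈ s'.pending ↔ (∃ j : ℕ, (j : ℤ) < N ∧ s.conn a.1 j = some x.1 ∧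
      s.conn b.1 ((0 + (j - δ)) % N) = some x.2) ∨ x ∈ rest := by
    intro x
    have hrot : ∀ k, (s.rot k (b.1, 0)).2 = (0 + k) % N := fun k => by
      simp only [rot]; rw [hty]
    have : s'.pending = (List.range (D.sides (s.ty a.1))).filterMap (fun j : ℕ =>
        match s.conn a.1 j, s.conn b.1 (s.rot (j - δ) (b.1, 0)).2 with
        | some x, some y => some (x, y)
        | _, _ => none) ++ rest := rfl
    rw [this, List.mem_append, List.mem_filterMap]
    refine or_congr_left (exists_congr fun j => ?_)
    rw [List.mem_range, hN, Nat.cast_lt, ← hN, ← hrot]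
    refine and_congr_right fun _ => ?_
    cases s.conn a.1 j <;> cases s.conn b.1 (s.rot (j - δ) (b.1, 0)).2 <;>
      simp [Prod.ext_iff]
  have hconn_cases : ∀ g i x, s'.conn g i = some x → s.conn g i = some x ∨
      (g = a.1 ∧ s.conn a.1 i = none ∧ s.conn b.1 ((0 + (i - δ)) % N) = some x) := by
    intro g i x hx
    rw [hconn] at hx
    split_ifs at hx with h1
    · subst h1
      cases h2 : s.conn a.1 i with
      | some y => rw [h2] at hx; exact .inl hx
      | none => rw [h2] at hx; exact .inr ⟨rfl, rfl, hx⟩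
    · exact .inl hx
  have hposb : ∀ i, pos ψ (b.1, (0 + (i - δ)) % N) = pos ψ (a.1, i) := by
    intro i
    simp only [pos]
    rw [C.zpow_emod hlabb, ← hψ, ← Equiv.Perm.mul_apply, ← zpow_add]
    congr 2; ring
  have hm : ∀ x y, s.Eqv x y → s'.Eqv x y := fun x y => Eqv.mono fun x y hxy => by
    refine Relation.EqvGen.rel _ _ ⟨hxy.1, hxy.2.1, ?_⟩
    rw [hfind, hfind]
    rcases hxy.2.2 with h1 | h1
    · exact .inl (by rw [h1])
    · rcases hpend x y h1 with h2 | ⟨h2, h3⟩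
      · exact .inr ((hmem _).2 (.inr h2))
      · refine .inl ?_
        rw [h2, h3, hF a hab, show b = (b.1, b.2) from rfl, hFb, hδ]
        rw [show b.2 + (a.2 - b.2) = a.2 by ring, Int.emod_eq_of_lt ha.2.1 ha.2.2]
  have hFwalk : ∀ w, s.IsWalker w → s'.IsWalker (F w) ∧ s'.Eqv (F w) w := by
    intro w hw
    have h1 : s'.IsWalker (F w) := by
      by_cases hwb : w.1 = b.1
      · rw [show w = (w.1, w.2) from rfl, hwb, hFb]
        exact ⟨hta, Int.emod_nonneg _ hN0.ne', Int.emod_lt_of_pos _ hN0⟩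
      · rw [hF w hwb]; exact (hwalk w).2 ⟨hw, hwb⟩
    have h2 := (hwalk _).1 h1
    refine ⟨h1, .rel _ _ ⟨h1.1.1, hw.1.1, .inl ?_⟩⟩
    rw [hfind, hfind, find_of_isWalker h2.1, find_of_isWalker hw, hF _ h2.2]
  have hA : ∀ w y, s.IsWalker w → s.conn w.1 w.2 = some y →
      ∃ y', s'.conn (F w).1 (F w).2 = some y' ∧ s'.Eqv y' y := by
    intro w y hw hy
    by_cases hwb : w.1 = b.1
    · obtain ⟨g, i⟩ := w
      simp only at hwb hy
      subst hwb
      have hi : (0 + ((i + δ) % N - δ)) % N = i := by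
        rw [zero_add, ← Int.emod_emod_of_dvd _ (dvd_refl N), Int.emod_sub_emod]
        rw [show i + δ - δ = i by ring]
        have := hw.2.2
        simp only [hty] at this
        rw [Int.emod_emod_of_dvd _ (dvd_refl N), Int.emod_eq_of_lt hw.2.1 this]
      rw [hFb]
      simp only [hconn, if_true, hi]
      cases h2 : s.conn a.1 ((i + δ) % N) with
      | none => exact ⟨y, hy, .refl _⟩
      | some z =>
        refine ⟨z, rfl, .rel _ _ ⟨(h.conn_lt _ _ _ h2).2, (h.conn_lt _ _ _ hy).2,
          .inr ((hmem _).2 (.inl ?_))⟩⟩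
        obtain ⟨j, hj⟩ := Int.eq_ofNat_of_zero_le (Int.emod_nonneg (i + δ) hN0.ne')
        refine ⟨j, ?_, ?_, ?_⟩
        · rw [← hj]; exact Int.emod_lt_of_pos _ hN0
        · rw [← hj]; exact h2
        · rw [← hj, hi]; exact hy
    · rw [hF w hwb, hconn]
      split_ifs with h1
      · rw [h1] at hy; rw [hy]; exact ⟨y, rfl, .refl _⟩
      · exact ⟨y, hy, .refl _⟩
  refine ⟨h.size_pos, h.root, h.lab, ?_, ?_, ?_, ?_, ?_, ?_, ?_, ?_, h.shortcuts, ?_⟩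
  · intro g hg
    rw [hu]
    split_ifs with h1
    · exact hta
    · exact (htile _).2 ⟨h.u_tile g hg, h1⟩
  · intro g hg
    rw [hu]
    split_ifs with h1
    · exact ⟨Int.emod_nonneg _ hN0.ne', Int.emod_lt_of_pos _ hN0⟩
    · exact h.u_range g hg
  · intro g hg
    rw [hu]
    split_ifs with h1
    · have h2 := h.u_pos g hg
      simp only [pos] at h2 ⊢
      rw [C.zpow_emod hlaba, zero_add, zpow_add, Equiv.Perm.mul_apply, hψ, ← h1, h2]
    · exact h.u_pos g hg
  · intro g hg
    have hg' : s.size ≤ g := hg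
    rw [hu, h.u_ge g hg', if_neg]
    exact fun h1 => absurd hb.1.1 (by rw [← h1]; exact not_lt.2 hg')
  · intro g i x hx
    rcases hconn_cases g i x hx with h1 | ⟨rfl, -, h1⟩
    · exact h.conn_lt _ _ _ h1
    · exact ⟨ha.1.1, (h.conn_lt _ _ _ h1).2⟩
  · intro g i x hx
    rcases hconn_cases g i x hx with h1 | ⟨rfl, -, h1⟩
    · exact h.conn_pos _ _ _ h1
    · rw [← h.conn_pos _ _ _ h1, hposb]
  · intro w x hw hx
    obtain ⟨hws, hwb⟩ := (hwalk w).1 hw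
    obtain ⟨w₀, hw₀, hx₀, hFw⟩ : ∃ w₀, s.IsWalker w₀ ∧ s.conn w₀.1 w₀.2 = some x ∧ F w₀ = w := by
      rcases hconn_cases _ _ x hx with h1 | ⟨h1, -, h2⟩
      · exact ⟨w, hws, h1, hF w hwb⟩
      · refine ⟨(b.1, (0 + (w.2 - δ)) % N), ⟨hb.1, Int.emod_nonneg _ hN0.ne', ?_⟩, h2, ?_⟩
        · simp only [hty]; exact Int.emod_lt_of_pos _ hN0
        · rw [hFb, Int.emod_add_emod, show 0 + (w.2 - δ) + δ = w.2 by ring]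
          have := hws.2.2
          rw [h1] at this
          rw [Int.emod_eq_of_lt hws.2.1 this, ← h1]
    obtain ⟨w₁, y, h1, h2, h3, h4⟩ := h.conn_symm w₀ x hw₀ hx₀
    obtain ⟨y', h5, h6⟩ := hA w₁ y h1 h3
    obtain ⟨h7, h8⟩ := hFwalk w₁ h1
    have h9 := (hFwalk w₀ hw₀).2
    rw [hFw] at h9
    exact ⟨F w₁, y', h7, h8.trans _ _ _ (hm _ _ h2), h5,
      (h6.trans _ _ _ (hm _ _ h4)).trans _ _ _ (h9.symm _ _)⟩
  · intro x y hxy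
    rcases (hmem _).1 hxy with ⟨j, -, h1, h2⟩ | h1
    · refine ⟨(h.conn_lt _ _ _ h1).2, (h.conn_lt _ _ _ h2).2, ?_⟩
      rw [← h.conn_pos _ _ _ h1, ← h.conn_pos _ _ _ h2, hposb]
    · exact h.pending _ _ (hrest _ h1)
  · have hdist : ∀ g, s'.dist g = if g = a.1 then min (s.dist a.1) (s.dist b.1) else s.dist g :=
      fun g => rfl
    have h0 := h.root_dist
    rw [hu, hdist]
    by_cases h1 : (s.u 0).1 = b.1
    · rw [if_pos h1, if_pos rfl, ← h1, h0]; simp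
    · rw [if_neg h1]
      split_ifs with h2
      · rw [← h2, h0]; simp
      · exact h0

end Sound

theorem sound_start (C : Tessellation D) {d₀ : C.Dart} {t₀ : D.T}
    (h₀ : C.lab d₀ = D.edge t₀ 0) : (start D t₀).Sound C d₀ fun _ => d₀ where
  size_pos := Nat.one_pos
  root := rfl
  lab := fun _ _ => h₀
  u_tile := fun _ hg => ⟨hg, rfl⟩
  u_range := fun _ _ => ⟨le_rfl, RTS.sides_pos D _⟩
  u_pos := fun _ _ => by simp [pos, start]
  u_ge := fun _ _ => rfl
  conn_lt := fun _ _ _ hx => by simp [start] at hx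
  conn_pos := fun _ _ _ hx => by simp [start] at hx
  conn_symm := fun _ _ _ hx => by simp [start] at hx
  pending := fun _ _ hab => by simp [start] at hab
  shortcuts := fun _ _ hp => by simp [start] at hp
  root_dist := by simp [start]

/-- Every operation on the approximation preserves its soundness: what is concluded from valences is
true of `C` because the vertices of `C` have these valences, and shortcuts are true of `C` because
edges of the same type are equivalent under its symmetries. -/
theorem Step.sound {s s' : Approx D} {ψ : ℕ → C.Dart} (hs : Step s s') (h : s.Sound C d₀ ψ) :
    ∃ ψ', s'.Sound C d₀ ψ' := by
  have hdemand : ∀ w w', s.IsWalker w → s.IsWalker w' → pos ψ w = pos ψ w' →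
      (s.demand w w').Sound C d₀ ψ := by
    intro w w' hw hw' hp
    refine h.congr rfl rfl rfl rfl ?_ ?_ h.shortcuts h.root_dist
    · intro a b hab
      rcases List.mem_cons.1 hab with heq | hab
      · cases heq; exact ⟨hw.1.1, hw'.1.1, hp⟩
      · exact h.pending _ _ hab
    · exact fun a b hab => hab.2.2.imp_right fun hm => List.mem_cons_of_mem _ hm
  cases hs with
  | generate w hw hf => exact h.generate hw hf
  | close w w' hw ha hf hf' =>
    obtain ⟨h1, h2⟩ := h.around hw ha
    have hr : s.IsWalker (s.rot (-1) w) := Sound.isWalker_rot hw.1 _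
    refine ⟨ψ, h.connect h1 hr (by simpa [fwd] using hf) (by simpa [fwd] using hf') ?_⟩
    -- the last of the `v` edges at the vertex is the one before `w`
    have hv := C.vertex_iterate (pos ψ w)
    have hpos := D.valence_pos (s.edge w)
    rw [h.lab_pos hw.1.1, show D.v (s.edge w) = D.v (s.edge w) - 1 + 1 by omega,
      Function.iterate_succ_apply', ← h2] at hv
    rw [h.pos_rot hw.1.1]
    apply C.rot.injective
    rw [hv]; simp
  | overfull w w' hw ha _ =>
    obtain ⟨h1, h2⟩ := h.around hw ha
    refine ⟨ψ, hdemand w w' hw h1 ?_⟩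
    rw [h2, ← h.lab_pos hw.1.1, C.vertex_iterate]
  | unify a b rest hp hne =>
    have hab : (a, b) ∈ s.pending := by rw [hp]; exact List.mem_cons_self
    obtain ⟨h1, h2, h3⟩ := h.pending _ _ hab
    refine ⟨ψ, h.merge (h.isWalker_find h1) (h.isWalker_find h2) hne
      (by rw [h.pos_find h1, h.pos_find h2, h3])
      (fun x hx => by rw [hp]; exact List.mem_cons_of_mem _ hx) fun x y hxy => ?_⟩
    rw [hp] at hxy
    rcases List.mem_cons.1 hxy with heq | hxy
    · cases heq; exact .inr ⟨rfl, rfl⟩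
    · exact .inl hxy
  | unified a b rest hp heq =>
    have hab : (a, b) ∈ s.pending := by rw [hp]; exact List.mem_cons_self
    obtain ⟨h1, h2, h3⟩ := h.pending _ _ hab
    refine ⟨ψ, h.congr rfl rfl rfl rfl ?_ ?_ h.shortcuts h.root_dist⟩
    · exact fun x y hxy => h.pending x y (by rw [hp]; exact List.mem_cons_of_mem _ hxy)
    · intro x y hxy
      rcases hxy.2.2 with h4 | h4
      · exact .inl h4
      · rw [hp] at h4
        rcases List.mem_cons.1 h4 with h5 | h5
        · cases h5
          -- one tile cannot be unified with itself in two ways, since its edges are distinct in `C`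
          left
          have ha := h.isWalker_find h1
          have hb := h.isWalker_find h2
          rw [← h.pos_find h1, ← h.pos_find h2, pos, pos, ← heq] at h3
          have hlab : (C.lab (ψ (s.find a).1)).1 = s.ty (s.find a).1 := by
            rw [h.lab _ ha.1.1]; rfl
          rw [C.zpow_eq_zpow_iff hlab] at h3
          unfold Int.ModEq at h3
          have hb2 := hb.2.2
          rw [← heq] at hb2
          rw [Int.emod_eq_of_lt ha.2.1 ha.2.2, Int.emod_eq_of_lt hb.2.1 hb2] at h3
          exact Prod.ext heq h3
        · exact .inr h5
  | relax w w' hw hf hlt =>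
    refine ⟨ψ, h.congr rfl rfl rfl rfl h.pending (fun _ _ hab => hab.2.2) h.shortcuts ?_⟩
    change (if (s.u 0).1 = w'.1 then _ else _) = (0 : ℕ∞)
    split_ifs with h1
    · rw [← h1, h.root_dist] at hlt; exact absurd hlt (by simp)
    · exact h.root_dist
  | solidify g hg =>
    exact ⟨ψ, h.congr rfl rfl rfl rfl h.pending (fun _ _ hab => hab.2.2) h.shortcuts h.root_dist⟩
  | restart =>
    exact ⟨ψ, h.congr rfl rfl rfl rfl h.pending (fun _ _ hab => hab.2.2) h.shortcuts h.root_dist⟩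
  | record w p hw hf =>
    refine ⟨ψ, h.congr rfl rfl rfl rfl h.pending (fun _ _ hab => hab.2.2) ?_ h.root_dist⟩
    intro e q hq d hd
    rcases List.mem_cons.1 hq with heq | hq
    · cases heq
      rw [← h.lab_pos hw.1.1] at hd
      exact C.follow_eq_self hd (h.follow hw hf).2.symm
    · exact h.shortcuts e q hq d hd
  | shortcut w w' p hw hp hf _ =>
    obtain ⟨h1, h2⟩ := h.follow hw hf
    refine ⟨ψ, hdemand w w' hw h1 ?_⟩
    rw [h2, h.shortcuts _ _ hp _ (h.lab_pos hw.1.1)]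

namespace Sound

variable {s : Approx D} {ψ : ℕ → C.Dart} (h : s.Sound C d₀ ψ)
include h

/-- When no unification is pending, stepping forward is symmetric. -/
theorem fwd_symm (hp : s.pending = []) {w w' : Walker} (hw : s.IsWalker w)
    (hf : s.fwd w = some w') : s.fwd w' = some w := by
  have heqv : ∀ a b, s.Eqv a b → s.find a = s.find b := by
    intro a b hab
    induction hab with
    | rel _ _ hr =>
      rcases hr.2.2 with h1 | h1
      · exact h1
      · rw [hp] at h1; cases h1
    | refl => rfl
    | symm _ _ _ ih => exact ih.symm
    | trans _ _ _ _ _ ih₁ ih₂ => exact ih₁.trans ih₂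
  rw [Approx.fwd, Option.map_eq_some_iff] at hf
  obtain ⟨x, hx, rfl⟩ := hf
  obtain ⟨w', y, h1, h2, h3, h4⟩ := h.conn_symm w x hw hx
  rw [← heqv _ _ h2, find_of_isWalker h1, Approx.fwd, h3, Option.map_some, heqv _ _ h4,
    find_of_isWalker hw]

theorem rootWalker_eq : s.rootWalker = s.u 0 := by
  obtain ⟨h1, h2⟩ := h.u_range 0 h.size_pos
  simp only [rootWalker, find, rot, add_zero]
  rw [Int.emod_eq_of_lt h1 h2]

theorem isWalker_rootWalker : s.IsWalker s.rootWalker := h.isWalker_find h.size_pos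

theorem pos_rootWalker : pos ψ s.rootWalker = d₀ := by
  rw [h.rootWalker_eq, h.u_pos 0 h.size_pos, h.root]

theorem dist_rootWalker : s.dist s.rootWalker.1 = 0 := by
  rw [h.rootWalker_eq, h.root_dist]

end Sound

end Approx

/-- The invariants of the algorithm: the approximation is true of `C`, the root tile is in `S`, and
the first queries of the decision trees are about the edges of the tile itself. -/
theorem Config.invariant {D : ATD} {C : Tessellation D} {d₀ : C.Dart} {t₀ : D.T}
    (h₀ : C.lab d₀ = D.edge t₀ 0) {A : Config D}
    (hA : Relation.ReflTransGen Config.Step (Config.start D t₀) A) :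
    (∃ ψ, A.s.Sound C d₀ ψ) ∧ 0 ∈ A.S ∧
      ∀ t p (l : List Cls), l.length < D.sides t → A.rules t p l = some (0, l.length) := by
  have hstart : ∀ t p (l : List Cls), l.length < D.sides t →
      Rules.start D t p l = some (0, l.length) := fun t p l hl => if_pos hl
  induction hA with
  | refl => exact ⟨⟨_, Approx.sound_start C h₀⟩, Finset.mem_singleton_self _, hstart⟩
  | tail _ hs ih =>
    obtain ⟨⟨ψ, h1⟩, h2, h3⟩ := ih
    cases hs with
    | approx s' hs => exact ⟨hs.sound h1, h2, h3⟩
    | addTile g _ => exact ⟨⟨ψ, h1⟩, Finset.mem_insert_of_mem h2, h3⟩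
    | reduce S' _ h0 => exact ⟨⟨ψ, h1⟩, h0, h3⟩
    | extend q i j hq _ _ =>
      refine ⟨⟨ψ, h1⟩, h2, fun t p l hl => ?_⟩
      simp only [Rules.extend]
      rw [if_neg, h3 t p l hl]
      rintro ⟨rfl, rfl, rfl⟩
      rw [h3 _ _ _ hl] at hq; cases hq
    | refresh => exact ⟨⟨ψ, h1⟩, Finset.mem_singleton_self _, hstart⟩

/-! ### States and the candidate -/

namespace Info

variable {D : ATD}

/-- What is known about the cached information, the set `S` and the candidate `R` when the
algorithm terminates successfully, apart from the validation of `R`. -/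
structure Successful (I : Info D) (S : Finset ℕ) (R : RTS D (Code D)) (C : Tessellation D)
    (d₀ : C.Dart) (ψ : ℕ → C.Dart) : Prop where
  sound : I.s.Sound C d₀ ψ
  stable : I.s.Stable
  valid : I.Valid
  zero_mem : 0 ∈ S
  rules : ∀ t p (l : List Cls), l.length < D.sides t → I.rules t p l = some (0, l.length)
  closed : I.Closed S
  candidate : I.IsCandidate S R
  root_edge : C.lab d₀ = D.edge (I.s.ty I.s.rootWalker.1) 0

/-- The classifications that correspond to a value of a transition rule. -/
inductive Fits : Cls → TreeEdge (Code D) → Prop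
  | parent : Fits .parent .parent
  | child (q) : Fits .child (.child q)
  | left (d) : Fits (.nontree .left d) .left
  | right (d) : Fits (.nontree .right d) .right

theorem Reads.fits {I : Info D} {w : Walker} {c : Cls} {x : TreeEdge (Code D)}
    (h : I.Reads w c x) : Fits c x := by
  cases h
  · exact .parent
  · exact .child _
  · exact .left _
  · exact .right _

theorem base_fst {I : Info D} {g : ℕ} {b : Walker} (h : I.base g = some b) : b.1 = g := by
  unfold base at h
  split_ifs at h with h1
  · cases h; exact h1.symm
  · obtain ⟨p, -, rfl⟩ := Option.map_eq_some_iff.1 h; rfl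

theorem At.range {I : Info D} {w : Walker} {q : Code D} {i : ℤ} (h : I.At w q i) :
    0 ≤ i ∧ i < D.sides q.typ := by
  obtain ⟨-, -, b, -, rfl⟩ := h
  exact ⟨Int.emod_nonneg _ (RTS.sides_pos D _).ne', Int.emod_lt_of_pos _ (RTS.sides_pos D _)⟩

theorem HasState.at {I : Info D} {w : Walker} {q : Code D} (h : I.HasState w.1 q)
    (hw : I.s.IsWalker w) : ∃ i, I.At w q i := by
  obtain ⟨b, hb, -⟩ := h.2.2
  exact ⟨_, hw, h, b, hb, rfl⟩

theorem HasState.exists_at {I : Info D} {g : ℕ} {q : Code D} (h : I.HasState g q) (i : ℤ) :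
    ∃ w : Walker, w.1 = g ∧ I.At w q (i % D.sides q.typ) := by
  obtain ⟨b, hb, -⟩ := h.2.2
  have hbg := base_fst hb
  refine ⟨I.s.rot (i - q.par.getD 0) b, hbg, ?_, ?_, b, ?_, ?_⟩
  · exact Approx.Sound.isWalker_rot (by rw [hbg]; exact h.1) _
  · change I.HasState b.1 q; rw [hbg]; exact h
  · change I.base b.1 = _; rw [hbg]; exact hb
  · simp only [Approx.rot]
    rw [hbg, ← h.2.1]
    refine Int.ModEq.symm ((((Int.mod_modEq _ _).sub_right b.2).add_right _).trans ?_)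
    rw [show b.2 + (i - q.par.getD 0) - b.2 + q.par.getD 0 = i by ring]

theorem At.rot {I : Info D} {w : Walker} {q : Code D} {i : ℤ} (h : I.At w q i) (k : ℤ) :
    I.At (I.s.rot k w) q ((i + k) % D.sides q.typ) := by
  obtain ⟨hw, hq, b, hb, rfl⟩ := h
  refine ⟨Approx.Sound.isWalker_rot hw.1 _, hq, b, hb, ?_⟩
  simp only [Approx.rot]
  rw [← hq.2.1, Int.emod_add_emod]
  refine Int.ModEq.symm ((((Int.mod_modEq _ _).sub_right b.2).add_right _).trans ?_)
  rw [show w.2 + k - b.2 + q.par.getD 0 = w.2 - b.2 + q.par.getD 0 + k by ring]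

theorem Asked.head {I : Info D} {t : D.T} {p : Option ℤ} {b : Walker} {ws : List Walker}
    {l : List Cls} (h : I.Asked t p b ws l) : ws[0]? = some b ∧ ws.length = l.length + 1 := by
  induction h with
  | start => exact ⟨rfl, rfl⟩
  | ask _ _ _ _ _ _ ih =>
    refine ⟨?_, by simp [ih.2]⟩
    rw [List.getElem?_append_left (by omega)]; exact ih.1

theorem Asked.take {I : Info D} {t : D.T} {p : Option ℤ} {b : Walker} {ws : List Walker}
    {l : List Cls} (h : I.Asked t p b ws l) : ∀ n < l.length, I.rules t p (l.take n) ≠ none := by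
  induction h with
  | start => intro n hn; exact absurd hn (by simp)
  | @ask ws l i j w w' c _ hr _ _ _ _ ih =>
    intro n hn
    rw [List.length_append, List.length_singleton] at hn
    rw [List.take_append_of_le_length (by omega)]
    rcases Nat.lt_succ_iff_lt_or_eq.1 hn with hn | rfl
    · exact ih n hn
    · rw [List.take_length, hr]; simp

namespace Successful

variable {I : Info D} {S : Finset ℕ} {R : RTS D (Code D)} {C : Tessellation D} {d₀ : C.Dart}
  {ψ : ℕ → C.Dart} (h : I.Successful S R C d₀ ψ)
include h

theorem fwd_symm {w w' : Walker} (hw : I.s.IsWalker w) (hf : I.s.fwd w = some w') :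
    I.s.fwd w' = some w := h.sound.fwd_symm h.stable.no_pending hw hf

theorem edge_fwd {w w' : Walker} (hw : I.s.IsWalker w) (hf : I.s.fwd w = some w') :
    I.s.edge w' = D.c (I.s.edge w) := by
  obtain ⟨h1, h2⟩ := h.sound.fwd hf
  rw [← h.sound.lab_pos h1.1.1, ← h2, C.lab_step, h.sound.lab_pos hw.1.1]

theorem parentEdge {w : Walker} (hp : Approx.ParentEdge I.par w) :
    I.s.IsWalker w ∧ ∃ w', I.s.fwd w = some w' ∧ ∃ k : ℕ, I.s.dist w.1 = (k + 1 : ℕ) ∧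
      I.s.dist w'.1 = k := by
  obtain ⟨⟨h1, -, w', h2, -, h3⟩, -⟩ := h.valid.parent _ _ hp
  exact ⟨h1, w', h2, h3⟩

theorem not_parentEdge_root {w : Walker} (hp : Approx.ParentEdge I.par w) :
    w.1 ≠ I.s.rootWalker.1 := by
  intro h1
  obtain ⟨-, -, -, k, h2, -⟩ := h.parentEdge hp
  rw [h1, h.sound.dist_rootWalker] at h2
  have h3 : ((0 : ℕ) : ℕ∞) = ((k + 1 : ℕ) : ℕ∞) := h2
  rw [Nat.cast_inj] at h3
  omega

theorem childEdge {w w' : Walker} (hw : I.s.IsWalker w) (hc : I.s.ChildEdge I.par w)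
    (hf : I.s.fwd w = some w') : Approx.ParentEdge I.par w' ∧
      ∃ k : ℕ, I.s.dist w'.1 = (k + 1 : ℕ) ∧ I.s.dist w.1 = k := by
  obtain ⟨x, hx, hp⟩ := hc
  rw [hf] at hx; cases hx
  obtain ⟨-, y, hy, hk⟩ := h.parentEdge hp
  rw [h.fwd_symm hw hf] at hy; cases hy
  exact ⟨hp, hk⟩

/-- The classification is unique: the cases exclude each other, the parent being closer to the root,
and a difference of distances between `-1` and `1` is recorded faithfully. -/
theorem classify_unique {w : Walker} {c c' : Cls} (hc : I.Classify w c) (hc' : I.Classify w c') :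
    c = c' := by
  have hpc : Approx.ParentEdge I.par w → I.s.ChildEdge I.par w → False := by
    intro hp hch
    obtain ⟨hw, w', hf, k, h1, h2⟩ := h.parentEdge hp
    obtain ⟨-, j, h3, h4⟩ := h.childEdge hw hch hf
    rw [h1, Nat.cast_inj] at h4
    rw [h2, Nat.cast_inj] at h3
    omega
  have hcn : I.s.ChildEdge I.par w → I.s.NonTreeEdge I.par w → False := by
    rintro ⟨w', hf, hp⟩ ⟨w'', hf', -, -, -, hn⟩
    rw [hf] at hf'; cases hf'
    exact hn hp
  cases hc with
  | parent hp =>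
    cases hc' with
    | parent => rfl
    | child hch => exact (hpc hp hch).elim
    | nontree _ _ _ hn => obtain ⟨_, -, -, -, h1, -⟩ := hn; exact (h1 hp).elim
  | child hch =>
    cases hc' with
    | parent hp => exact (hpc hp hch).elim
    | child => rfl
    | nontree _ _ _ hn => exact (hcn hch hn).elim
  | nontree d a b hn hs hf _ _ ha hb hd =>
    cases hc' with
    | parent hp => obtain ⟨_, -, -, -, h1, -⟩ := hn; exact (h1 hp).elim
    | child hch => exact (hcn hch hn).elim
    | nontree d' a' b' _ hs' hf' _ _ ha' hb' hd' =>
      rw [hs] at hs'; cases hs'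
      rw [hf] at hf'; cases hf'
      rw [ha, Nat.cast_inj] at ha'
      rw [hb, Nat.cast_inj] at hb'
      subst ha' hb'
      rw [hd] at hd'
      congr 1
      revert hd'
      cases d <;> cases d' <;> simp

/-- The queries about a tile are determined by the previous answers, so that two runs of queries
agree as far as both of them go. -/
theorem asked_prefix {t : D.T} {p : Option ℤ} {b : Walker} {ws ws' : List Walker}
    {l l' : List Cls} (h1 : I.Asked t p b ws l) (h2 : I.Asked t p b ws' l')
    (hle : l.length ≤ l'.length) : l <+: l' ∧ ws <+: ws' := by
  induction h2 generalizing ws l with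
  | start =>
    cases h1 with
    | start => exact ⟨List.prefix_refl _, List.prefix_refl _⟩
    | ask => simp at hle
  | @ask ws' l' i j w w' c h2 hr _ hwi hcl hf ih =>
    by_cases hlt : l.length ≤ l'.length
    · obtain ⟨h3, h4⟩ := ih h1 hlt
      exact ⟨h3.trans (List.prefix_append _ _), h4.trans (List.prefix_append _ _)⟩
    · cases h1 with
      | start => simp at hlt
      | @ask ws₀ l₀ i' j' w₀ w₀' c₀ h1 hr' _ hwi' hcl' hf' =>
        simp only [List.length_append, List.length_singleton] at hle hlt
        obtain ⟨h3, h4⟩ := ih h1 (by omega)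
        have h5 := h3.eq_of_length (by omega)
        have h6 := h4.eq_of_length (by rw [h1.head.2, h2.head.2]; omega)
        subst h5 h6
        rw [hr] at hr'; cases hr'
        rw [hwi] at hwi'; cases hwi'
        rw [hf] at hf'; cases hf'
        rw [h.classify_unique hcl hcl']
        exact ⟨List.prefix_refl _, List.prefix_refl _⟩

/-- Every tile has at most one state. -/
theorem hasState_unique {g : ℕ} {q q' : Code D} (hq : I.HasState g q) (hq' : I.HasState g q') :
    q = q' := by
  obtain ⟨-, h1, b, hb, h2, ⟨ws, h3⟩, h4⟩ := hq
  obtain ⟨-, h1', b', hb', h2', ⟨ws', h3'⟩, h4'⟩ := hq'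
  rw [hb] at hb'; cases hb'
  have ht : q'.typ = q.typ := h1'.trans h1.symm
  have hp : q'.par = q.par := h2'.trans h2.symm
  rw [ht, hp] at h3' h4'
  have key : ∀ {ws ws' : List Walker} {l l' : List Cls}, I.Asked q.typ q.par b ws l →
      I.Asked q.typ q.par b ws' l' → I.rules q.typ q.par l = none → l.length ≤ l'.length →
      l = l' := by
    intro ws ws' l l' ha ha' hn hle
    have hpre := (h.asked_prefix ha ha' hle).1
    rcases hle.lt_or_eq with hlt | heq
    · have := ha'.take _ hlt
      rw [← List.prefix_iff_eq_take.1 hpre] at this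
      exact absurd hn this
    · exact hpre.eq_of_length heq
  refine Code.ext ht.symm hp.symm ?_
  rcases le_total q.ans.length q'.ans.length with hle | hle
  · exact key h3 h3' h4 hle
  · exact (key h3' h3 h4' hle).symm

theorem at_unique {w : Walker} {q q' : Code D} {i i' : ℤ} (hw : I.At w q i)
    (hw' : I.At w q' i') : q = q' ∧ i = i' := by
  obtain ⟨-, h1, b, hb, rfl⟩ := hw
  obtain ⟨-, h1', b', hb', rfl⟩ := hw'
  rw [hb] at hb'; cases hb'
  cases h.hasState_unique h1 h1'
  exact ⟨rfl, rfl⟩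

theorem asked_classify {t : D.T} {p : Option ℤ} {b : Walker} {ws : List Walker} {l : List Cls}
    (ha : I.Asked t p b ws l) : ∀ j < l.length, j < D.sides t →
      ∃ c, l[j]? = some c ∧ I.Classify (I.s.rot j b) c := by
  induction ha with
  | start => intro j hj; exact absurd hj (by simp)
  | @ask ws l i j w w' c ha hr _ hwi hcl _ ih =>
    intro k hk hkN
    rw [List.length_append, List.length_singleton] at hk
    rcases Nat.lt_succ_iff_lt_or_eq.1 hk with hk | rfl
    · rw [List.getElem?_append_left hk]; exact ih k hk hkN
    · rw [h.rules _ _ _ hkN] at hr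
      cases hr
      rw [ha.head.1] at hwi; cases hwi
      exact ⟨c, by simp, hcl⟩

/-- The state determines the classification of all edges of the tile. -/
theorem at_classify {w : Walker} {q : Code D} {i : ℤ} (hw : I.At w q i) :
    ∃ c, q.ans[((i - q.par.getD 0) % D.sides q.typ).toNat]? = some c ∧ I.Classify w c := by
  obtain ⟨hwk, ⟨-, h1, b', hb', h2, ⟨ws, h3⟩, h4⟩, b, hb, rfl⟩ := hw
  rw [hb] at hb'; obtain rfl : b = b' := Option.some_injective _ hb'
  have hN := RTS.sides_pos D q.typ
  have hlen : D.sides q.typ ≤ q.ans.length := by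
    by_contra hlt
    rw [h.rules _ _ _ (not_le.1 hlt)] at h4; cases h4
  have hidx : ((w.2 - b.2 + q.par.getD 0) % D.sides q.typ - q.par.getD 0) % D.sides q.typ =
      (w.2 - b.2) % D.sides q.typ := by
    rw [Int.emod_sub_emod]; congr 1; ring
  rw [hidx]
  obtain ⟨n, hn⟩ := Int.eq_ofNat_of_zero_le (Int.emod_nonneg (w.2 - b.2) hN.ne')
  have hnN : n < D.sides q.typ := by
    have := Int.emod_lt_of_pos (w.2 - b.2) hN
    omega
  obtain ⟨c, hc, hcl⟩ := h.asked_classify h3 n (by omega) hnN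
  refine ⟨c, by rw [hn]; exact hc, ?_⟩
  have hrot : I.s.rot n b = w := by
    have hbw := base_fst hb
    apply Prod.ext
    · exact hbw
    · simp only [Approx.rot]
      rw [hbw, ← hn, ← h1, Int.add_emod_emod, add_sub_cancel, Int.emod_eq_of_lt hwk.2.1]
      rw [h1]; exact hwk.2.2
  rwa [hrot] at hcl

theorem at_congr {w w' : Walker} {q : Code D} {i : ℤ} (hw : I.At w q i) (hw' : I.At w' q i) :
    ∃ c, I.Classify w c ∧ I.Classify w' c := by
  obtain ⟨c, hc, h1⟩ := h.at_classify hw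
  obtain ⟨c', hc', h2⟩ := h.at_classify hw'
  rw [hc] at hc'; cases hc'
  exact ⟨c, h1, h2⟩

/-- Numbering the edges of a tile from the parent index, which is known only modulo the number of
edge types, preserves the edge types. -/
theorem at_edge {w : Walker} {q : Code D} {i : ℤ} (hw : I.At w q i) :
    I.s.edge w = D.edge q.typ i := by
  obtain ⟨hwk, ⟨-, h1, b', hb', h2, -, -⟩, b, hb, rfl⟩ := hw
  rw [hb] at hb'; obtain rfl : b = b' := Option.some_injective _ hb'
  have hbw := base_fst hb
  have hcast : ((b.2 : ℤ) : ZMod (D.n q.typ)) = ((q.par.getD 0 : ℤ) : ZMod (D.n q.typ)) := by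
    by_cases hr : b.1 = I.s.rootWalker.1
    · have hbr : b = I.s.rootWalker := by
        rw [base, if_pos (hbw.symm.trans hr)] at hb
        exact (Option.some_injective _ hb).symm
      have h3 := h.sound.lab_pos h.sound.isWalker_rootWalker.1.1
      rw [h.sound.pos_rootWalker, h.root_edge, ← hbr, hbw, ← h1] at h3
      rw [parIndex, if_pos hr] at h2
      rw [h2]
      simp only [Approx.edge, hbw, ← h1] at h3
      exact (eq_of_heq (Sigma.mk.inj h3).2).symm
    · rw [parIndex, if_neg hr, hbw, ← h1] at h2
      rw [h2, Option.getD_some, ZMod.intCast_mod]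
  rw [RTS.Dart.edge_emod, Approx.edge, ← h1]
  simp only [ATD.edge, Int.cast_add, Int.cast_sub]
  rw [hcast]
  simp

theorem mem_states_iff {q : Code D} : q ∈ R.states ↔ ∃ g ∈ I.current S, I.HasState g q := by
  rw [h.candidate.states]; rfl

theorem rule_of_mem {q : Code D} (hq : q ∈ R.states) (i : ℤ) :
    ∃ w, I.At w q (i % D.sides q.typ) ∧ ∃ c, I.Classify w c ∧ I.Reads w c (R.e q i) := by
  obtain ⟨g, hg, hgq⟩ := h.mem_states_iff.1 hq
  obtain ⟨w, rfl, hw⟩ := hgq.exists_at i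
  exact ⟨w, hw, h.candidate.rule w q i hg hw⟩

/-- The rules of the candidate are true of all tiles of the approximation. -/
theorem rule {w : Walker} {q : Code D} {i : ℤ} (hq : q ∈ R.states) (hw : I.At w q i) :
    ∃ c, I.Classify w c ∧ Fits c (R.e q i) := by
  obtain ⟨w', hw', c, hc, hr⟩ := h.rule_of_mem hq i
  rw [Int.emod_eq_of_lt hw.range.1 hw.range.2] at hw'
  obtain ⟨c', h1, h2⟩ := h.at_congr hw hw'
  rw [h.classify_unique hc h2] at hr
  exact ⟨c', h1, hr.fits⟩

theorem parentEdge_of_rule {w : Walker} {q : Code D} {i : ℤ} (hq : q ∈ R.states)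
    (hw : I.At w q i) (he : R.e q i = .parent) : Approx.ParentEdge I.par w := by
  obtain ⟨c, hc, hf⟩ := h.rule hq hw
  rw [he] at hf; cases hf; cases hc; assumption

theorem childEdge_of_rule {w : Walker} {q q' : Code D} {i : ℤ} (hq : q ∈ R.states)
    (hw : I.At w q i) (he : R.e q i = .child q') : I.s.ChildEdge I.par w := by
  obtain ⟨c, hc, hf⟩ := h.rule hq hw
  rw [he] at hf; cases hf; cases hc; assumption

theorem rule_of_parentEdge {w : Walker} {q : Code D} {i : ℤ} (hq : q ∈ R.states)
    (hw : I.At w q i) (hp : Approx.ParentEdge I.par w) : R.e q i = .parent := by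
  obtain ⟨c, hc, hf⟩ := h.rule hq hw
  rw [h.classify_unique hc (.parent hp)] at hf
  generalize R.e q i = x at hf
  cases hf; rfl

theorem mem_states_of_child {q q' : Code D} (hq : q ∈ R.states) {i : ℤ}
    (he : R.e q i = .child q') : q' ∈ R.states := by
  obtain ⟨g, hg, hgq⟩ := h.mem_states_iff.1 hq
  obtain ⟨w, rfl, hw⟩ := hgq.exists_at i
  obtain ⟨c, hc, hr⟩ := h.candidate.rule w q i hg hw
  rw [he] at hr
  cases hr with
  | child hf hs =>
    cases hc with
    | child hch =>
      obtain ⟨g', hg', q'', h1, h2⟩ := h.closed _ _ hg hw.1 hch hf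
      cases h.hasState_unique hs h1
      exact h.mem_states_iff.2 ⟨g', hg', h2⟩

theorem wellFormed : R.WellFormed where
  finite := by
    have hfin : (I.current S).Finite := by
      refine (S.finite_toSet.image fun h => (I.s.u h).1).subset ?_
      rintro g ⟨k, hk, rfl⟩
      exact ⟨k, hk, rfl⟩
    have hsub : R.states ⊆ ⋃ g ∈ I.current S, {q | I.HasState g q} := by
      intro q hq
      obtain ⟨g, hg, hgq⟩ := h.mem_states_iff.1 hq
      exact Set.mem_biUnion hg hgq
    refine (hfin.biUnion fun g _ => Set.Subsingleton.finite ?_).subset hsub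
    exact fun q hq q' hq' => h.hasState_unique hq hq'
  root_mem := h.mem_states_iff.2
    ⟨_, ⟨0, h.zero_mem, by rw [h.sound.rootWalker_eq]⟩, h.candidate.root⟩
  child_mem := fun q hq i q' he => h.mem_states_of_child hq he
  periodic := by
    intro q hq i
    obtain ⟨g, hg, hgq⟩ := h.mem_states_iff.1 hq
    obtain ⟨w, rfl, hw⟩ := hgq.exists_at i
    rw [h.candidate.typ]
    obtain ⟨c, hc, hr⟩ := h.candidate.rule w q i hg hw
    obtain ⟨c', hc', hr'⟩ := h.candidate.rule w q (i + D.sides q.typ) hg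
      (by rw [Int.add_emod_right]; exact hw)
    rw [← h.classify_unique hc hc'] at hr'
    generalize R.e q i = x at hr
    generalize R.e q (i + D.sides q.typ) = y at hr'
    cases hr <;> cases hr' <;> try rfl
    rename_i hf hs _ _ hf' hs'
    rw [hf] at hf'; cases hf'
    rw [h.hasState_unique hs hs']
  parent_unique := by
    intro q hq i j hi hj
    obtain ⟨g, hg, hgq⟩ := h.mem_states_iff.1 hq
    obtain ⟨w, hwg, hw⟩ := hgq.exists_at i
    obtain ⟨w', hwg', hw'⟩ := hgq.exists_at j
    obtain ⟨c, hc, hr⟩ := h.candidate.rule w q i (hwg ▸ hg) hw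
    obtain ⟨c', hc', hr'⟩ := h.candidate.rule w' q j (hwg' ▸ hg) hw'
    rw [hi] at hr; rw [hj] at hr'
    cases hr; cases hr'
    cases hc with
    | parent hp =>
      cases hc' with
      | parent hp' =>
        unfold Approx.ParentEdge at hp hp'
        rw [hwg] at hp; rw [hwg'] at hp'
        rw [hp] at hp'
        have : w = w' := Prod.ext (hwg.trans hwg'.symm) (Option.some_injective _ hp')
        subst this
        rw [h.candidate.typ]
        exact (h.at_unique hw hw').2
  root_parent := by
    intro i hi
    obtain ⟨w, hw1, hw⟩ := h.candidate.root.exists_at i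
    obtain ⟨c, hc, hr⟩ := h.candidate.rule w R.root i
      ⟨0, h.zero_mem, by rw [hw1, h.sound.rootWalker_eq]⟩ hw
    rw [hi] at hr
    cases hr
    cases hc with
    | parent hp => exact h.not_parentEdge_root hp hw1
  child_connects := by
    intro q hq i q' he
    obtain ⟨w, hw, c, hc, hr⟩ := h.rule_of_mem hq i
    rw [he] at hr
    cases hr with
    | child hf hs =>
      rename_i w'
      cases hc with
      | child hch =>
        obtain ⟨hp, -⟩ := h.childEdge hw.1 hch hf
        obtain ⟨j, hj⟩ := hs.at (h.sound.fwd hf).1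
        refine ⟨j, h.rule_of_parentEdge (h.mem_states_of_child hq he) hj hp, ?_⟩
        rw [h.candidate.typ, h.candidate.typ, ← h.at_edge hj, h.edge_fwd hw.1 hf, h.at_edge hw,
          RTS.Dart.edge_emod]

/-- A child is entered at its parent edge. -/
theorem at_child {w w' : Walker} {q q' : Code D} {i : ℤ} (hq : q ∈ R.states)
    (hw : I.At w q i) (he : R.e q i = .child q') (hf : I.s.fwd w = some w')
    (hs : I.HasState w'.1 q') : I.At w' q' (R.parentIndex q') := by
  obtain ⟨hp, -⟩ := h.childEdge hw.1 (h.childEdge_of_rule hq hw he) hf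
  obtain ⟨j, hj⟩ := hs.at (h.sound.fwd hf).1
  have hq' := h.mem_states_of_child hq he
  have hjr := hj.range
  rw [← h.candidate.typ] at hjr
  rwa [h.wellFormed.parentIndex_eq hq' (h.rule_of_parentEdge hq' hj hp) hjr.1 hjr.2] at hj

end Successful

end Info

/-! ### Following a treewalker in the generated structure -/

namespace RTS

variable {D : ATD} {Q : Type*} {R : RTS D Q}

variable (R) in
/-- A treewalker at the edge `i` of a tile of state `q` that rotates in the direction `ε` meets a
live child before it meets the parent edge. -/
def SafeAt (ε : ℤ) (q : Q) (i : ℤ) : Prop :=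
  ∃ k : ℕ, R.LiveChild q (i + ε * k) ∧ ∀ m ≤ k, R.e q (i + ε * m) ≠ .parent

theorem SafeAt.next {ε : ℤ} {q : Q} {i : ℤ} (h : R.SafeAt ε q i) (hi : ¬ R.LiveChild q i) :
    R.SafeAt ε q (i + ε) := by
  obtain ⟨k, h1, h2⟩ := h
  cases k with
  | zero => simp only [Nat.cast_zero, mul_zero, add_zero] at h1; exact absurd h1 hi
  | succ k =>
    have hk : ∀ m : ℕ, i + ε * ((m + 1 : ℕ) : ℤ) = i + ε + ε * m := fun m => by push_cast; ring
    refine ⟨k, by rw [← hk]; exact h1, fun m hm => ?_⟩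
    rw [← hk]; exact h2 _ (by omega)

theorem SafeAt.congr (hW : R.WellFormed) {ε : ℤ} {q : Q} (hq : q ∈ R.states) {i j : ℤ}
    (hij : i ≡ j [ZMOD D.sides (R.typ q)]) (h : R.SafeAt ε q i) : R.SafeAt ε q j := by
  obtain ⟨k, ⟨q', h1, h1'⟩, h2⟩ := h
  refine ⟨k, ⟨q', ?_, h1'⟩, fun m hm => ?_⟩
  · rw [← hW.e_congr hq (hij.add_right _)]; exact h1
  · rw [← hW.e_congr hq (hij.add_right _)]; exact h2 m hm

/-- After entering a live tile from its parent, both directions of rotation are safe. -/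
theorem SafeAt.enter (hW : R.WellFormed) {ε : ℤ} (hε : ε * ε = 1) {q : Q} (hq : q ∈ R.states)
    (hpar : R.e q (R.parentIndex q) = .parent) (hlive : ¬ R.Dead q) :
    R.SafeAt ε q (R.parentIndex q + ε) := by
  obtain ⟨j, q', he, hl⟩ : ∃ j q', R.e q j = .child q' ∧ ¬ R.Dead q' := by
    by_contra hno
    push Not at hno
    exact hlive (.mk hno)
  have hN := sides_pos D (R.typ q)
  set N : ℤ := (D.sides (R.typ q) : ℤ)
  set p := R.parentIndex q
  obtain ⟨k, hk⟩ := Int.eq_ofNat_of_zero_le (Int.emod_nonneg (ε * (j - p) - 1) hN.ne')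
  have hkN : (k : ℤ) < N := hk ▸ Int.emod_lt_of_pos _ hN
  have hmod : p + ε + ε * k ≡ j [ZMOD N] := by
    rw [← hk]
    refine (((Int.mod_modEq _ _).mul_left ε).add_left _).trans ?_
    rw [show p + ε + ε * (ε * (j - p) - 1) = p + ε * ε * (j - p) by ring, hε]
    simp
  have hlast : R.e q (p + ε + ε * k) = .child q' := by rw [hW.e_congr hq hmod, he]
  refine ⟨k, ⟨q', hlast, hl⟩, fun m hm hp => ?_⟩
  rcases hm.lt_or_eq with hm | rfl
  · have h1 := Int.modEq_iff_dvd.1 (hW.parent_unique q hq _ _ hpar hp)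
    rw [show p + ε + ε * m - p = ε * (m + 1) by ring] at h1
    have h2 : N ∣ m + 1 := by
      have := h1.mul_left ε
      rwa [← mul_assoc, hε, one_mul] at this
    have := Int.le_of_dvd (by omega) h2
    omega
  · rw [hlast] at hp; cases hp

end RTS

namespace Info

variable {D : ATD} (I : Info D) (R : RTS D (Code D))

/-- The treewalker `w` in the approximation stands at a tile of the same state as the dart `v` of
the generated structure, facing the same edge, and if this is in a dead branch, the same is true of
the ancestors down to the first live tile; there, the direction of movement `ε` is safe.  The list
is the note about `w`. -/
inductive Track (ε : ℤ) : Walker → List ℤ × ℤ → List (Code D × ℤ) → Prop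
  | live {w p q i} : I.At w q i → R.stateAt p = some q → ¬ R.Dead q → R.SafeAt ε q i →
      Track ε w (p, i) [(q, i)]
  | dead {w p q i j pw w' l} : I.At w q i → R.stateAt (j :: p) = some q → R.Dead q →
      I.par w.1 = some pw → I.s.fwd (w.1, pw) = some w' → Track ε w' (p, j) l →
      Track ε w (j :: p, i) ((q, i) :: l)

/-- The distance of the tile of `w` in the approximation exceeds the depth of the tile of `x` by
`off`. -/
def Offset (off : ℤ) (w : Walker) (x : R.Dart) : Prop :=
  ∃ a : ℕ, I.s.dist w.1 = a ∧ (a : ℤ) - x.depth = off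

variable {I R}

theorem Track.inv {ε : ℤ} {w : Walker} {v : List ℤ × ℤ} {l : List (Code D × ℤ)}
    (h : I.Track R ε w v l) : ∃ q, I.At w q v.2 ∧ R.stateAt v.1 = some q ∧
      ((¬ R.Dead q ∧ R.SafeAt ε q v.2 ∧ l = [(q, v.2)]) ∨
        R.Dead q ∧ ∃ j p pw w' l', v.1 = j :: p ∧ I.par w.1 = some pw ∧
          I.s.fwd (w.1, pw) = some w' ∧ I.Track R ε w' (p, j) l' ∧ l = (q, v.2) :: l') := by
  cases h with
  | live h1 h2 h3 h4 => exact ⟨_, h1, h2, .inl ⟨h3, h4, rfl⟩⟩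
  | dead h1 h2 h3 h4 h5 h6 => exact ⟨_, h1, h2, .inr ⟨h3, _, _, _, _, _, rfl, h4, h5, h6, rfl⟩⟩

theorem Track.at {ε : ℤ} {w : Walker} {x : R.Dart} {l : List (Code D × ℤ)}
    (h : I.Track R ε w x.1 l) : I.At w x.state x.1.2 := by
  obtain ⟨q, h1, h2, -⟩ := h.inv
  rwa [RTS.Dart.state_eq h2]

namespace Successful

variable {S : Finset ℕ} {C : Tessellation D} {d₀ : C.Dart} {ψ : ℕ → C.Dart}
  (h : I.Successful S R C d₀ ψ)
include h

/-- While a treewalker is tracked, its note is the list that comes with the tracking. -/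
theorem track_note {ε : ℤ} {w : Walker} {v : List ℤ × ℤ} {l l' : List (Code D × ℤ)}
    (ht : I.Track R ε w v l) (hn : I.Note R w l') : l' = l := by
  induction ht generalizing l' with
  | live h1 h2 h3 h4 =>
    cases hn with
    | live h5 h6 => obtain ⟨rfl, rfl⟩ := h.at_unique h1 h5; rfl
    | dead h5 h6 => obtain ⟨rfl, rfl⟩ := h.at_unique h1 h5; exact absurd h6 h3
  | dead h1 h2 h3 h4 h5 _ ih =>
    cases hn with
    | live h6 h7 => obtain ⟨rfl, rfl⟩ := h.at_unique h1 h6; exact absurd h3 h7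
    | dead h6 h7 h8 h9 h10 =>
      obtain ⟨rfl, rfl⟩ := h.at_unique h1 h6
      rw [h4] at h8; cases h8
      rw [h5] at h9; cases h9
      rw [ih h10]

omit h in
/-- The note about a treewalker is all that matters for following it. -/
theorem track_of_note {ε : ℤ} {w w' : Walker} {v : List ℤ × ℤ} {l : List (Code D × ℤ)}
    (ht : I.Track R ε w v l) (hn : I.Note R w' l) : I.Track R ε w' v l := by
  induction ht generalizing w' with
  | live h1 h2 h3 h4 =>
    cases hn with
    | live h5 h6 => exact .live h5 h2 h3 h4
    | dead h5 h6 => exact absurd h6 h3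
  | dead h1 h2 h3 h4 h5 _ ih =>
    cases hn with
    | live h6 h7 => exact absurd h3 h7
    | dead h6 h7 h8 h9 h10 => exact .dead h6 h2 h3 h8 h9 (ih h10)

theorem track_rot {ε : ℤ} {w : Walker} {x : R.Dart} {l : List (Code D × ℤ)}
    (ht : I.Track R ε w x.1 l) (hx : R.Dead x.state ∨ ¬ R.LiveChild x.state x.1.2) :
    ∃ l', I.Track R ε (I.s.rot ε w) (x.rotBy ε).1 l' := by
  obtain ⟨q, h1, h2, h3⟩ := ht.inv
  have hq := RTS.Dart.state_eq h2
  rw [hq] at hx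
  have hat := h1.rot ε
  rw [RTS.Dart.rotBy_val, RTS.Dart.rot_val, hq, h.candidate.typ]
  rcases h3 with ⟨h3, h4, -⟩ | ⟨h3, j, p, pw, w', l', h4, h5, h6, h7, -⟩
  · have hs := (h4.next (hx.resolve_left h3)).congr h.wellFormed (h.wellFormed.stateAt_mem h2)
      (Int.mod_modEq _ _).symm
    rw [h.candidate.typ] at hs
    exact ⟨_, .live hat h2 h3 hs⟩
  · rw [h4] at h2 ⊢
    exact ⟨_, .dead hat h2 h3 h5 h6 h7⟩

/-- A treewalker is tracked over a tree edge.  It never leaves a live tile by the parent edge, since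
the direction of movement is safe there; a dead tile is left to the ancestor that is tracked with
it. -/
theorem track_cross {ε : ℤ} (hε : ε * ε = 1) {w w' : Walker} {x : R.Dart}
    {l : List (Code D × ℤ)} (ht : I.Track R ε w x.1 l) (hx : x.IsTree)
    (hf : I.s.fwd w = some w') (hs : ∀ q', x.edge = .child q' → I.HasState w'.1 q') :
    ∃ l', I.Track R ε (I.s.rot ε w') ((h.wellFormed.cross x).rotBy ε).1 l' := by
  have hW := h.wellFormed
  obtain ⟨q, h1, h2, h3⟩ := ht.inv
  have hq := RTS.Dart.state_eq h2
  have hmem := hW.stateAt_mem h2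
  rcases hx with hx | ⟨q', hx⟩
  · have he : R.e q x.1.2 = .parent := by rw [← hq]; exact hx
    rcases h3 with ⟨-, ⟨k, -, h4⟩, -⟩ | ⟨h3, j, p, pw, w'', l', h4, h5, h6, h7, -⟩
    · exact absurd he (by simpa using h4 0 (Nat.zero_le _))
    · have hp : I.par w.1 = some w.2 := h.parentEdge_of_rule hmem h1 he
      rw [h5] at hp; cases hp
      rw [show (w.1, w.2) = w from rfl, hf] at h6; cases h6
      obtain ⟨h8, h9⟩ := hW.cross_of_parent hx
      rw [h9] at h4
      simp only [List.cons.injEq] at h4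
      have h10 : (h.wellFormed.cross x).1 = (p, j) := Prod.ext h4.2 h4.1
      refine h.track_rot (x := h.wellFormed.cross x) (by rw [h10]; exact h7) (.inr ?_)
      rintro ⟨q'', h11, h12⟩
      rw [RTS.Dart.edge, h11] at h8
      cases h8
      rw [hq] at h12; exact h12 h3
  · have he : R.e q x.1.2 = .child q' := by rw [← hq]; exact hx
    obtain ⟨h4, h5, h6⟩ := hW.cross_of_child hx
    have hs' := hs q' hx
    have hat := h.at_child hmem h1 he hf hs'
    have hst : R.stateAt (x.1.2 :: x.1.1) = some q' := by
      have := (h.wellFormed.cross x).stateAt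
      rwa [h4, h5] at this
    by_cases hd : R.Dead q'
    · have hp := (h.childEdge h1.1 (h.childEdge_of_rule hmem h1 he) hf).1
      have hfs : I.s.fwd (w'.1, w'.2) = some w := h.fwd_symm h1.1 hf
      have := Track.dead hat hst hd hp hfs ht
      rw [← h4] at this
      exact h.track_rot this (.inl (by rw [h5]; exact hd))
    · have hat' := hat.rot ε
      have hpar : R.e q' (R.parentIndex q') = .parent :=
        (hW.child_parentIndex hmem he).2.2.1
      have hsafe := (RTS.SafeAt.enter hW hε (hW.stateAt_mem hst) hpar hd).congr hW
        (hW.stateAt_mem hst) (Int.mod_modEq _ _).symm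
      rw [RTS.Dart.rotBy_val, RTS.Dart.rot_val, h5, h4, h.candidate.typ]
      rw [h.candidate.typ] at hsafe
      exact ⟨_, .live hat' hst hd hsafe⟩

theorem offset_cross {off : ℤ} {w w' : Walker} {x : R.Dart} (ho : I.Offset R off w x)
    (hat : I.At w x.state x.1.2) (hx : x.IsTree) (hf : I.s.fwd w = some w') :
    I.Offset R off w' (h.wellFormed.cross x) := by
  have hW := h.wellFormed
  have hmem := x.state_mem hW
  obtain ⟨a, h1, h2⟩ := ho
  rcases hx with hx | ⟨q', hx⟩
  · obtain ⟨-, w'', h3, k, h4, h5⟩ := h.parentEdge (h.parentEdge_of_rule hmem hat hx)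
    rw [hf] at h3; cases h3
    refine ⟨k, h5, ?_⟩
    rw [h1, Nat.cast_inj] at h4
    have h6 := (hW.cross_of_parent hx).2
    have h7 : x.depth = (h.wellFormed.cross x).depth + 1 := by
      rw [RTS.Dart.depth, RTS.Dart.depth]
      exact (congrArg (fun v => v.1.length) h6)
    rw [← h2, h4, h7]; push_cast; ring
  · obtain ⟨-, k, h4, h5⟩ := h.childEdge hat.1 (h.childEdge_of_rule hmem hat hx) hf
    refine ⟨k + 1, h4, ?_⟩
    rw [h1, Nat.cast_inj] at h5
    have h7 : (h.wellFormed.cross x).depth = x.depth + 1 := by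
      rw [RTS.Dart.depth, (hW.cross_of_child hx).1]; rfl
    rw [← h2, h5, h7]; push_cast; ring

omit h in
theorem offset_rot {off : ℤ} {w : Walker} {x : R.Dart} (k : ℤ) (ho : I.Offset R off w x) :
    I.Offset R off (I.s.rot k w) (x.rotBy k) := by
  obtain ⟨a, h1, h2⟩ := ho
  refine ⟨a, h1, ?_⟩
  rw [← h2, RTS.Dart.depth, RTS.Dart.depth, RTS.Dart.rotBy_val, RTS.Dart.rot_val]

/-- Two treewalkers that move, in direction `ε`, in the approximation and in the generated structure
over the same tree edges. -/
inductive TreePath (h : I.Successful S R C d₀ ψ) (ε : ℤ) :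
    Walker → R.Dart → Walker → R.Dart → Prop
  | nil (w x) : TreePath h ε w x w x
  | cons {w w' x z y} : x.IsTree → I.At w x.state x.1.2 → I.s.fwd w = some w' →
      TreePath h ε (I.s.rot ε w') ((h.wellFormed.cross x).rotBy ε) z y → TreePath h ε w x z y

/-- Moving along a wall in the approximation is followed in the generated structure. -/
theorem look {ε : ℤ} (hε : ε * ε = 1) {off : ℤ} {w z : Walker} {x : R.Dart}
    (hl : I.Look R ε w z) (ht : ∃ l, I.Track R ε w x.1 l) (ho : I.Offset R off w x) :
    ∃ y : R.Dart, h.TreePath ε w x z y ∧ (∃ l, I.Track R ε z y.1 l) ∧ I.Offset R off z y ∧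
      (y.edge = .left ∨ y.edge = .right) := by
  induction hl generalizing x with
  | touch hat he =>
    obtain ⟨l, ht⟩ := ht
    obtain ⟨rfl, rfl⟩ := h.at_unique hat ht.at
    exact ⟨x, .nil _ _, ⟨l, ht⟩, ho, he⟩
  | up hat he hf _ ih =>
    obtain ⟨l, ht⟩ := ht
    obtain ⟨rfl, rfl⟩ := h.at_unique hat ht.at
    have hx : x.IsTree := .inl he
    obtain ⟨y, h1, h2⟩ := ih (h.track_cross hε ht hx hf fun q' hq' => by
      rw [RTS.Dart.edge, he] at hq'; cases hq') (offset_rot ε (h.offset_cross ho ht.at hx hf))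
    exact ⟨y, .cons hx ht.at hf h1, h2⟩
  | down hat he hf hs _ ih =>
    obtain ⟨l, ht⟩ := ht
    obtain ⟨rfl, rfl⟩ := h.at_unique hat ht.at
    have hx : x.IsTree := .inr ⟨_, he⟩
    obtain ⟨y, h1, h2⟩ := ih (h.track_cross hε ht hx hf fun q' hq' => by
      rw [RTS.Dart.edge, he] at hq'; cases hq'; exact hs)
      (offset_rot ε (h.offset_cross ho ht.at hx hf))
    exact ⟨y, .cons hx ht.at hf h1, h2⟩

end Successful

end Info

/-! ### Matching edges found by the validation -/

namespace Info.Successful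

open RTS RTS.WellFormed

variable {D : ATD} {I : Info D} {R : RTS D (Code D)} {S : Finset ℕ} {C : Tessellation D}
  {d₀ : C.Dart} {ψ : ℕ → C.Dart} (h : I.Successful S R C d₀ ψ)

/-- Two treewalkers that go, in the approximation and in the generated structure, around a vertex
over `c` corresponding edges: tree edges, or matching edges crossed from the right edge to the left
one.  In the approximation, none of these edges is a left edge on the side from which it is crossed. -/
inductive Joint : ℕ → Walker → R.Dart → Walker → R.Dart → Prop
  | nil (w x) : Joint 0 w x w x
  | cross {c w w' x x' z y} : I.s.IsWalker w → I.s.fwd w = some w' →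
      (∀ d, ¬ I.Classify w (.nontree .left d)) →
      ((x.IsTree ∧ x' = h.wellFormed.cross x) ∨ h.wellFormed.Matched x x') →
      Joint c (I.s.rot 1 w') (Dart.rot R x') z y → Joint (c + 1) w x z y

variable {h}

theorem Joint.trans {c c' : ℕ} {w w' w'' : Walker} {x x' x'' : R.Dart}
    (h₁ : h.Joint c w x w' x') (h₂ : h.Joint c' w' x' w'' x'') :
    h.Joint (c + c') w x w'' x'' := by
  induction h₁ with
  | nil => simpa using h₂
  | cross h1 h2 h3 h4 _ ih =>
    have := Joint.cross h1 h2 h3 h4 (ih h₂)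
    convert this using 1; omega

theorem Joint.balanced {c : ℕ} {w w' : Walker} {x x' : R.Dart} (h₁ : h.Joint c w x w' x') :
    ∃ m, h.wellFormed.Balanced c m x x' := by
  induction h₁ with
  | nil => exact ⟨0, .nil _⟩
  | cross h1 h2 h3 h4 _ ih =>
    obtain ⟨m, ih⟩ := ih
    rcases h4 with ⟨ht, rfl⟩ | ⟨hx, hz, hcl, c', m', h5, hc⟩
    · exact ⟨m + 1, .tree ht ih⟩
    · rw [← h.wellFormed.contour_of_not_tree fun ht => ht.not_left hz] at ih
      exact ⟨_, .pair hx h5 hz hc hcl ih⟩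

theorem around_succ {s : Approx D} {k : ℕ} {w u u' : Walker} (hu : s.around k w = some u)
    (hf : s.fwd u = some u') : s.around (k + 1) w = some (s.rot 1 u') := by
  induction k generalizing w with
  | zero => cases hu; simp [Approx.around, hf]
  | succ k ih =>
    rw [Approx.around, Option.bind_eq_some_iff] at hu ⊢
    obtain ⟨x, hx, hu⟩ := hu
    exact ⟨x, hx, ih hu⟩

theorem Joint.around {c : ℕ} {w z : Walker} {x y : R.Dart} (h₁ : h.Joint c w x z y) :
    I.s.around c w = some z ∧ ∀ j < c, ∃ u u', I.s.around j w = some u ∧ I.s.IsWalker u ∧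
      I.s.fwd u = some u' ∧ ∀ d, ¬ I.Classify u (.nontree .left d) := by
  induction h₁ with
  | nil => exact ⟨rfl, fun j hj => absurd hj (by omega)⟩
  | @cross c w w' x x' z y h1 h2 h3 h4 _ ih =>
    refine ⟨by rw [Approx.around, h2]; exact ih.1, ?_⟩
    rintro (_ | j) hj
    · exact ⟨w, w', rfl, h1, h2, h3⟩
    · rw [Approx.around, h2]
      exact ih.2 j (by omega)

theorem rot_inv {w : Walker} (hw : I.s.IsWalker w) (k : ℤ) : I.s.rot (-k) (I.s.rot k w) = w := by
  rw [Approx.rot_rot]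
  simp only [Approx.rot, add_neg_cancel, add_zero]
  rw [Int.emod_eq_of_lt hw.2.1 hw.2.2]

theorem rot_inv' {w : Walker} (hw : I.s.IsWalker w) (k : ℤ) : I.s.rot k (I.s.rot (-k) w) = w := by
  have := rot_inv hw (-k)
  rwa [neg_neg] at this

variable (h) in
/-- If a treewalker arrives, after going around a vertex from a right edge, at the same edge seen
from the other side, labelled left, then it has gone around the vertex exactly once: the vertex
closes up in the approximation after `v` edges, and the last of these edges is a left edge, so that
the treewalker has not gone past it. -/
theorem matched_of_joint {c : ℕ} {off : ℤ} {w z : Walker} {x y : R.Dart}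
    (hj : h.Joint c (I.s.rot 1 w) (Dart.rot R x) z y) (hw : I.At w x.state x.1.2)
    (hz : I.At z y.state y.1.2) (how : I.Offset R off w x) (hoz : I.Offset R off z y)
    (hx : x.edge = .right) (hy : y.edge = .left) (hf : I.s.fwd w = some z) :
    h.wellFormed.Matched x y := by
  have hW := h.wellFormed
  obtain ⟨cx, hcx, hfx⟩ := h.rule (x.state_mem hW) hw
  obtain ⟨cy, hcy, hfy⟩ := h.rule (y.state_mem hW) hz
  rw [show R.e x.state x.1.2 = .right from hx] at hfx
  rw [show R.e y.state y.1.2 = .left from hy] at hfy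
  cases hfx
  cases hfy
  have hclose : Close x y := by
    obtain ⟨a', ha', hoa⟩ := how
    obtain ⟨b', hb', hob⟩ := hoz
    cases hcx with
    | nontree d a b _ _ hf' _ _ ha hb hd =>
      rw [hf] at hf'; cases hf'
      rw [ha', Nat.cast_inj] at ha
      rw [hb', Nat.cast_inj] at hb
      have hd1 : ∀ e : SignType, (e : ℤ) ≤ 1 ∧ -1 ≤ (e : ℤ) := fun e => by cases e <;> simp
      have hd2 := hd ▸ hd1 _
      constructor <;> omega
  obtain ⟨m, hbal⟩ := hj.balanced
  rw [← hW.contour_of_not_tree fun ht => ht.not_right hx] at hbal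
  refine ⟨hx, hy, hclose, c, m, hbal, ?_⟩
  have hlab : (hW.contour x).lab = I.s.edge (I.s.rot 1 w) := by
    rw [hW.contour_of_not_tree fun ht => ht.not_right hx, h.at_edge (hw.rot 1)]
    conv_lhs => rw [x.eq_mk, Dart.rot_mk, Dart.lab_mk]
    rw [Dart.edge_emod, h.candidate.typ]
  rw [hlab]
  have hwk := hw.1
  have hrw : I.s.IsWalker (I.s.rot 1 w) := Approx.Sound.isWalker_rot hwk.1 1
  obtain ⟨har, hpre⟩ := hj.around
  have hzw := h.fwd_symm hwk hf
  -- the number of edges is a multiple of the valence, by looking at `C`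
  have hdvd : D.v (I.s.edge (I.s.rot 1 w)) ∣ c + 1 := by
    have h1 := (h.sound.around hrw (around_succ har hzw)).2
    rw [← h.sound.lab_pos hrw.1.1, ← C.vertex_size]
    exact Function.IsPeriodicPt.minimalPeriod_dvd h1.symm
  have hle := Nat.le_of_dvd (Nat.succ_pos c) hdvd
  rcases hle.lt_or_eq with hlt | heq
  · exfalso
    have hpos := D.valence_pos (I.s.edge (I.s.rot 1 w))
    obtain ⟨u, u', h1, h2, h3, h4⟩ := hpre (D.v (I.s.edge (I.s.rot 1 w)) - 1) (by omega)
    have h5 := around_succ h1 h3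
    rw [Nat.sub_add_cancel hpos] at h5
    have h6 := h.stable.not_overfull _ _ hrw h5
    have h7 : u' = w := by
      rw [← rot_inv (h.sound.fwd h3).1 1, h6, rot_inv hwk]
    rw [h7] at h3
    have h8 := h.fwd_symm h2 h3
    rw [hf] at h8; cases h8
    -- otherwise the treewalker has crossed the left edge `z` on its way
    exact h4 _ hcy
  · exact heq.symm

variable (h) in
include h in
theorem not_left_of_right {w : Walker} {x : R.Dart} (hw : I.At w x.state x.1.2)
    (hx : x.edge = .right) : ∀ d, ¬ I.Classify w (.nontree .left d) := by
  intro d hd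
  obtain ⟨c, hc, hf⟩ := h.rule (x.state_mem h.wellFormed) hw
  rw [show R.e x.state x.1.2 = .right from hx] at hf
  cases hf
  cases h.classify_unique hc hd

variable (h) in
theorem joint_matched {w w' : Walker} {x x' : R.Dart} (hw : I.At w x.state x.1.2)
    (hf : I.s.fwd w = some w') (hm : h.wellFormed.Matched x x') :
    h.Joint 1 w x (I.s.rot 1 w') (Dart.rot R x') :=
  .cross hw.1 hf (h.not_left_of_right hw hm.1) (.inr hm) (.nil _ _)

/-- Crossing tree edges to the right is going around a vertex. -/
theorem TreePath.joint_right {w z : Walker} {x y : R.Dart} (hp : h.TreePath 1 w x z y) :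
    ∃ c, h.Joint c w x z y := by
  induction hp with
  | nil => exact ⟨0, .nil _ _⟩
  | cons hx hat hf _ ih =>
    obtain ⟨c, ih⟩ := ih
    refine ⟨c + 1, .cross hat.1 hf (fun d hd => ?_) (.inl ⟨hx, rfl⟩) ih⟩
    obtain ⟨c, hc, hfit⟩ := h.rule (Dart.state_mem h.wellFormed _) hat
    rw [h.classify_unique hc hd] at hfit
    rcases hx with he | ⟨q', he⟩ <;> rw [Dart.edge] at he <;> rw [he] at hfit <;> cases hfit

/-- Crossing tree edges to the left is, backwards, going around a vertex. -/
theorem TreePath.joint_left {w z : Walker} {x y : R.Dart} (hp : h.TreePath (-1) w x z y) :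
    ∃ c, h.Joint c (I.s.rot 1 z) (Dart.rot R y) (I.s.rot 1 w) (Dart.rot R x) := by
  induction hp with
  | nil => exact ⟨0, .nil _ _⟩
  | @cons w w' x z y hx hat hf _ ih =>
    obtain ⟨c, ih⟩ := ih
    have hw' := (h.sound.fwd hf).1
    have hf' := h.fwd_symm hat.1 hf
    rw [rot_inv' hw', Dart.rot_apply _, Dart.rot_apply, Dart.rotBy_rotBy, neg_add_cancel,
      Dart.rotBy_zero] at ih
    refine ⟨c + 1, ih.trans (.cross hw' hf' (fun d hd => ?_)
      (.inl ⟨h.wellFormed.cross_tree hx, (h.wellFormed.cross_cross x).symm⟩) (.nil _ _))⟩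
    rcases hx with he | ⟨q', he⟩
    · have hp := h.parentEdge_of_rule (Dart.state_mem h.wellFormed _) hat he
      cases h.classify_unique (.child ⟨w, hf', hp⟩) hd
    · have hp := (h.childEdge hat.1
        (h.childEdge_of_rule (Dart.state_mem h.wellFormed _) hat he) hf).1
      cases h.classify_unique (.parent hp) hd

variable (h) in
/-- Moving on to the right from `(w, x)`, the elements of the stack are popped one after another:
the first one is the other side of a left edge reached around a vertex, the remaining stack is
emptied in the same way, and finally `(z, y)` is reached. -/
def PopRight (off : ℤ) : Walker → R.Dart → List (Walker × R.Dart) → Walker → R.Dart → Prop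
  | w, x, [], z, y => ∃ c, h.Joint c w x z y
  | w, x, (s, _) :: l, z, y => ∃ c u v, h.Joint c w x u v ∧ v.edge = .left ∧
      I.At u v.state v.1.2 ∧ I.Offset R off u v ∧ I.SameEdge s u ∧
      PopRight off (I.s.rot 1 u) (Dart.rot R v) l z y

variable (h) in
/-- The mirror image of `PopRight` for the left-moving treewalker; `(w, x)` is the right end of the
piece of the wall that remains to be explored. -/
def PopLeft (off : ℤ) : Walker → R.Dart → List (Walker × R.Dart) → Walker → R.Dart → Prop
  | w, x, [], z, y => ∃ c, h.Joint c (I.s.rot 1 z) (Dart.rot R y) w x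
  | w, x, (s, _) :: l, z, y => ∃ c u v, h.Joint c (I.s.rot 1 u) (Dart.rot R v) w x ∧
      v.edge = .right ∧ I.At u v.state v.1.2 ∧ I.Offset R off u v ∧ I.SameEdge s u ∧
      PopLeft off u v l z y

theorem PopRight.prepend {off : ℤ} {c : ℕ} {w w' z : Walker} {x x' y : R.Dart}
    {l : List (Walker × R.Dart)} (hj : h.Joint c w x w' x') (hp : h.PopRight off w' x' l z y) :
    h.PopRight off w x l z y := by
  cases l with
  | nil => obtain ⟨c', hp⟩ := hp; exact ⟨_, hj.trans hp⟩
  | cons a l => obtain ⟨c', u, v, h1, h2⟩ := hp; exact ⟨_, u, v, hj.trans h1, h2⟩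

theorem PopLeft.append {off : ℤ} {c : ℕ} {w w' z : Walker} {x x' y : R.Dart}
    {l : List (Walker × R.Dart)} (hj : h.Joint c w' x' w x) (hp : h.PopLeft off w' x' l z y) :
    h.PopLeft off w x l z y := by
  cases l with
  | nil => obtain ⟨c', hp⟩ := hp; exact ⟨_, hp.trans hj⟩
  | cons a l => obtain ⟨c', u, v, h1, h2⟩ := hp; exact ⟨_, u, v, h1.trans hj, h2⟩

/-- A pair of notes about the two treewalkers that correspond to the right edge `x` and the left
edge `y` on a wall of the generated structure, at a moment when both stacks are empty. -/
def Noted (I : Info D) (V : Set (Seen D)) (off : ℤ) (w : Walker) (x : R.Dart) (z : Walker)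
    (y : R.Dart) : Prop :=
  x.edge = .right ∧ y.edge = .left ∧ I.SameEdge w z ∧ I.Offset R off w x ∧ I.Offset R off z y ∧
    ∃ l, l ∈ V ∧ I.Track R (-1) w x.1 l.1 ∧ I.Track R 1 z y.1 l.2

theorem _root_.Info.Examine.subset {V V' : Set (Seen D)} {a b : Walker} {sl sr : List Walker}
    (he : I.Examine R V a b sl sr V') : V ⊆ V' := by
  induction he with
  | pushRight _ _ _ ih => exact ih
  | popRight _ _ _ _ ih => exact ih
  | pushLeft _ _ _ ih => exact ih
  | popLeft _ _ _ _ ih => exact ih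
  | advance _ _ _ _ _ _ _ _ _ ih => exact (Set.subset_insert _ _).trans ih
  | seen => exact subset_rfl

variable (h) in
include h in
theorem edge_of_faces {w : Walker} {x : R.Dart} {e : TreeEdge (Code D)}
    (hw : I.At w x.state x.1.2) (hf : I.Faces R w e) : x.edge = e := by
  obtain ⟨q, i, h1, h2⟩ := hf
  obtain ⟨rfl, rfl⟩ := h.at_unique hw h1
  exact h2

theorem not_liveChild {x : R.Dart} (hx : ¬ x.IsTree) : ¬ R.LiveChild x.state x.1.2 := by
  rintro ⟨q', he, -⟩
  exact hx (.inr ⟨q', he⟩)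

variable (h) in
/-- Moving on from a non-tree edge along the wall. -/
theorem look_rot {ε : ℤ} (hε : ε * ε = 1) {off : ℤ} {w z : Walker} {x : R.Dart}
    (hl : I.Look R ε (I.s.rot ε w) z) (ht : ∃ l, I.Track R ε w x.1 l) (ho : I.Offset R off w x)
    (hx : ¬ x.IsTree) :
    ∃ y : R.Dart, h.TreePath ε (I.s.rot ε w) (x.rotBy ε) z y ∧ (∃ l, I.Track R ε z y.1 l) ∧
      I.Offset R off z y ∧ (y.edge = .left ∨ y.edge = .right) := by
  obtain ⟨l, ht⟩ := ht
  exact h.look hε hl (h.track_rot ht (.inr (not_liveChild hx))) (offset_rot ε ho)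

variable (h) in
theorem joint_look_left {off : ℤ} {w z : Walker} {x : R.Dart}
    (hl : I.Look R (-1) (I.s.rot (-1) w) z) (ht : ∃ l, I.Track R (-1) w x.1 l)
    (ho : I.Offset R off w x) (hx : ¬ x.IsTree) :
    ∃ y : R.Dart, (∃ c, h.Joint c (I.s.rot 1 z) (Dart.rot R y) w x) ∧
      (∃ l, I.Track R (-1) z y.1 l) ∧ I.Offset R off z y ∧ ¬ y.IsTree := by
  obtain ⟨y, h1, h2, h3, h4⟩ := h.look_rot (by norm_num) hl ht ho hx
  obtain ⟨c, h5⟩ := h1.joint_left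
  obtain ⟨l, ht⟩ := ht
  rw [rot_inv' ht.at.1, Dart.rot_apply _, Dart.rot_apply, Dart.rotBy_rotBy, neg_add_cancel,
    Dart.rotBy_zero] at h5
  exact ⟨y, ⟨c, h5⟩, h2, h3, fun ht => h4.elim ht.not_left ht.not_right⟩

variable (h) in
theorem joint_look_right {off : ℤ} {w z : Walker} {x : R.Dart}
    (hl : I.Look R 1 (I.s.rot 1 w) z) (ht : ∃ l, I.Track R 1 w x.1 l)
    (ho : I.Offset R off w x) (hx : ¬ x.IsTree) :
    ∃ y : R.Dart, (∃ c, h.Joint c (I.s.rot 1 w) (Dart.rot R x) z y) ∧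
      (∃ l, I.Track R 1 z y.1 l) ∧ I.Offset R off z y ∧ ¬ y.IsTree := by
  obtain ⟨y, h1, h2, h3, h4⟩ := h.look_rot (by norm_num) hl ht ho hx
  exact ⟨y, h1.joint_right, h2, h3, fun ht => h4.elim ht.not_left ht.not_right⟩

variable (h) in
/-- A successful examination, followed in the generated structure, empties the stacks by matching
edges and arrives at a pair of notes. -/
theorem examine {V V' : Set (Seen D)} {a b : Walker} {sl sr : List Walker}
    (he : I.Examine R V a b sl sr V') {off : ℤ} {x y : R.Dart} {xl xr : List (Walker × R.Dart)}
    (hx : ∃ l, I.Track R (-1) a x.1 l) (hy : ∃ l, I.Track R 1 b y.1 l)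
    (hxo : I.Offset R off a x) (hyo : I.Offset R off b y) (hxt : ¬ x.IsTree) (hyt : ¬ y.IsTree)
    (hsl : sl = xl.map Prod.fst) (hsr : sr = xr.map Prod.fst) :
    ∃ a' x' b' y', h.PopLeft off (I.s.rot 1 a) (Dart.rot R x) xl a' x' ∧
      h.PopRight off b y xr b' y' ∧ Noted I V' off a' x' b' y' := by
  induction he generalizing x y xl xr with
  | @pushRight V a b b' sl sr V' hf hl _ ih =>
    have hat := hy.choose_spec.at
    obtain ⟨y', ⟨c, h1⟩, h2, h3, h4⟩ := h.joint_look_right hl hy hyo hyt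
    obtain ⟨a', x', b'', y'', h5, h6, h7⟩ := ih (xr := (b, y) :: xr) hx h2 hxo h3 hxt h4 hsl
      (by rw [hsr]; rfl)
    obtain ⟨c', u, v, h8, h9, h10, h11, h12, h13⟩ := h6
    have hm := h.matched_of_joint (h1.trans h8) hat h10 hyo h11 (h.edge_of_faces hat hf) h9 h12.1
    exact ⟨a', x', b'', y'', h5, h13.prepend (h.joint_matched hat h12.1 hm), h7⟩
  | @popRight V a b b' s sl sr V' hf hs hl _ ih =>
    have hat := hy.choose_spec.at
    cases xr with
    | nil => cases hsr
    | cons r xr =>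
      obtain ⟨rfl, rfl⟩ := List.cons.inj hsr
      obtain ⟨y', ⟨c, h1⟩, h2, h3, h4⟩ := h.joint_look_right hl hy hyo hyt
      obtain ⟨a', x', b'', y'', h5, h6, h7⟩ := ih hx h2 hxo h3 hxt h4 hsl rfl
      exact ⟨a', x', b'', y'', h5, ⟨0, b, y, .nil _ _, h.edge_of_faces hat hf, hat, hyo, hs,
        h6.prepend h1⟩, h7⟩
  | @pushLeft V a a' b sl sr V' hf hl _ ih =>
    have hat := hx.choose_spec.at
    obtain ⟨x', ⟨c, h1⟩, h2, h3, h4⟩ := h.joint_look_left hl hx hxo hxt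
    obtain ⟨a'', x'', b', y', h5, h6, h7⟩ := ih (xl := (a, x) :: xl) h2 hy h3 hyo h4 hyt
      (by rw [hsl]; rfl) hsr
    obtain ⟨c', u, v, h8, h9, h10, h11, h12, h13⟩ := h5
    have hm := h.matched_of_joint (h8.trans h1) h10 hat h11 hxo h9 (h.edge_of_faces hat hf) h12.2
    exact ⟨a'', x'', b', y', h13.append (h.joint_matched h10 h12.2 hm), h6, h7⟩
  | @popLeft V a a' b s sl sr V' hf hs hl _ ih =>
    have hat := hx.choose_spec.at
    cases xl with
    | nil => cases hsl
    | cons r xl =>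
      obtain ⟨rfl, rfl⟩ := List.cons.inj hsl
      obtain ⟨x', ⟨c, h1⟩, h2, h3, h4⟩ := h.joint_look_left hl hx hxo hxt
      obtain ⟨a'', x'', b', y', h5, h6, h7⟩ := ih h2 hy h3 hyo h4 hyt rfl hsr
      exact ⟨a'', x'', b', y', ⟨0, a, x, .nil _ _, h.edge_of_faces hat hf, hat, hxo, hs,
        h5.append h1⟩, h6, h7⟩
  | @advance V a a' b b' la lb V' hfa hfb hs hna hnb _ _ _ he _ =>
    obtain ⟨l, hx⟩ := hx
    obtain ⟨l', hy⟩ := hy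
    cases List.map_eq_nil_iff.1 hsl.symm
    cases List.map_eq_nil_iff.1 hsr.symm
    refine ⟨a, x, b, y, ⟨0, .nil _ _⟩, ⟨0, .nil _ _⟩, h.edge_of_faces hx.at hfa,
      h.edge_of_faces hy.at hfb, hs, hxo, hyo, (la, lb), he.subset (Set.mem_insert _ _), ?_, ?_⟩
    · rw [h.track_note hx hna]; exact hx
    · rw [h.track_note hy hnb]; exact hy
  | @seen V a b la lb hfa hfb hs hna hnb hV =>
    obtain ⟨l, hx⟩ := hx
    obtain ⟨l', hy⟩ := hy
    cases List.map_eq_nil_iff.1 hsl.symm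
    cases List.map_eq_nil_iff.1 hsr.symm
    refine ⟨a, x, b, y, ⟨0, .nil _ _⟩, ⟨0, .nil _ _⟩, h.edge_of_faces hx.at hfa,
      h.edge_of_faces hy.at hfb, hs, hxo, hyo, (la, lb), hV, ?_, ?_⟩
    · rw [h.track_note hx hna]; exact hx
    · rw [h.track_note hy hnb]; exact hy

/-- The examination has gone on, successfully, from a place with the given notes. -/
def Continued (I : Info D) (R : RTS D (Code D)) (Vf : Set (Seen D)) (l : Seen D) : Prop :=
  ∃ a b a' b' V V', I.Note R a l.1 ∧ I.Note R b l.2 ∧ I.SameEdge a b ∧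
    I.Look R (-1) (I.s.rot (-1) a) a' ∧ I.Look R 1 (I.s.rot 1 b) b' ∧
    I.Examine R V a' b' [] [] V' ∧ V' ⊆ Vf

theorem Continued.mono {Vf Vf' : Set (Seen D)} (hV : Vf ⊆ Vf') {l : Seen D}
    (hc : Continued I R Vf l) : Continued I R Vf' l := by
  obtain ⟨a, b, a', b', V, V', h1, h2, h3, h4, h5, h6, h7⟩ := hc
  exact ⟨a, b, a', b', V, V', h1, h2, h3, h4, h5, h6, h7.trans hV⟩

theorem _root_.Info.Examine.continued {V V' : Set (Seen D)} {a b : Walker} {sl sr : List Walker}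
    (he : I.Examine R V a b sl sr V') : ∀ l ∈ V', l ∈ V ∨ Continued I R V' l := by
  induction he with
  | pushRight _ _ _ ih => exact ih
  | popRight _ _ _ _ ih => exact ih
  | pushLeft _ _ _ ih => exact ih
  | popLeft _ _ _ _ ih => exact ih
  | @advance V a a' b b' la lb V' _ _ hs hna hnb _ hl hl' he ih =>
    intro l hl''
    rcases ih l hl'' with (rfl | h1) | h1
    · exact .inr ⟨a, b, a', b', _, _, hna, hnb, hs, hl, hl', he, subset_rfl⟩
    · exact .inl h1
    · exact .inr h1
  | seen => exact fun l hl => .inl hl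

theorem _root_.Info.ExamineAll.continued {V : Set (Seen D)} {ws : List Walker}
    (he : I.ExamineAll R V ws) : ∃ Vf, V ⊆ Vf ∧ (∀ l ∈ Vf, l ∈ V ∨ Continued I R Vf l) ∧
      ∀ w ∈ ws, ∃ a b V₁ V₂, I.Look R (-1) w a ∧ I.Look R 1 (I.s.rot 1 w) b ∧
        I.Examine R V₁ a b [] [] V₂ ∧ V₂ ⊆ Vf := by
  induction he with
  | nil => exact ⟨_, subset_rfl, fun l hl => .inl hl, fun w hw => by cases hw⟩
  | @cons V V' w a b ws hl hl' he _ ih =>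
    obtain ⟨Vf, h1, h2, h3⟩ := ih
    refine ⟨Vf, he.subset.trans h1, fun l hlf => ?_, fun w' hw' => ?_⟩
    · rcases h2 l hlf with h4 | h4
      · exact (he.continued l h4).imp_right (Continued.mono h1)
      · exact .inr h4
    · rcases List.mem_cons.1 hw' with rfl | hw'
      · exact ⟨a, b, V, V', hl, hl', he, h1⟩
      · exact h3 w' hw'

variable (h) in
/-- Two matching edges on a wall of the generated structure that have been examined. -/
def Synced (Vf : Set (Seen D)) (x y : R.Dart) : Prop :=
  h.wellFormed.Matched x y ∧ ∃ off w z, Noted I Vf off w x z y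

variable (h) in
/-- If the positions of the two treewalkers are joined around a vertex, so are those at which the
examination makes its next note, and they face matching edges. -/
theorem synced_of_examine {V V' Vf : Set (Seen D)} {a b : Walker}
    (he : I.Examine R V a b [] [] V') (hV : V' ⊆ Vf) {off : ℤ} {x y : R.Dart}
    (hx : ∃ l, I.Track R (-1) a x.1 l) (hy : ∃ l, I.Track R 1 b y.1 l)
    (hxo : I.Offset R off a x) (hyo : I.Offset R off b y) (hxt : ¬ x.IsTree) (hyt : ¬ y.IsTree)
    {c : ℕ} (hj : h.Joint c (I.s.rot 1 a) (Dart.rot R x) b y) :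
    ∃ x' y' c m c' m', h.Synced Vf x' y' ∧
      h.wellFormed.Balanced c m (h.wellFormed.contour x') (Dart.rot R x) ∧
      h.wellFormed.Balanced c' m' y y' := by
  obtain ⟨a', x', b', y', ⟨c₁, h1⟩, ⟨c₂, h2⟩, hex, hey, hs, hox, hoy, l, hl, htx, hty⟩ :=
    h.examine he (xl := []) (xr := []) hx hy hxo hyo hxt hyt rfl rfl
  obtain ⟨m₁, h3⟩ := h1.balanced
  obtain ⟨m₂, h4⟩ := h2.balanced
  rw [← h.wellFormed.contour_of_not_tree fun ht => ht.not_right hex] at h3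
  exact ⟨x', y', _, _, _, _, ⟨h.matched_of_joint ((h1.trans hj).trans h2) htx.at hty.at hox hoy
    hex hey hs.1, off, a', b', hex, hey, hs, hox, hoy, l, hV hl, htx, hty⟩, h3, h4⟩

variable (h) in
/-- From two examined edges, the examination has gone on, perhaps at another place with the same
notes, and can be repeated here. -/
theorem synced_next {Vf : Set (Seen D)} (hVf : ∀ l ∈ Vf, Continued I R Vf l) {x y : R.Dart}
    (hs : h.Synced Vf x y) : ∃ x' y' c m c' m', h.Synced Vf x' y' ∧
      h.wellFormed.Balanced c m (h.wellFormed.contour x') x ∧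
      h.wellFormed.Balanced c' m' (h.wellFormed.contour y) y' := by
  obtain ⟨hm, off, w, z, hex, hey, hsame, hox, hoy, l, hl, htx, hty⟩ := hs
  obtain ⟨a, b, a', b', V, V', hna, hnb, hab, hla, hlb, he, hV⟩ := hVf l hl
  have hta := track_of_note htx hna
  have htb := track_of_note hty hnb
  have hxt : ¬ x.IsTree := fun ht => ht.not_right hex
  have hyt : ¬ y.IsTree := fun ht => ht.not_left hey
  -- the difference of the distances is part of the state
  obtain ⟨off', hoa, hob⟩ : ∃ off', I.Offset R off' a x ∧ I.Offset R off' b y := by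
    obtain ⟨cl, h1, h2⟩ := h.at_congr htx.at hta.at
    obtain ⟨cl', h3, h4⟩ := h.rule (x.state_mem h.wellFormed) htx.at
    rw [h.classify_unique h3 h1, show R.e x.state x.1.2 = .right from hex] at h4
    cases h4
    obtain ⟨i, h5, h6⟩ := hox
    obtain ⟨j, h7, h8⟩ := hoy
    cases h1 with
    | nontree d k m _ _ hf _ _ hk hm' hd =>
      rw [hsame.1] at hf; cases hf
      rw [h5, Nat.cast_inj] at hk
      rw [h7, Nat.cast_inj] at hm'
      subst hk hm'
      cases h2 with
      | nontree _ k' m' _ _ hf' _ _ hk' hm'' hd' =>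
        rw [hab.1] at hf'; cases hf'
        exact ⟨k' - x.depth, ⟨k', hk', rfl⟩, ⟨m', hm'', by omega⟩⟩
  obtain ⟨xa, ⟨c₁, h1⟩, h2, h3, h4⟩ := h.joint_look_left hla ⟨_, hta⟩ hoa hxt
  obtain ⟨yb, ⟨c₂, h5⟩, h6, h7, h8⟩ := h.joint_look_right hlb ⟨_, htb⟩ hob hyt
  obtain ⟨x', y', c, m, c', m', h9, h10, h11⟩ := h.synced_of_examine he hV h2 h6 h3 h7 h4 h8
    ((h1.trans (h.joint_matched hta.at hab.1 hm)).trans h5)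
  obtain ⟨m₁, h12⟩ := h1.balanced
  obtain ⟨m₂, h13⟩ := h5.balanced
  rw [← h.wellFormed.contour_of_not_tree hyt] at h13
  exact ⟨x', y', _, _, _, _, h9, h10.trans h12, h13.trans h11⟩

variable (h) in
/-- The wall to the right of a live child is examined from the tile of `S` of the same state. -/
theorem synced_start {Vf V V' : Set (Seen D)} {w a b : Walker} {p : List ℤ} {q : Code D}
    {i₁ i₂ : ℤ} (hq : R.stateAt p = some q) (hb : R.BranchPair q i₁ i₂)
    (hat : I.At w q (i₁ % D.sides q.typ)) (hla : I.Look R (-1) w a)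
    (hlb : I.Look R 1 (I.s.rot 1 w) b) (he : I.Examine R V a b [] [] V') (hV : V' ⊆ Vf) :
    ∃ x' y' c m c' m', h.Synced Vf x' y' ∧
      h.wellFormed.Balanced c m (h.wellFormed.contour x') (Dart.mk hq (i₁ + 1)) ∧
      h.wellFormed.Balanced c' m' (Dart.mk hq (i₁ + 1)) y' := by
  have hW := h.wellFormed
  have hmem := hW.stateAt_mem hq
  obtain ⟨hlt, -, ⟨q₁, he₁, hl₁⟩, hl₂, hbet⟩ := hb
  have hlive : ¬ R.Dead q := fun hd => by
    cases hd with
    | mk hd => exact hl₁ (hd _ _ he₁)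
  have hval : ∀ i, (Dart.mk hq i).1 = (p, i % D.sides q.typ) := fun i => by
    rw [← h.candidate.typ]; rfl
  have htx : I.Track R (-1) w (Dart.mk hq i₁).1 [(q, i₁ % D.sides q.typ)] := by
    rw [hval]
    refine .live hat hq hlive (SafeAt.congr hW hmem (i := i₁) ?_ ?_)
    · rw [h.candidate.typ]; exact (Int.mod_modEq _ _).symm
    · refine ⟨0, by simpa using ⟨q₁, he₁, hl₁⟩, fun m hm => ?_⟩
      rw [Nat.le_zero.1 hm]; simp [he₁]
  have hty : I.Track R 1 (I.s.rot 1 w) (Dart.mk hq (i₁ + 1)).1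
      [(q, (i₁ + 1) % D.sides q.typ)] := by
    rw [hval]
    have hat' := hat.rot 1
    rw [Int.emod_add_emod] at hat'
    refine .live hat' hq hlive (SafeAt.congr hW hmem (i := i₁ + 1) ?_ ?_)
    · rw [h.candidate.typ]; exact (Int.mod_modEq _ _).symm
    · obtain ⟨k, hk⟩ := Int.eq_ofNat_of_zero_le (show 0 ≤ i₂ - (i₁ + 1) by omega)
      refine ⟨k, by rw [show i₁ + 1 + 1 * (k : ℤ) = i₂ by omega]; exact hl₂, fun m hm => ?_⟩
      by_cases hmk : i₁ + 1 + 1 * (m : ℤ) < i₂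
      · exact (hbet _ (by omega) hmk).2
      · rw [show i₁ + 1 + 1 * (m : ℤ) = i₂ by omega]
        obtain ⟨q₂, he₂, -⟩ := hl₂
        rw [he₂]; simp
  have hrot : Dart.rot R (Dart.mk hq i₁) = Dart.mk hq (i₁ + 1) := Dart.rot_mk hq i₁
  obtain ⟨off, hox⟩ : ∃ off, I.Offset R off w (Dart.mk hq i₁) := by
    have hch := h.childEdge_of_rule (q' := q₁) hmem hat (by
      rw [← h.candidate.typ, hW.e_emod hmem, he₁])
    obtain ⟨w', hf, hp⟩ := hch
    obtain ⟨-, k, -, hk⟩ := h.childEdge hat.1 ⟨w', hf, hp⟩ hf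
    exact ⟨_, k, hk, rfl⟩
  have hoy := offset_rot (R := R) 1 hox
  rw [← Dart.rot_apply, hrot] at hoy
  obtain ⟨xa, h1, h2, h3, h4⟩ := h.look (by norm_num) hla ⟨_, htx⟩ hox
  obtain ⟨yb, h5, h6, h7, h8⟩ := h.look (by norm_num) hlb ⟨_, hty⟩ hoy
  obtain ⟨c₁, h1⟩ := h1.joint_left
  obtain ⟨c₂, h5⟩ := h5.joint_right
  rw [hrot] at h1
  obtain ⟨x', y', c, m, c', m', h9, h10, h11⟩ := h.synced_of_examine he hV h2 h6 h3 h7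
    (fun ht => h4.elim ht.not_left ht.not_right) (fun ht => h8.elim ht.not_left ht.not_right)
    (h1.trans h5)
  obtain ⟨m₁, h12⟩ := h1.balanced
  obtain ⟨m₂, h13⟩ := h5.balanced
  exact ⟨x', y', _, _, _, _, h9, h10.trans h12, h13.trans h11⟩

variable (h) in
include h in
/-- A candidate that passes the validation generates `C`. -/
theorem isGRTSFor (hD : D.Consistent) (hv : I.Validates S R) : R.IsGRTSFor C d₀ := by
  obtain ⟨hlive, ws, hall, -, hws⟩ := hv
  obtain ⟨Vf, -, hVf, hstart⟩ := hall.continued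
  refine h.wellFormed.isGRTSFor_of_walls hD ?_ hlive (h.Synced Vf) (fun a b hab => hab.1)
    (fun a b hab => ?_) fun p q hq i₁ i₂ hb => ?_
  · rw [h.candidate.typ, h.candidate.root.2.1]; exact h.root_edge
  · exact h.synced_next (fun l hl => (hVf l hl).resolve_left fun h' => h'.elim) hab
  · obtain ⟨w, hw, -, hat⟩ := hws q (h.wellFormed.stateAt_mem hq) i₁ i₂ hb
    obtain ⟨a, b, V₁, V₂, h1, h2, h3, h4⟩ := hstart w hw
    exact h.synced_start hq hb hat h1 h2 h3 h4

end Info.Successful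

theorem mainTheorem3 (D : ATD) (hD : D.Consistent) (C : Tessellation D) (t₀ : D.T) (d₀ : C.Dart)
    (hd₀ : C.lab d₀ = D.edge t₀ 0) (R : RTS D (Code D)) (hR : AlgorithmReturns D t₀ R) :
    R.IsGRTSFor C d₀ := by
  obtain ⟨A, hA, hstable, -, I, hs, hr, hvalid, -, hclosed, -, hcand, hval⟩ := hR
  obtain ⟨⟨ψ, hsound⟩, hS, hrules⟩ := Config.invariant hd₀ hA
  rw [← hs] at hsound hstable
  rw [← hr] at hrules
  have hroot : C.lab d₀ = D.edge (I.s.ty I.s.rootWalker.1) 0 := by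
    have h1 := hsound.lab_pos hsound.isWalker_rootWalker.1.1
    rw [hsound.pos_rootWalker, hd₀] at h1
    rw [hd₀, show I.s.ty I.s.rootWalker.1 = t₀ from (congrArg Sigma.fst h1).symm]
  exact Info.Successful.isGRTSFor ⟨hsound, hstable, hvalid, hS, hrules, hclosed, hcand, hroot⟩
    hD hval
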